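/- **Setting.** Fix integers $r\ge 1$, $\beta\ge 0$. For each $n$ let $(Q_{k,n})_{k\ge 0}$ be monic polynomials, $\deg Q_{k,n}=k$, generated by a recurrence $$x\,(Q_{0,n}(x),Q_{1,n}(x),\dots)^T=J_n\,(Q_{0,n}(x),Q_{1,n}(x),\dots)^T,$$ where $J_n$ is a semi-infinite unit lower Hessenberg matrix (entries $1$ on the first superdiagonal, $0$ above it). Partition $J_n=(A_{k,n}^{(k-l)})_{k,l\ge 0}$ into $r\times r$ blocks and suppose that $A_{k,n}^{(j)}=0$ for $j>\beta$ and that $J_n$ has locally block Toeplitz structure: for all $s\ge 0$ and $j=-1,0,\dots,\beta$ the entrywise limits $$A_s^{(j)}=\lim_{rk/n\to s}A_{k,n}^{(j)}$$ exist, where $k,n\to\infty$ in such a way that $rk/n\to s$. Put $$A_s(z)=\sum_{j=-1}^{\beta}A_s^{(j)}z^j,\qquad f_s(z,x)=\det(A_s(z)-xI_r).$$ For $x\in\mathbb C$ let $z_1(x,s),z_2(x,s),\dots$ be the roots $z\in\mathbb C\setminus\{0\}$ of $f_s(z,x)=0$, counted with multiplicity and ordered so that $0<|z_1(x,s)|\le|z_2(x,s)|\le\cdots$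 (ties are labelled arbitrarily), and let $$\Gamma_1(s)=\{x\in\mathbb C: |z_1(x,s)|=|z_2(x,s)|\},$$ that is, the set of $x$ for which there are at least two roots and the first two have equal modulus. Assume that for all $0<s<1$ and $x\in\mathbb C$ the equation $f_s(z,x)=0$ has at least one root $z\in\mathbb C\setminus\{0\}$, so that $z_1(x,s)$ is defined. If $\Gamma_1(s)\subset\mathbb R$, let $\mu_1^s$ be the measure on $\Gamma_1(s)$ with density $$\frac{d\mu_1^s(x)}{dx}=\frac1r\,\frac1{2\pi i}\left(\frac{z_{1+}'(x,s)}{z_{1+}(x,s)}-\frac{z_{1-}'(x,s)}{z_{1-}(x,s)}\right),$$ where the prime is the derivative in $x$ and $\pm$ denote boundary values from the upper and lower half plane (they exist for all but finitely many $x$ when $0<s<1$). **Theorem.** Assume that for each $n$ the sequence $(Q_{k,n})_k$ has real and interlacing zeros, i.e. $Q_{k,n}$ has $k$ distinct real zeros $x_1^{k,n}<\dots<x_k^{k,n}$, and $x_j^{k,n}<x_j^{k-1,n}<x_{j+1}^{k,n}$ for $1\le j\le k-1$. Assume also that $\Gamma_1(s)\subset\mathbb R$ for every $s\ge 0$. Then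 $\nu_1=\int_0^1\mu_1^s\,ds$ is a probability measure and, as $n\to\infty$, the normalized zero counting measures $$\rho_n=\frac1n\sum_{j=1}^n\delta_{x_j^{n,n}}$$ of $Q_{n,n}$ converge weakly to $\nu_1$: $\int\varphi\,d\rho_n\to\int\varphi\,d\nu_1$ for every bounded continuous $\varphi:\mathbb R\to\mathbb R$. -/

import Mathlib

open Filter Topology MeasureTheory Polynomial
open scoped BoundedContinuousFunction

noncomputable section

namespace BlockToeplitz

/-- The monic polynomials `Q 0, Q 1, …` (with `deg (Q k) = k`) are generated by the semi-infinite
matrix `J`: `x (Q 0, Q 1, …)ᵀ = J (Q 0, Q 1, …)ᵀ`.  Here `J` is unit lower Hessenberg, and, when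
partitioned into `r × r` blocks, it has no nonzero block below its `β`-th block subdiagonal. -/
structure IsGeneratedBy (r β : ℕ) (J : ℕ → ℕ → ℂ) (Q : ℕ → ℂ[X]) : Prop where
  monic : ∀ k, (Q k).Monic
  natDegree_eq : ∀ k, (Q k).natDegree = k
  upper_zero : ∀ i j, i + 1 < j → J i j = 0
  superdiag_one : ∀ i, J i (i + 1) = 1
  banded : ∀ i j, j / r + β < i / r → J i j = 0
  /-- Row `i` of the matrix relation; the entries of row `i` to the right of column `i + 1`
  vanish. -/
  recurrence : ∀ i, X * Q i = ∑ j ∈ Finset.range (i + 2), C (J i j) * Q j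

/-- The `r × r` block `A_k^{(j)}` of `J`, in block row `k` and block column `k - j`.
(It is only meaningful for `j ≤ k`; only the behaviour as `k → ∞` matters.) -/
def block (r : ℕ) (J : ℕ → ℕ → ℂ) (k : ℕ) (j : ℤ) : Matrix (Fin r) (Fin r) ℂ :=
  Matrix.of fun a b => J (r * k + a) (r * ((k : ℤ) - j).toNat + b)

/-- The filter of pairs `(k, n)` describing `lim_{rk/n → s}`: both `k` and `n` tend to infinity, and
`r k / n` tends to `s`. -/
def ratioFilter (r : ℕ) (s : ℝ) : Filter (ℕ × ℕ) :=
  (atTop ×ˢ atTop) ⊓ comap (fun p : ℕ × ℕ => (r : ℝ) * p.1 / p.2) (𝓝 s)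

/-- The matrices `J n` have locally block Toeplitz structure with limits
`A s j = lim_{rk/n → s} A_{k,n}^{(j)}` (entrywise) for `s ≥ 0` and `j = -1, 0, …, β`. -/
def IsLocallyBlockToeplitz (r β : ℕ) (J : ℕ → ℕ → ℕ → ℂ)
    (A : ℝ → ℤ → Matrix (Fin r) (Fin r) ℂ) : Prop :=
  ∀ s : ℝ, 0 ≤ s → ∀ j ∈ Finset.Icc (-1 : ℤ) β, ∀ a b : Fin r,
    Tendsto (fun p : ℕ × ℕ => block r (J p.2) p.1 j a b) (ratioFilter r s) (𝓝 (A s j a b))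

/-- The polynomials `Q 0, Q 1, …` have real and interlacing zeros, the zeros of `Q k` being
`x k 0 < x k 1 < ⋯ < x k (k - 1)`. -/
structure HasInterlacingZeros (Q : ℕ → ℂ[X]) (x : (k : ℕ) → Fin k → ℝ) : Prop where
  strictMono : ∀ k, StrictMono (x k)
  isRoot : ∀ k j, (Q k).IsRoot (x k j : ℂ)
  interlacing : ∀ k (j : Fin k),
    x (k + 1) j.castSucc < x k j ∧ x k j < x (k + 1) j.succ

/-- The zero counting measure `(1 / n) ∑ δ_{x_j}` of `n` real points. -/
def countingMeasure {n : ℕ} (x : Fin n → ℝ) : Measure ℝ :=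
  (n : ENNReal)⁻¹ • ∑ j, Measure.dirac (x j)

section Symbol

/- In this section `A` is the family `A^{(-1)}, …, A^{(β)}` of block coefficients, for a fixed
value of `s`. -/
variable {r : ℕ} (β : ℕ) (A : ℤ → Matrix (Fin r) (Fin r) ℂ)

/-- The symbol `A(z) = A^{(-1)} z⁻¹ + A^{(0)} + ⋯ + A^{(β)} z^β`. -/
def symbol (z : ℂ) : Matrix (Fin r) (Fin r) ℂ :=
  ∑ j ∈ Finset.Icc (-1 : ℤ) β, z ^ j • A j

/-- `f(z, x) = det (A(z) - x I)`. -/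
def f (z x : ℂ) : ℂ := (symbol β A z - x • (1 : Matrix (Fin r) (Fin r) ℂ)).det

/-- The polynomial `det (z A(z) - x z I) = z ^ r f(z, x)` in the indeterminate `z`, for fixed `x`. -/
def rootPoly (x : ℂ) : ℂ[X] :=
  (∑ j ∈ Finset.Icc (-1 : ℤ) β, (X : ℂ[X]) ^ (j + 1).toNat • (A j).map (C : ℂ →+* ℂ[X])
    - (C x * X) • (1 : Matrix (Fin r) (Fin r) ℂ[X])).det

theorem eval_rootPoly (x : ℂ) {z : ℂ} (hz : z ≠ 0) :
    (rootPoly β A x).eval z = z ^ r * f β A z x := by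
  have h1 : z ^ r * f β A z x
      = (z • (symbol β A z - x • (1 : Matrix (Fin r) (Fin r) ℂ))).det := by
    rw [Matrix.det_smul, Fintype.card_fin, f]
  rw [h1, rootPoly, ← coe_evalRingHom, RingHom.map_det]
  congr 1
  ext a b
  simp only [symbol, RingHom.mapMatrix_apply, Matrix.map_apply, Matrix.sub_apply,
    Matrix.sum_apply, Matrix.smul_apply, smul_eq_mul, map_sub, map_sum,
    coe_evalRingHom, mul_sub, Finset.mul_sum]
  congr 1
  · refine Finset.sum_congr rfl fun j hj => ?_
    have h2 : ((j + 1).toNat : ℤ) = j + 1 :=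
      Int.toNat_of_nonneg (by have := (Finset.mem_Icc.mp hj).1; omega)
    have h3 : z ^ (j + 1).toNat = z * z ^ j := by
      rw [← zpow_natCast, h2, zpow_add₀ hz, zpow_one, mul_comm]
    rw [eval_mul, eval_pow, eval_X]
    erw [eval_C]
    rw [h3, mul_assoc]
  · rw [Matrix.one_apply, Matrix.one_apply]
    split_ifs <;> (simp; try ring)

open Classical in
/-- The multiset of the roots `z ∈ ℂ \ {0}` of `f(z, x) = 0`, counted with multiplicity. -/
def roots (x : ℂ) : Multiset ℂ := (rootPoly β A x).roots.filter (fun z => z ≠ 0)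

/-- The set `Γ₁` of all `x ∈ ℂ` with `|z₁(x)| = |z₂(x)|`, where `z₁(x), z₂(x), …` are the roots of
`f(z, x) = 0`, counted with multiplicity and ordered by increasing modulus. -/
def Gamma1 : Set ℂ :=
  {x | ∃ (z₁ z₂ : ℂ) (m : Multiset ℂ), roots β A x = z₁ ::ₘ z₂ ::ₘ m ∧ ‖z₁‖ = ‖z₂‖ ∧
    ∀ w ∈ m, ‖z₂‖ ≤ ‖w‖}

open Classical in
/-- The root `z₁(x)` of `f(z, x) = 0` of smallest modulus (an arbitrary one, if there are several
such roots). -/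
def z1 (x : ℂ) : ℂ :=
  if h : ∃ z ∈ roots β A x, ∀ w ∈ roots β A x, ‖z‖ ≤ ‖w‖ then h.choose else 0

/-- The boundary value at `x ∈ ℝ` of a function `g`, from the upper half plane. -/
def upperValue (g : ℂ → ℂ) (x : ℝ) : ℂ := limUnder (𝓝[{w : ℂ | 0 < w.im}] (x : ℂ)) g

/-- The boundary value at `x ∈ ℝ` of a function `g`, from the lower half plane. -/
def lowerValue (g : ℂ → ℂ) (x : ℝ) : ℂ := limUnder (𝓝[{w : ℂ | w.im < 0}] (x : ℂ)) g

/-- `(1 / r) (1 / (2 π i)) (z₁₊' / z₁₊ - z₁₋' / z₁₋)` at the point `x ∈ ℝ`. -/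
def density (x : ℝ) : ℂ :=
  1 / (r : ℂ) * (1 / (2 * Real.pi * Complex.I)) *
    (upperValue (deriv (z1 β A)) x / upperValue (z1 β A) x
      - lowerValue (deriv (z1 β A)) x / lowerValue (z1 β A) x)

/-- The measure `μ₁` on `Γ₁ ⊂ ℝ` with the above density (whose values are real and nonnegative). -/
def mu1 : Measure ℝ :=
  (volume.restrict {x : ℝ | (x : ℂ) ∈ Gamma1 β A}).withDensity
    fun x => ENNReal.ofReal (density β A x).re

end Symbol

/-- The average `ν₁ = ∫₀¹ μ₁^s ds`, i.e. `ν₁ B = ∫₀¹ μ₁^s B ds`. -/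
def nu1 {r : ℕ} (β : ℕ) (A : ℝ → ℤ → Matrix (Fin r) (Fin r) ℂ) : Measure ℝ :=
  Measure.bind (volume.restrict (Set.Icc (0 : ℝ) 1)) fun s => mu1 β (A s)

end BlockToeplitz

end

noncomputable section

namespace BlockToeplitz

/-! Interlacing makes each ratio Q_i/Q_{i+1} the Stieltjes transform of a discrete probability
measure. Such functions satisfy inequalities on the upper half plane (`IsStieltjesLike`) that bound
them uniformly and survive pointwise limits.

Fix 0 < s < 1. Along any ultrafilter with rk/n → s, the ratios around row rk converge to functions
U_i, i ∈ ℤ, solving the ratio form of the recurrence of the limiting block Toeplitz matrix. Where Im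
x is large, a contraction argument leaves only one small solution, and the identity theorem extends
uniqueness to the half plane. So the ratios converge (`exists_isLimitRatio`), and U is r-periodic in
i. The product ζ = U_0⋯U_{r-1} is the inverse Floquet multiplier of a solution of the recurrence,
hence f(ζ(x), x) = 0. For large |x| at most one root lies in the unit disk, so ζ is the smallest
root far up the imaginary axis; as Γ₁ ⊂ ℝ, it remains so on the whole half plane
(`isMinRoot_periodProd`), that is, ζ = z₁.

Each U_p has values in the lower half plane, so L = -∑ log U_p satisfies 0 ≤ Im L ≤ πr. It extends
continuously to ℝ, and since ζ is algebraic, the boundary value of Im L/(πr), the `phase`, has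
derivative minus the density of μ₁ off a finite set. Minimality of ζ makes the density nonnegative;
conjugation symmetry makes it vanish off Γ₁. So -`phase` is a distribution function of μ₁
(`mu1_Ioc`). A maximum principle then identifies the Stieltjes transform of μ₁ with L'/r = -(1/r) ∑
U_p'/U_p (`integral_inv_sub_mu1`), and its behaviour at i∞ shows that μ₁ has mass one.

Finally Q_n'/Q_n telescopes into minus the sum of the logarithmic derivatives of the ratios with i <
n. Divided by n this is, up to O(1/n), the integral over s of block averages, which converge to the
transform of μ₁^s by the ratio asymptotics. Dominated convergence gives convergence of Stieltjes
transforms to that of ν₁; Poisson smoothing and Scheffé's lemma turn this into weak convergence. -/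

/-- The open upper half plane. -/
def upperHalf : Set ℂ := {w : ℂ | 0 < w.im}

theorem mem_upperHalf {z : ℂ} : z ∈ upperHalf ↔ 0 < z.im := Iff.rfl

theorem isOpen_upperHalf : IsOpen upperHalf := isOpen_lt continuous_const Complex.continuous_im

theorem convex_upperHalf : Convex ℝ upperHalf := convex_halfSpace_im_gt 0

theorem isPreconnected_upperHalf : IsPreconnected upperHalf := convex_upperHalf.isPreconnected

theorem sub_ofReal_ne_zero {z : ℂ} (hz : 0 < z.im) (t : ℝ) : z - t ≠ 0 := by
  intro h
  have := congrArg Complex.im h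
  simp at this
  exact hz.ne' this

theorem im_le_norm_sub_ofReal (z : ℂ) (t : ℝ) : |z.im| ≤ ‖z - t‖ := by
  simpa using Complex.abs_im_le_norm (z - t)

theorem neg_im_inv_sub_ofReal (z : ℂ) (t : ℝ) :
    -((z - t)⁻¹).im = z.im * (‖z - t‖⁻¹) ^ 2 := by
  rw [Complex.inv_im, Complex.normSq_eq_norm_sq]
  simp only [Complex.sub_im, Complex.ofReal_im, sub_zero, inv_pow]
  ring

/-! ### Stieltjes transforms of finitely supported measures. -/

section StieltjesSum

variable {m : ℕ} {w t : Fin m → ℝ}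

theorem neg_im_sum_inv_sub (w t : Fin m → ℝ) (z : ℂ) :
    -(∑ j, (w j : ℂ) * (z - t j)⁻¹).im = z.im * ∑ j, w j * (‖z - t j‖⁻¹) ^ 2 := by
  rw [Complex.im_sum, Finset.mul_sum, ← Finset.sum_neg_distrib]
  refine Finset.sum_congr rfl fun j _ => ?_
  rw [Complex.im_ofReal_mul, ← mul_neg, neg_im_inv_sub_ofReal]
  ring

/-- Jensen's inequality for the square: the squared modulus is at most ∑ w_j |z - t_j|⁻², and Im z
times that sum is exactly the right-hand side. -/
theorem im_mul_norm_sq_sum_inv_sub_le (hw : ∀ j, 0 ≤ w j) (hw1 : ∑ j, w j = 1) {z : ℂ}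
    (hz : 0 < z.im) :
    z.im * ‖∑ j, (w j : ℂ) * (z - t j)⁻¹‖ ^ 2 ≤ -(∑ j, (w j : ℂ) * (z - t j)⁻¹).im := by
  rw [neg_im_sum_inv_sub]
  refine mul_le_mul_of_nonneg_left ?_ hz.le
  have h1 : ‖∑ j, (w j : ℂ) * (z - t j)⁻¹‖ ≤ ∑ j, w j * ‖z - t j‖⁻¹ := by
    refine (norm_sum_le _ _).trans (le_of_eq (Finset.sum_congr rfl fun j _ => ?_))
    rw [norm_mul, norm_inv, Complex.norm_real, Real.norm_of_nonneg (hw j)]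
  calc _ ≤ (∑ j, w j * ‖z - t j‖⁻¹) ^ 2 := by gcongr
    _ ≤ _ := Real.pow_arith_mean_le_arith_mean_pow _ _ _ (fun j _ => hw j) hw1
        (fun j _ => by positivity) 2

theorem hasDerivAt_sum_inv_sub (w t : Fin m → ℝ) {z : ℂ} (hz : 0 < z.im) :
    HasDerivAt (fun z : ℂ => ∑ j, (w j : ℂ) * (z - t j)⁻¹)
      (∑ j, (w j : ℂ) * (-1 / (z - t j) ^ 2)) z := by
  refine HasDerivAt.fun_sum fun j _ => HasDerivAt.const_mul _ ?_
  exact ((hasDerivAt_id z).sub_const _).fun_inv (sub_ofReal_ne_zero hz _)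

/-- The triangle inequality bounds the derivative by the same sum ∑ w_j |z - t_j|⁻². -/
theorem im_mul_norm_deriv_sum_inv_sub_le (hw : ∀ j, 0 ≤ w j) {z : ℂ} (hz : 0 < z.im) :
    z.im * ‖deriv (fun z : ℂ => ∑ j, (w j : ℂ) * (z - t j)⁻¹) z‖
      ≤ -(∑ j, (w j : ℂ) * (z - t j)⁻¹).im := by
  rw [neg_im_sum_inv_sub, (hasDerivAt_sum_inv_sub w t hz).deriv]
  refine mul_le_mul_of_nonneg_left ?_ hz.le
  refine (norm_sum_le _ _).trans (le_of_eq (Finset.sum_congr rfl fun j _ => ?_))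
  rw [norm_mul, norm_div, norm_neg, norm_one, norm_pow, Complex.norm_real,
    Real.norm_of_nonneg (hw j), one_div, inv_pow]

end StieltjesSum

/-! ### Interlacing and ratios of consecutive polynomials. -/

section Interlacing

variable {Q : ℕ → ℂ[X]} {x : (k : ℕ) → Fin k → ℝ}

theorem HasInterlacingZeros.eq_prod (hx : HasInterlacingZeros Q x) (hm : ∀ k, (Q k).Monic)
    (hd : ∀ k, (Q k).natDegree = k) (k : ℕ) : Q k = ∏ j, (X - C (x k j : ℂ)) := by
  have hinj : Function.Injective fun j => (x k j : ℂ) :=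
    Complex.ofReal_injective.comp (hx.strictMono k).injective
  have hdvd : ∏ j, (X - C (x k j : ℂ)) ∣ Q k := by
    refine Finset.prod_dvd_of_coprime ?_ fun j _ => dvd_iff_isRoot.mpr (hx.isRoot k j)
    intro i _ j _ hij
    exact pairwise_coprime_X_sub_C hinj hij
  refine (eq_of_monic_of_dvd_of_natDegree_le (monic_prod_of_monic _ _ fun j _ =>
    monic_X_sub_C _) (hm k) hdvd ?_)
  rw [natDegree_prod_of_monic _ _ fun j _ => monic_X_sub_C _, hd]
  simp

/-- Partial fractions: the weights are the residues Q_k(y_j)/Q_{k+1}'(y_j) at the zeros y_j of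
Q_{k+1}. -/
theorem HasInterlacingZeros.exists_weights (hx : HasInterlacingZeros Q x) (hm : ∀ k, (Q k).Monic)
    (hd : ∀ k, (Q k).natDegree = k) (k : ℕ) :
    ∃ w : Fin (k + 1) → ℝ, (∀ j, 0 ≤ w j) ∧ ∑ j, w j = 1 ∧
      ∀ z : ℂ, 0 < z.im → (Q k).eval z / (Q (k + 1)).eval z
        = ∑ j, (w j : ℂ) * (z - x (k + 1) j)⁻¹ := by
  have hQ := hx.eq_prod hm hd
  set y := x (k + 1) with hy
  have hymono := hx.strictMono (k + 1)
  have hinj : Set.InjOn (fun j => (y j : ℂ)) (Finset.univ : Finset (Fin (k + 1))) :=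
    (Complex.ofReal_injective.comp hymono.injective).injOn
  -- Pairing x_i with y_{j.succAbove i} puts both points on the same side of y_j, so interlacing
  -- makes every single factor nonnegative.
  let w : Fin (k + 1) → ℝ := fun j => ∏ i : Fin k, (y j - x k i) / (y j - y (j.succAbove i))
  have herase : ∀ j : Fin (k + 1), ∏ i ∈ Finset.univ.erase j, ((y j : ℂ) - y i)
      = ∏ i : Fin k, ((y j : ℂ) - y (j.succAbove i)) := by
    intro j
    have h := Fin.prod_univ_succAbove (fun i => if i = j then (1 : ℂ) else (y j : ℂ) - y i) j
    simp only [if_true, Fin.succAbove_ne, if_false, one_mul] at h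
    rw [← h, ← Finset.mul_prod_erase _ _ (Finset.mem_univ j), if_pos rfl, one_mul]
    exact Finset.prod_congr rfl fun i hi => by rw [if_neg (Finset.ne_of_mem_erase hi)]
  have hw : ∀ j, ((w j : ℝ) : ℂ)
      = (Q k).eval (y j : ℂ) / ∏ i ∈ Finset.univ.erase j, ((y j : ℂ) - y i) := by
    intro j
    rw [herase, hQ k, eval_prod]
    simp only [w, eval_sub, eval_X, eval_C]
    push_cast
    rw [Finset.prod_div_distrib]
  have hdeg : (Q k).degree < (Finset.univ : Finset (Fin (k + 1))).card := by
    rw [degree_eq_natDegree (hm k).ne_zero, hd k, Finset.card_univ, Fintype.card_fin]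
    exact_mod_cast Nat.lt_succ_self k
  refine ⟨w, fun j => ?_, ?_, fun z hz => ?_⟩
  · refine Finset.prod_nonneg fun i _ => ?_
    rcases lt_or_ge i.castSucc j with h | h
    · rw [Fin.succAbove_of_castSucc_lt _ _ h]
      have h1 := (hx.interlacing k i).2
      have h2 : y i.succ ≤ y j := hymono.monotone (Fin.castSucc_lt_iff_succ_le.mp h)
      have h3 := hymono h
      exact div_nonneg (by linarith) (by linarith)
    · rw [Fin.succAbove_of_le_castSucc _ _ h]
      have h1 := (hx.interlacing k i).1
      have h2 : y j ≤ y i.castSucc := hymono.monotone h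
      have h3 : y j < y i.succ := hymono (lt_of_le_of_lt h Fin.castSucc_lt_succ)
      exact div_nonneg_of_nonpos (by linarith) (by linarith)
  -- The weights sum to the coefficient of X^k in the Lagrange interpolant of Q_k, which is 1
  -- because Q_k is monic.
  · have h := Lagrange.coeff_eq_sum hinj hdeg
    simp only [Finset.card_univ, Fintype.card_fin, Nat.add_sub_cancel] at h
    have h1 : (Q k).coeff k = 1 := by
      have := (hm k).coeff_natDegree
      rwa [hd k] at this
    rw [h1] at h
    have : ((∑ j, w j : ℝ) : ℂ) = ((1 : ℝ) : ℂ) := by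
      rw [Complex.ofReal_sum, Complex.ofReal_one, h]
      exact Finset.sum_congr rfl fun j _ => hw j
    exact_mod_cast this
  · have hne : ∀ i ∈ (Finset.univ : Finset (Fin (k + 1))), z ≠ (y i : ℂ) :=
      fun i _ => sub_ne_zero.mp (sub_ofReal_ne_zero hz _)
    have hnod : (Q (k + 1)).eval z = (Lagrange.nodal Finset.univ fun j => (y j : ℂ)).eval z := by
      rw [hQ (k + 1), Lagrange.nodal_eq]
    have hnz : (Lagrange.nodal Finset.univ fun j => (y j : ℂ)).eval z ≠ 0 := by
      rw [Lagrange.eval_nodal]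
      exact Finset.prod_ne_zero_iff.mpr fun i hi => sub_ne_zero.mpr (hne i hi)
    rw [hnod, div_eq_iff hnz, mul_comm]
    conv_lhs => rw [Lagrange.eq_interpolate hinj hdeg]
    rw [Lagrange.eval_interpolate_not_at_node _ hne]
    congr 1
    refine Finset.sum_congr rfl fun j _ => ?_
    rw [hw j, Lagrange.nodalWeight, Finset.prod_inv_distrib]
    ring

/-- The ratio `Q i / Q (i + 1)`. -/
def ratio (Q : ℕ → ℂ[X]) (i : ℕ) (z : ℂ) : ℂ := (Q i).eval z / (Q (i + 1)).eval z

theorem HasInterlacingZeros.eval_ne_zero (hx : HasInterlacingZeros Q x) (hm : ∀ k, (Q k).Monic)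
    (hd : ∀ k, (Q k).natDegree = k) (k : ℕ) {z : ℂ} (hz : 0 < z.im) : (Q k).eval z ≠ 0 := by
  rw [hx.eq_prod hm hd k, eval_prod]
  refine Finset.prod_ne_zero_iff.mpr fun i _ => ?_
  simpa using sub_ofReal_ne_zero hz _

/-- The class of analytic functions on the upper half plane containing the Stieltjes transforms of
probability measures. -/
structure IsStieltjesLike (u : ℂ → ℂ) : Prop where
  differentiableOn : DifferentiableOn ℂ u upperHalf
  norm_sq_le : ∀ z, 0 < z.im → z.im * ‖u z‖ ^ 2 ≤ -(u z).im
  norm_deriv_le : ∀ z, 0 < z.im → z.im * ‖deriv u z‖ ≤ -(u z).im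

theorem HasInterlacingZeros.isStieltjesLike_ratio (hx : HasInterlacingZeros Q x)
    (hm : ∀ k, (Q k).Monic) (hd : ∀ k, (Q k).natDegree = k) (i : ℕ) :
    IsStieltjesLike (ratio Q i) := by
  obtain ⟨w, hw, hw1, h⟩ := hx.exists_weights hm hd i
  have heq : Set.EqOn (ratio Q i) (fun z : ℂ => ∑ j, (w j : ℂ) * (z - x (i + 1) j)⁻¹)
    upperHalf := fun z hz => h z hz
  refine ⟨?_, fun z hz => ?_, fun z hz => ?_⟩
  · refine DifferentiableOn.congr ?_ heq
    exact fun z hz => (hasDerivAt_sum_inv_sub _ _ hz).differentiableAt.differentiableWithinAt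
  · rw [heq hz]
    exact im_mul_norm_sq_sum_inv_sub_le hw hw1 hz
  · rw [heq hz, (heq.eventuallyEq_of_mem (isOpen_upperHalf.mem_nhds hz)).deriv_eq]
    exact im_mul_norm_deriv_sum_inv_sub_le hw hz

namespace IsStieltjesLike

variable {u : ℂ → ℂ} {z : ℂ}

theorem norm_le (hu : IsStieltjesLike u) (hz : 0 < z.im) : ‖u z‖ ≤ z.im⁻¹ := by
  have h1 := hu.norm_sq_le z hz
  have h2 : -(u z).im ≤ ‖u z‖ := (neg_le_abs _).trans (Complex.abs_im_le_norm _)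
  rcases (norm_nonneg (u z)).eq_or_lt with h | h
  · rw [← h]; positivity
  · rw [le_inv_comm₀ h hz]
    rw [← one_div, le_div_iff₀ h]
    have : z.im * ‖u z‖ * ‖u z‖ ≤ 1 * ‖u z‖ := by nlinarith
    exact le_of_mul_le_mul_right this h

theorem norm_deriv_le_mul (hu : IsStieltjesLike u) (hz : 0 < z.im) :
    z.im * ‖deriv u z‖ ≤ ‖u z‖ :=
  (hu.norm_deriv_le z hz).trans ((neg_le_abs _).trans (Complex.abs_im_le_norm _))

/-- Serves as the dominating constant in the averaging over s; if u vanishes at z, the quotient is 0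
by convention. -/
theorem norm_logDeriv_le (hu : IsStieltjesLike u) (hz : 0 < z.im) :
    ‖deriv u z / u z‖ ≤ z.im⁻¹ := by
  have h1 := hu.norm_deriv_le_mul hz
  rcases (norm_nonneg (u z)).eq_or_lt with h | h
  · rw [norm_div, ← h, div_zero]; positivity
  · rw [norm_div, div_le_iff₀ h, inv_mul_eq_div, le_div_iff₀ hz]
    linarith

end IsStieltjesLike

end Interlacing

/-! ### Limits within the Stieltjes class. -/

namespace IsStieltjesLike

/-- The Lipschitz constant depends on δ only, not on u. This equicontinuity upgrades pointwise to
locally uniform convergence, for arbitrary filters and without extracting subsequences. -/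
theorem norm_sub_apply_le {u : ℂ → ℂ} (hu : IsStieltjesLike u) {δ : ℝ} (hδ : 0 < δ) {z w : ℂ}
    (hz : δ < z.im) (hw : δ < w.im) : ‖u w - u z‖ ≤ (δ⁻¹) ^ 2 * ‖w - z‖ := by
  have hconv : Convex ℝ {w : ℂ | δ < w.im} := convex_halfSpace_im_gt δ
  refine hconv.norm_image_sub_le_of_norm_deriv_le (𝕜 := ℂ) (fun v hv => ?_) (fun v hv => ?_) hz hw
  · have hv0 : 0 < v.im := hδ.trans hv
    exact (hu.differentiableOn v hv0).differentiableAt (isOpen_upperHalf.mem_nhds hv0)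
  · have hv1 : δ < v.im := hv
    have hv0 : 0 < v.im := hδ.trans hv
    have h1 := hu.norm_deriv_le_mul hv0
    have h2 := hu.norm_le hv0
    have h3 : v.im⁻¹ ≤ δ⁻¹ := inv_anti₀ hδ hv1.le
    have h4 : ‖deriv u v‖ ≤ v.im⁻¹ * ‖u v‖ := by
      rw [inv_mul_eq_div, le_div_iff₀ hv0]; linarith
    calc ‖deriv u v‖ ≤ v.im⁻¹ * ‖u v‖ := h4
      _ ≤ δ⁻¹ * δ⁻¹ := by
        have := norm_nonneg (u v)
        gcongr
        exact h2.trans h3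
      _ = _ := by ring

variable {ι : Type*} {l : Filter ι} {F : ι → ℂ → ℂ} {u : ℂ → ℂ}

theorem tendstoLocallyUniformlyOn [l.NeBot] (hF : ∀ i, IsStieltjesLike (F i))
    (h : ∀ z, 0 < z.im → Tendsto (fun i => F i z) l (𝓝 (u z))) :
    TendstoLocallyUniformlyOn F u l upperHalf := by
  rw [Metric.tendstoLocallyUniformlyOn_iff]
  intro ε hε z hz
  have hz0 : 0 < z.im := hz
  set δ := z.im / 2 with hδ
  have hδ0 : 0 < δ := by positivity
  set K := (δ⁻¹) ^ 2 with hK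
  have hK0 : 0 < K := by positivity
  refine ⟨Metric.ball z (min δ (ε / (4 * K))),
    mem_nhdsWithin_of_mem_nhds (Metric.ball_mem_nhds z (by positivity)), ?_⟩
  have key : ∀ y ∈ Metric.ball z (min δ (ε / (4 * K))), δ < y.im ∧ ∀ i, ‖F i y - F i z‖ ≤ ε / 4 := by
    intro y hy
    rw [Metric.mem_ball, dist_eq_norm, lt_min_iff] at hy
    have hyim : δ < y.im := by
      have := (Complex.abs_im_le_norm (y - z)).trans_lt hy.1
      rw [Complex.sub_im] at this
      have := (abs_lt.mp this).1
      linarith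
    refine ⟨hyim, fun i => ((hF i).norm_sub_apply_le hδ0 (by linarith) hyim).trans ?_⟩
    have := hy.2.le
    rw [le_div_iff₀ (by positivity)] at this
    linarith
  filter_upwards [(Metric.tendsto_nhds.mp (h z hz)) (ε / 4) (by positivity)] with i hi y hy
  obtain ⟨hyim, hFy⟩ := key y hy
  have h1 : ‖u y - u z‖ ≤ ε / 4 :=
    le_of_tendsto ((h y (hδ0.trans hyim)).sub (h z hz)).norm (Eventually.of_forall hFy)
  have h2 := hFy i
  rw [dist_eq_norm] at hi ⊢
  have : u y - F i y = (u y - u z) - (F i y - F i z) - (F i z - u z) := by ring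
  rw [this]
  have h3 := norm_sub_le (u y - u z - (F i y - F i z)) (F i z - u z)
  have h4 := norm_sub_le (u y - u z) (F i y - F i z)
  linarith

theorem tendsto_deriv [l.NeBot] (hF : ∀ i, IsStieltjesLike (F i))
    (h : ∀ z, 0 < z.im → Tendsto (fun i => F i z) l (𝓝 (u z))) {z : ℂ} (hz : 0 < z.im) :
    Tendsto (fun i => deriv (F i) z) l (𝓝 (deriv u z)) :=
  ((tendstoLocallyUniformlyOn hF h).deriv
    (Eventually.of_forall fun i => (hF i).differentiableOn) isOpen_upperHalf).tendsto_at hz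

/-- All defining conditions are closed under locally uniform limits. Defining the class by
inequalities avoids constructing a representing measure for the limit. -/
theorem of_tendsto [l.NeBot] (hF : ∀ i, IsStieltjesLike (F i))
    (h : ∀ z, 0 < z.im → Tendsto (fun i => F i z) l (𝓝 (u z))) : IsStieltjesLike u where
  differentiableOn := (tendstoLocallyUniformlyOn hF h).differentiableOn
    (Eventually.of_forall fun i => (hF i).differentiableOn) isOpen_upperHalf
  norm_sq_le z hz := le_of_tendsto_of_tendsto (((h z hz).norm.pow 2).const_mul _)
    ((Complex.continuous_im.tendsto _).comp (h z hz)).neg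
    (Eventually.of_forall fun i => (hF i).norm_sq_le z hz)
  norm_deriv_le z hz := le_of_tendsto_of_tendsto ((tendsto_deriv hF h hz).norm.const_mul _)
    ((Complex.continuous_im.tendsto _).comp (h z hz)).neg
    (Eventually.of_forall fun i => (hF i).norm_deriv_le z hz)

end IsStieltjesLike

/-! ### The limiting recurrence and its ratio equation. -/

/-- The coefficients of a bi-infinite block Toeplitz matrix, periodic along diagonals with period
`r`, which is unit lower Hessenberg with bandwidth `m`. -/
structure IsPeriodicHessenberg (r m : ℕ) (a : ℤ → ℤ → ℂ) : Prop where
  periodic : ∀ i j : ℤ, a (i + r) (j + r) = a i j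
  superdiag : ∀ i : ℤ, a i (i + 1) = 1
  upper : ∀ i j : ℤ, i + 1 < j → a i j = 0
  lower : ∀ i j : ℤ, j + m ≤ i → a i j = 0

/-- Solutions `q` of the bi-infinite recurrence `x q_i = q_{i+1} + ∑ a_{i,i-l} q_{i-l}`. -/
def IsSeqSolution (m : ℕ) (a : ℤ → ℤ → ℂ) (x : ℂ) (q : ℤ → ℂ) : Prop :=
  ∀ i, x * q i = q (i + 1) + ∑ l ∈ Finset.range m, a i (i - l) * q (i - l)

/-- The equation satisfied by the ratios `u_i = q_i / q_{i+1}` of solutions. -/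
def IsRatioSolution (m : ℕ) (a : ℤ → ℤ → ℂ) (x : ℂ) (u : ℤ → ℂ) : Prop :=
  ∀ i, x * u i = 1 + u i * ∑ l ∈ Finset.range m, a i (i - l) *
    ∏ p ∈ Finset.range l, u (i - 1 - p)

theorem norm_prod_sub_prod_le {u v : ℕ → ℂ} {D : ℝ} (hu : ∀ i, ‖u i‖ ≤ 1) (hv : ∀ i, ‖v i‖ ≤ 1)
    (h : ∀ i, ‖u i - v i‖ ≤ D) (l : ℕ) :
    ‖∏ p ∈ Finset.range l, u p - ∏ p ∈ Finset.range l, v p‖ ≤ l * D := by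
  induction l with
  | zero => simp
  | succ l ih =>
    rw [Finset.prod_range_succ, Finset.prod_range_succ]
    have : (∏ p ∈ Finset.range l, u p) * u l - (∏ p ∈ Finset.range l, v p) * v l
      = (∏ p ∈ Finset.range l, u p - ∏ p ∈ Finset.range l, v p) * u l
        + (∏ p ∈ Finset.range l, v p) * (u l - v l) := by ring
    rw [this]
    have h1 : ‖∏ p ∈ Finset.range l, v p‖ ≤ 1 := by
      rw [norm_prod]
      exact Finset.prod_le_one (fun _ _ => norm_nonneg _) fun i _ => hv i
    calc _ ≤ ‖∏ p ∈ Finset.range l, u p - ∏ p ∈ Finset.range l, v p‖ * ‖u l‖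
          + ‖∏ p ∈ Finset.range l, v p‖ * ‖u l - v l‖ := by
          refine (norm_add_le _ _).trans ?_
          rw [norm_mul, norm_mul]
      _ ≤ (l * D) * 1 + 1 * D := by
          have h0 : 0 ≤ D := (norm_nonneg _).trans (h 0)
          gcongr
          · exact hu l
          · exact h l
      _ = _ := by push_cast; ring

/-- The difference of two solutions bounded by κ contracts by the factor κ²Cm² < 1; iterating from
the trivial bound 2κ forces it to vanish. -/
theorem IsRatioSolution.eq_of_norm_le {m : ℕ} {a : ℤ → ℤ → ℂ} {x : ℂ} {u v : ℤ → ℂ} {C κ : ℝ}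
    (hu : IsRatioSolution m a x u) (hv : IsRatioSolution m a x v) (hC : ∀ i j, ‖a i j‖ ≤ C)
    (hκ1 : κ ≤ 1) (hκ : κ ^ 2 * (C * m ^ 2) < 1) (huκ : ∀ i, ‖u i‖ ≤ κ)
    (hvκ : ∀ i, ‖v i‖ ≤ κ) : u = v := by
  have hκ0 : 0 ≤ κ := (norm_nonneg _).trans (huκ 0)
  have hC0 : 0 ≤ C := (norm_nonneg _).trans (hC 0 0)
  set θ := κ ^ 2 * (C * m ^ 2) with hθ
  have hθ0 : 0 ≤ θ := by positivity
  have step : ∀ D : ℝ, (∀ i, ‖u i - v i‖ ≤ D) → ∀ i, ‖u i - v i‖ ≤ θ * D := by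
    intro D hD i
    have hD0 : 0 ≤ D := (norm_nonneg _).trans (hD 0)
    set S := ∑ l ∈ Finset.range m, a i (i - l) * ∏ p ∈ Finset.range l, u (i - 1 - p) with hS
    set S' := ∑ l ∈ Finset.range m, a i (i - l) * ∏ p ∈ Finset.range l, v (i - 1 - p) with hS'
    have h1 : x * u i = 1 + u i * S := hu i
    have h2 : x * v i = 1 + v i * S' := hv i
    -- Cross-multiplying the two equations eliminates x, so the contraction constant does not depend
    -- on x.
    have h3 : u i - v i = u i * v i * (S - S') := by
      linear_combination v i * h1 - u i * h2
    have h4 : ‖S - S'‖ ≤ C * m ^ 2 * D := by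
      rw [hS, hS', ← Finset.sum_sub_distrib]
      calc _ ≤ ∑ l ∈ Finset.range m, C * (m * D) := by
            refine norm_sum_le_of_le _ fun l hl => ?_
            rw [← mul_sub, norm_mul]
            have h5 := norm_prod_sub_prod_le (u := fun p => u (i - 1 - p))
              (v := fun p => v (i - 1 - p)) (fun p => (huκ _).trans hκ1)
              (fun p => (hvκ _).trans hκ1) (fun p => hD _) l
            have h6 : (l : ℝ) ≤ m := by exact_mod_cast (Finset.mem_range.mp hl).le
            refine mul_le_mul (hC _ _) (h5.trans (by gcongr)) (norm_nonneg _) hC0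
        _ = _ := by rw [Finset.sum_const, Finset.card_range, nsmul_eq_mul]; ring
    rw [h3, norm_mul, norm_mul]
    calc _ ≤ κ * κ * (C * m ^ 2 * D) := by
          gcongr
          · exact huκ i
          · exact hvκ i
      _ = θ * D := by rw [hθ]; ring
  have hpow : ∀ N : ℕ, ∀ i, ‖u i - v i‖ ≤ θ ^ N * (2 * κ) := by
    intro N
    induction N with
    | zero =>
      intro i
      rw [pow_zero, one_mul, two_mul]
      exact (norm_sub_le _ _).trans (add_le_add (huκ i) (hvκ i))
    | succ N ih =>
      intro i
      refine (step _ ih i).trans (le_of_eq ?_)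
      ring
  funext i
  rw [← sub_eq_zero, ← norm_le_zero_iff]
  have hlim : Tendsto (fun N : ℕ => θ ^ N * (2 * κ)) atTop (𝓝 (0 * (2 * κ))) :=
    (tendsto_pow_atTop_nhds_zero_of_lt_one hθ0 hκ).mul_const _
  rw [zero_mul] at hlim
  exact ge_of_tendsto' hlim fun N => hpow N i

theorem prod_ratio {q u : ℤ → ℂ} (hq : ∀ i, q (i + 1) * u i = q i) (i : ℤ) (l : ℕ) :
    q i * ∏ p ∈ Finset.range l, u (i - 1 - p) = q (i - l) := by
  induction l with
  | zero => simp
  | succ l ih =>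
    rw [Finset.prod_range_succ, ← mul_assoc, ih, ← hq (i - (l + 1 : ℕ))]
    push_cast
    congr 2 <;> ring

theorem IsSeqSolution.isRatioSolution {m : ℕ} {a : ℤ → ℤ → ℂ} {x : ℂ} {q u : ℤ → ℂ}
    (h : IsSeqSolution m a x q) (hq : ∀ i, q (i + 1) * u i = q i) (hq0 : ∀ i, q i ≠ 0) :
    IsRatioSolution m a x u := by
  intro i
  have h1 := h i
  have h2 : ∑ l ∈ Finset.range m, a i (i - l) * q (i - l)
      = q i * ∑ l ∈ Finset.range m, a i (i - l) * ∏ p ∈ Finset.range l, u (i - 1 - p) := by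
    rw [Finset.mul_sum]
    refine Finset.sum_congr rfl fun l _ => ?_
    rw [← prod_ratio hq i l]; ring
  rw [h2] at h1
  have h3 := hq i
  refine mul_left_cancel₀ (hq0 i) ?_
  linear_combination u i * h1 + h3

theorem IsRatioSolution.isSeqSolution {m : ℕ} {a : ℤ → ℤ → ℂ} {x : ℂ} {q u : ℤ → ℂ}
    (h : IsRatioSolution m a x u) (hq : ∀ i, q (i + 1) * u i = q i) :
    IsSeqSolution m a x q := by
  intro i
  have h1 := h i
  have h2 : ∑ l ∈ Finset.range m, a i (i - l) * q (i - l)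
      = q i * ∑ l ∈ Finset.range m, a i (i - l) * ∏ p ∈ Finset.range l, u (i - 1 - p) := by
    rw [Finset.mul_sum]
    refine Finset.sum_congr rfl fun l _ => ?_
    rw [← prod_ratio hq i l]; ring
  rw [h2]
  have h3 := hq i
  linear_combination q (i + 1) * h1 + (∑ l ∈ Finset.range m, a i (i - l) *
    ∏ p ∈ Finset.range l, u (i - 1 - p) - x) * h3

/-! ### Record indices: growth estimates for solutions. -/

section Records

variable {m r : ℕ} {a : ℤ → ℤ → ℂ} {x z : ℂ} {q : ℤ → ℂ} {C : ℝ}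

theorem norm_sum_le_of_record (hC : ∀ i j, ‖a i j‖ ≤ C) {i : ℤ} {N : ℝ}
    (h : ∀ j ≤ i, ‖q j‖ ≤ N) : ‖∑ l ∈ Finset.range m, a i (i - l) * q (i - l)‖ ≤ C * m * N := by
  have hC0 : 0 ≤ C := (norm_nonneg _).trans (hC 0 0)
  calc _ ≤ ∑ l ∈ Finset.range m, C * N := by
        refine norm_sum_le_of_le _ fun l _ => ?_
        rw [norm_mul]
        exact mul_le_mul (hC _ _) (h _ (by omega)) (norm_nonneg _) hC0
    _ = _ := by rw [Finset.sum_const, Finset.card_range, nsmul_eq_mul]; ring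

/-- At a record index, where |q_i| dominates all earlier values, the recurrence computes later
values from the past, so the running maximum grows by at most a fixed factor per step. -/
theorem IsSeqSolution.norm_le_pow (h : IsSeqSolution m a x q) (hC : ∀ i j, ‖a i j‖ ≤ C) {i : ℤ}
    (hi : ∀ j ≤ i, ‖q j‖ ≤ ‖q i‖) (p : ℕ) :
    ∀ j ≤ i + p, ‖q j‖ ≤ (‖x‖ + C * m + 1) ^ p * ‖q i‖ := by
  have hC0 : 0 ≤ C := (norm_nonneg _).trans (hC 0 0)
  induction p with
  | zero => simpa using hi
  | succ p ih =>
    intro j hj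
    set B := ‖x‖ + C * m + 1 with hB
    have hB1 : 1 ≤ B := by
      have := norm_nonneg x
      have : 0 ≤ C * m := by positivity
      linarith
    have hN0 : 0 ≤ B ^ p * ‖q i‖ := by positivity
    rcases (show j ≤ i + p ∨ j = i + p + 1 by push_cast at hj; omega) with hj | rfl
    · refine (ih j hj).trans ?_
      exact mul_le_mul_of_nonneg_right (pow_le_pow_right₀ hB1 p.le_succ) (norm_nonneg _)
    · have h1 := h (i + p)
      have h2 : q (i + p + 1) = x * q (i + p)
        - ∑ l ∈ Finset.range m, a (i + p) (i + p - l) * q (i + p - l) := by rw [h1]; ring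
      rw [h2]
      have h3 := norm_sum_le_of_record (m := m) hC ih
      have h4 := ih (i + p) le_rfl
      calc _ ≤ ‖x‖ * ‖q (i + p)‖ + C * m * (B ^ p * ‖q i‖) := by
            refine (norm_sub_le _ _).trans ?_
            rw [norm_mul]
            exact add_le_add le_rfl h3
        _ ≤ ‖x‖ * (B ^ p * ‖q i‖) + C * m * (B ^ p * ‖q i‖) + 1 * (B ^ p * ‖q i‖) := by
            have : ‖x‖ * ‖q (i + p)‖ ≤ ‖x‖ * (B ^ p * ‖q i‖) := by gcongr
            linarith
        _ = _ := by rw [pow_succ, hB]; ring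

theorem IsSeqSolution.norm_succ_ge (h : IsSeqSolution m a x q) (hC : ∀ i j, ‖a i j‖ ≤ C) {i : ℤ}
    (hi : ∀ j ≤ i, ‖q j‖ ≤ ‖q i‖) : (‖x‖ - C * m) * ‖q i‖ ≤ ‖q (i + 1)‖ := by
  have h1 := h i
  have h3 := norm_sum_le_of_record (m := m) hC hi
  have h4 : ‖x‖ * ‖q i‖ ≤ ‖q (i + 1)‖ + C * m * ‖q i‖ := by
    rw [← norm_mul, h1]
    exact (norm_add_le _ _).trans (add_le_add le_rfl h3)
  linarith

theorem norm_mul_pow (hqz : ∀ i, q i = z * q (i + r)) (i : ℤ) (t : ℕ) :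
    q i = z ^ t * q (i + r * t) := by
  induction t with
  | zero => simp
  | succ t ih =>
    rw [ih, hqz (i + r * t), pow_succ]
    push_cast
    rw [mul_assoc]
    congr 3
    ring

/-- For large |x| the term x q_i dominates the recurrence, so every index after a record is again a
record. The relation q_i = z q_{i+r} carries the estimate back to all earlier indices. -/
theorem IsSeqSolution.ne_zero_and_norm_le (h : IsSeqSolution m a x q) (hC : ∀ i j, ‖a i j‖ ≤ C)
    (hr : 1 ≤ r) (hz : z ≠ 0) (hqz : ∀ i, q i = z * q (i + r)) {K : ℝ} (hK : 1 ≤ K)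
    (hx : K + C * m ≤ ‖x‖)
    {i₀ : ℤ} (hi₀ : ∀ j ≤ i₀, ‖q j‖ ≤ ‖q i₀‖) (hq0 : q i₀ ≠ 0) (i : ℤ) :
    q i ≠ 0 ∧ ‖q i‖ ≤ K⁻¹ * ‖q (i + 1)‖ := by
  have hrec : ∀ p : ℕ, q (i₀ + p) ≠ 0 ∧ ∀ j ≤ i₀ + p, ‖q j‖ ≤ ‖q (i₀ + p)‖ := by
    intro p
    induction p with
    | zero => simpa using ⟨hq0, hi₀⟩
    | succ p ih =>
      have h1 := h.norm_succ_ge hC ih.2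
      have h0 : 0 < ‖q (i₀ + p)‖ := norm_pos_iff.mpr ih.1
      have h2 : ‖q (i₀ + p)‖ ≤ ‖q (i₀ + p + 1)‖ := by
        refine le_trans ?_ h1
        nlinarith
      have e : i₀ + ((p + 1 : ℕ) : ℤ) = i₀ + p + 1 := by push_cast; ring
      rw [e]
      refine ⟨norm_pos_iff.mp (h0.trans_le h2), fun j hj => ?_⟩
      rcases (show j ≤ i₀ + p ∨ j = i₀ + p + 1 by omega) with hj | rfl
      · exact (ih.2 j hj).trans h2
      · exact le_rfl
  -- Shift i by enough periods to land at or beyond i₀.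
  obtain ⟨p, hp⟩ : ∃ p : ℕ, i + r * ((i₀ - i).toNat : ℤ) = i₀ + p := by
    refine ⟨(i + r * ((i₀ - i).toNat : ℤ) - i₀).toNat, ?_⟩
    have h1 : (1 : ℤ) ≤ r := by exact_mod_cast hr
    have : ((i₀ - i).toNat : ℤ) ≤ r * ((i₀ - i).toNat : ℤ) := by
      nlinarith [Int.natCast_nonneg (i₀ - i).toNat]
    omega
  set t := (i₀ - i).toNat
  have e1 := norm_mul_pow hqz i t
  have e2 := norm_mul_pow hqz (i + 1) t
  obtain ⟨hne, hrecp⟩ := hrec p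
  have h1 := h.norm_succ_ge hC hrecp
  rw [← hp] at h1 hne
  rw [show i + 1 + r * (t : ℤ) = i + r * t + 1 by ring] at e2
  refine ⟨?_, ?_⟩
  · rw [e1]; exact mul_ne_zero (pow_ne_zero _ hz) hne
  · rw [inv_mul_eq_div, le_div_iff₀ (by linarith), e1, e2, norm_mul, norm_mul, mul_assoc]
    gcongr
    have := norm_nonneg (q (i + r * t))
    nlinarith

end Records

/-! ### The symbol and Floquet solutions of the recurrence. -/

section SymbolSequence

variable {r : ℕ} [NeZero r]

/-- The residue of `i` modulo `r`. -/
def residue (r : ℕ) [NeZero r] (i : ℤ) : Fin r :=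
  ⟨(i % r).toNat, by
    have h : (0 : ℤ) < r := by exact_mod_cast Nat.pos_of_ne_zero (NeZero.ne r)
    have := Int.emod_lt_of_pos i h
    have := Int.emod_nonneg i h.ne'
    omega⟩

theorem natCast_pos_of_neZero (r : ℕ) [NeZero r] : (0 : ℤ) < r := by
  exact_mod_cast Nat.pos_of_ne_zero (NeZero.ne r)

theorem coe_residue (i : ℤ) : ((residue r i : ℕ) : ℤ) = i % r :=
  Int.toNat_of_nonneg (Int.emod_nonneg i (natCast_pos_of_neZero r).ne')

theorem mul_ediv_add_residue (i : ℤ) : r * (i / r) + (residue r i : ℕ) = i := by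
  rw [coe_residue, Int.mul_ediv_add_emod]

theorem mul_add_ediv (k : ℤ) (b : Fin r) : (r * k + (b : ℕ)) / (r : ℤ) = k := by
  have h := natCast_pos_of_neZero r
  rw [add_comm, Int.add_mul_ediv_left _ _ h.ne', Int.ediv_eq_zero_of_lt (by omega)
    (by exact_mod_cast b.2), zero_add]

theorem residue_mul_add (k : ℤ) (b : Fin r) : residue r (r * k + (b : ℕ)) = b := by
  ext
  have : ((residue r (r * k + (b : ℕ)) : ℕ) : ℤ) = (b : ℕ) := by
    have h1 := mul_ediv_add_residue (r := r) (r * k + (b : ℕ))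
    rw [mul_add_ediv] at h1
    omega
  exact_mod_cast this

theorem residue_add_period (i : ℤ) : residue r (i + r) = residue r i := by
  ext; simp [residue]

theorem add_period_ediv (i : ℤ) : (i + r) / (r : ℤ) = i / r + 1 :=
  Int.add_ediv_of_dvd_right dvd_rfl |>.trans (by
    rw [Int.ediv_self (natCast_pos_of_neZero r).ne'])

variable (β : ℕ) (A : ℤ → Matrix (Fin r) (Fin r) ℂ)

/-- The entries of the bi-infinite block Toeplitz matrix with symbol `A`. -/
def toeplitz (i j : ℤ) : ℂ :=
  if i / r - j / r ∈ Finset.Icc (-1 : ℤ) β then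
    A (i / r - j / r) (residue r i) (residue r j) else 0

/-- The sequence with block components `z ^ (-k) v`. -/
def blockSeq (z : ℂ) (v : Fin r → ℂ) (i : ℤ) : ℂ := z ^ (-(i / (r : ℤ))) * v (residue r i)

theorem toeplitz_periodic (i j : ℤ) : toeplitz β A (i + r) (j + r) = toeplitz β A i j := by
  simp only [toeplitz, add_period_ediv, residue_add_period]
  rw [show i / (r : ℤ) + 1 - (j / r + 1) = i / r - j / r by ring]

theorem toeplitz_lower (i j : ℤ) (h : j + (r * (β + 1) : ℕ) ≤ i) : toeplitz β A i j = 0 := by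
  rw [toeplitz, if_neg]
  rw [Finset.mem_Icc, not_and, not_le]
  intro _
  have h1 : j / r + (β + 1) ≤ i / (r : ℤ) := by
    rw [← Int.add_mul_ediv_left _ _ (natCast_pos_of_neZero r).ne']
    exact Int.ediv_le_ediv (natCast_pos_of_neZero r) (by push_cast at h; exact h)
  omega

theorem exists_norm_toeplitz_le : ∃ C : ℝ, ∀ i j, ‖toeplitz β A i j‖ ≤ C := by
  refine ⟨∑ d ∈ Finset.Icc (-1 : ℤ) β, ∑ a, ∑ b, ‖A d a b‖, fun i j => ?_⟩
  rw [toeplitz]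
  split_ifs with h
  · refine le_trans ?_ (Finset.single_le_sum (f := fun d => ∑ a, ∑ b, ‖A d a b‖)
      (fun _ _ => by positivity) h)
    refine le_trans ?_ (Finset.single_le_sum (f := fun a => ∑ b, ‖A _ a b‖)
      (fun _ _ => by positivity) (Finset.mem_univ (residue r i)))
    exact Finset.single_le_sum (f := fun b => ‖A _ _ b‖) (fun _ _ => by positivity)
      (Finset.mem_univ (residue r j))
  · rw [norm_zero]; positivity

-- Lets the scalar band be summed over any larger finite window, in particular over whole blocks.
omit [NeZero r] in
theorem sum_window_eq {m : ℕ} {a : ℤ → ℤ → ℂ} (H : IsPeriodicHessenberg r m a) (s : ℤ → ℂ) (i : ℤ)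
    {W : Finset ℤ} (hW : ∀ j, i - m < j → j ≤ i + 1 → j ∈ W) :
    ∑ j ∈ W, a i j * s j = s (i + 1) + ∑ l ∈ Finset.range m, a i (i - l) * s (i - l) := by
  have hinj : Function.Injective fun l : ℕ => i - (l : ℤ) := fun l l' h => by
    have : i - (l : ℤ) = i - l' := h
    omega
  have h1 : ∑ l ∈ Finset.range m, a i (i - l) * s (i - l)
      = ∑ j ∈ (Finset.range m).map ⟨fun l : ℕ => i - (l : ℤ), hinj⟩, a i j * s j := by
    rw [Finset.sum_map]; rfl
  have hnot : i + 1 ∉ (Finset.range m).map ⟨fun l : ℕ => i - (l : ℤ), hinj⟩ := by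
    simp only [Finset.mem_map, Function.Embedding.coeFn_mk, not_exists, not_and]
    intro l _ h
    omega
  rw [h1, ← one_mul (s (i + 1)), ← H.superdiag i, ← Finset.sum_insert (f := fun j => a i j * s j) hnot]
  symm
  rcases Nat.eq_zero_or_pos m with rfl | hm
  · have h0 := H.lower i i (by simp)
    refine Finset.sum_subset_zero_on_sdiff ?_ ?_ fun _ _ => rfl
    · intro j hj
      simp at hj
      subst hj
      exact hW _ (by simp) le_rfl
    · intro j hj
      simp only [Finset.mem_sdiff, Finset.mem_insert, Finset.mem_map, Finset.range_zero,
        Finset.notMem_empty, false_and, exists_false, or_false] at hj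
      rcases lt_or_gt_of_ne hj.2 with h | h
      · rw [H.lower i j (by push_cast; omega), zero_mul]
      · rw [H.upper i j h, zero_mul]
  · refine Finset.sum_subset_zero_on_sdiff ?_ ?_ fun _ _ => rfl
    · intro j hj
      simp only [Finset.mem_insert, Finset.mem_map, Finset.mem_range,
        Function.Embedding.coeFn_mk] at hj
      rcases hj with rfl | ⟨l, hl, rfl⟩
      · exact hW _ (by omega) le_rfl
      · exact hW _ (by omega) (by omega)
    · intro j hj
      simp only [Finset.mem_sdiff, Finset.mem_insert, Finset.mem_map, Finset.mem_range,
        Function.Embedding.coeFn_mk, not_or, not_exists, not_and] at hj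
      rcases lt_or_gt_of_ne hj.2.1 with h | h
      · rw [H.lower i j, zero_mul]
        by_contra hlt
        exact hj.2.2 (i - j).toNat (by omega) (by omega)
      · rw [H.upper i j h, zero_mul]

/-- Block d of block row k acts on z^{-(k-d)} v = z^{-k} z^d v, so the Toeplitz matrix acts on the
sequence as A(z) acts on v. -/
theorem symbol_mulVec_eq (H : IsPeriodicHessenberg r (r * (β + 1)) (toeplitz β A)) {z : ℂ}
    (hz : z ≠ 0) (v : Fin r → ℂ) (i : ℤ) :
    z ^ (-(i / (r : ℤ))) * (symbol β A z).mulVec v (residue r i)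
      = blockSeq z v (i + 1) + ∑ l ∈ Finset.range (r * (β + 1)),
        toeplitz β A i (i - l) * blockSeq z v (i - l) := by
  set k := i / (r : ℤ) with hk
  have hr := natCast_pos_of_neZero r
  have hi := mul_ediv_add_residue (r := r) i
  have hlt : ((residue r i : ℕ) : ℤ) < r := by exact_mod_cast (residue r i).2
  rw [← hk] at hi
  -- The scalar band of length r(β+1) can reach block column k-β-1, whose entries are zero; so d
  -- first runs up to β+1 and is cut back to β afterwards.
  rw [← sum_window_eq H (blockSeq z v) i (W := Finset.Ico (r * (k - (β + 1))) (r * (k + 2)))]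
  · have hbij : ∑ j ∈ Finset.Ico ((r : ℤ) * (k - (β + 1))) (r * (k + 2)),
          toeplitz β A i j * blockSeq z v j
        = ∑ p ∈ Finset.Icc (-1 : ℤ) (β + 1) ×ˢ (Finset.univ : Finset (Fin r)),
          toeplitz β A i (r * (k - p.1) + (p.2 : ℕ))
            * blockSeq z v (r * (k - p.1) + (p.2 : ℕ)) := by
      refine Finset.sum_bij' (fun j _ => (k - j / r, residue r j))
        (fun p _ => r * (k - p.1) + (p.2 : ℕ)) ?_ ?_ ?_ ?_ ?_
      · intro j hj
        rw [Finset.mem_Ico] at hj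
        simp only [Finset.mem_product, Finset.mem_Icc, Finset.mem_univ, and_true]
        have h1 : k - (β + 1) ≤ j / r := (Int.le_ediv_iff_mul_le hr).mpr (by rw [mul_comm]; exact hj.1)
        have h2 : j / r < k + 2 := Int.ediv_lt_of_lt_mul hr (by rw [mul_comm]; exact hj.2)
        omega
      · rintro ⟨d, b⟩ hp
        simp only [Finset.mem_product, Finset.mem_Icc, Finset.mem_univ, and_true] at hp
        have hb : ((b : ℕ) : ℤ) < r := by exact_mod_cast b.2
        rw [Finset.mem_Ico]
        constructor <;> nlinarith
      · intro j _
        simp only [sub_sub_cancel]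
        exact mul_ediv_add_residue j
      · rintro ⟨d, b⟩ _
        simp only [mul_add_ediv, residue_mul_add, sub_sub_cancel]
      · intro j _
        simp only [sub_sub_cancel, mul_ediv_add_residue]
    rw [hbij, Finset.sum_product]
    have hIcc : Finset.Icc (-1 : ℤ) β ⊆ Finset.Icc (-1 : ℤ) (β + 1) :=
      Finset.Icc_subset_Icc le_rfl (by omega)
    rw [← Finset.sum_subset hIcc, symbol, Matrix.sum_mulVec, Finset.sum_apply, Finset.mul_sum]
    · refine Finset.sum_congr rfl fun d hd => ?_
      rw [Matrix.smul_mulVec, Pi.smul_apply, smul_eq_mul, Matrix.mulVec, dotProduct, Finset.mul_sum,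
        Finset.mul_sum]
      refine Finset.sum_congr rfl fun b _ => ?_
      rw [toeplitz, blockSeq, mul_add_ediv, residue_mul_add, ← hk, sub_sub_cancel, if_pos hd,
        show -(k - d) = -k + d by ring, zpow_add₀ hz]
      ring
    · intro d _ hd
      refine Finset.sum_eq_zero fun b _ => ?_
      rw [toeplitz, mul_add_ediv, ← hk, sub_sub_cancel, if_neg hd, zero_mul]
  · intro j h1 h2
    rw [Finset.mem_Ico]
    push_cast at h1
    constructor <;> nlinarith

omit [NeZero r] in
theorem f_eq_zero_iff (z x : ℂ) :
    f β A z x = 0 ↔ ∃ v : Fin r → ℂ, v ≠ 0 ∧ (symbol β A z).mulVec v = x • v := by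
  rw [f, ← Matrix.exists_mulVec_eq_zero_iff]
  simp only [Matrix.sub_mulVec, Matrix.smul_mulVec, Matrix.one_mulVec, sub_eq_zero]

/-- Links roots with the recurrence: eigenvectors of A(z) for the eigenvalue x are the solutions
with multiplier z⁻¹ over a period. -/
theorem isSeqSolution_blockSeq_iff (H : IsPeriodicHessenberg r (r * (β + 1)) (toeplitz β A))
    {z : ℂ} (hz : z ≠ 0) (x : ℂ) (v : Fin r → ℂ) :
    IsSeqSolution (r * (β + 1)) (toeplitz β A) x (blockSeq z v)
      ↔ (symbol β A z).mulVec v = x • v := by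
  constructor
  · intro h
    ext b
    have h1 := h (b : ℕ)
    rw [← symbol_mulVec_eq β A H hz, blockSeq] at h1
    have e1 := mul_add_ediv (r := r) 0 b
    have e2 := residue_mul_add (r := r) 0 b
    rw [mul_zero, zero_add] at e1 e2
    rw [e1, e2, neg_zero, zpow_zero, one_mul, one_mul] at h1
    rw [Pi.smul_apply, smul_eq_mul, h1]
  · intro h i
    rw [← symbol_mulVec_eq β A H hz, h, blockSeq, Pi.smul_apply, smul_eq_mul]
    ring

theorem blockSeq_eq_mul {z : ℂ} (hz : z ≠ 0) (v : Fin r → ℂ) (i : ℤ) :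
    blockSeq z v i = z * blockSeq z v (i + r) := by
  rw [blockSeq, blockSeq, add_period_ediv, residue_add_period, ← mul_assoc, neg_add,
    zpow_add₀ hz, zpow_neg_one]
  field_simp

theorem blockSeq_natCast (z : ℂ) (v : Fin r → ℂ) (b : Fin r) : blockSeq z v (b : ℕ) = v b := by
  have e1 := mul_add_ediv (r := r) 0 b
  have e2 := residue_mul_add (r := r) 0 b
  rw [mul_zero, zero_add] at e1 e2
  rw [blockSeq, e1, e2, neg_zero, zpow_zero, one_mul]

/-- For |z| ≤ 1 the blocks z^{-k} v do not decrease in modulus with k, so a largest component of v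
in block 0 dominates everything before it. -/
theorem exists_record {z : ℂ} (hz1 : ‖z‖ ≤ 1) {v : Fin r → ℂ} (hv : v ≠ 0) :
    ∃ i₀, blockSeq z v i₀ ≠ 0 ∧ ∀ j ≤ i₀, ‖blockSeq z v j‖ ≤ ‖blockSeq z v i₀‖ := by
  obtain ⟨b, hb⟩ := Finite.exists_max fun b => ‖v b‖
  refine ⟨(b : ℕ), ?_, fun j hj => ?_⟩
  · rw [blockSeq_natCast]
    intro h0
    refine hv (funext fun c => ?_)
    have := hb c
    rw [h0, norm_zero] at this
    exact norm_le_zero_iff.mp this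
  · rw [blockSeq_natCast, blockSeq, norm_mul]
    have hj0 : j / (r : ℤ) ≤ 0 := by
      have h1 : j / (r : ℤ) ≤ ((b : ℕ) : ℤ) / r := Int.ediv_le_ediv (natCast_pos_of_neZero r) hj
      have h2 : ((b : ℕ) : ℤ) / (r : ℤ) = 0 :=
        Int.ediv_eq_zero_of_lt (Int.natCast_nonneg _) (by exact_mod_cast b.2)
      rwa [h2] at h1
    obtain ⟨p, hp⟩ : ∃ p : ℕ, -(j / (r : ℤ)) = p := ⟨(-(j / (r : ℤ))).toNat, by omega⟩
    rw [hp, zpow_natCast, norm_pow]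
    calc _ ≤ 1 * ‖v (residue r j)‖ := by
          gcongr
          exact pow_le_one₀ (norm_nonneg _) hz1
      _ ≤ _ := by rw [one_mul]; exact hb _

/-- Roots of `f(·, x)` are bounded away from zero. -/
theorem pow_mul_norm_ge_one_of_root (H : IsPeriodicHessenberg r (r * (β + 1)) (toeplitz β A))
    {C : ℝ} (hC : ∀ i j, ‖toeplitz β A i j‖ ≤ C) {z x : ℂ} (hz : z ≠ 0) (hz1 : ‖z‖ ≤ 1)
    (h : f β A z x = 0) : 1 ≤ (‖x‖ + C * (r * (β + 1) : ℕ) + 1) ^ r * ‖z‖ := by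
  obtain ⟨v, hv, hvx⟩ := (f_eq_zero_iff β A z x).mp h
  obtain ⟨i, hi0, hi⟩ := exists_record hz1 hv
  -- One period after a record the solution has grown by at most the r-th power of the step factor,
  -- but by exactly |z|⁻¹ at the record.
  have h1 := ((isSeqSolution_blockSeq_iff β A H hz x v).mpr hvx).norm_le_pow hC hi r _ le_rfl
  have h2 := blockSeq_eq_mul hz v i
  have h3 : 0 < ‖blockSeq z v i‖ := norm_pos_iff.mpr hi0
  have h4 : ‖blockSeq z v i‖ = ‖z‖ * ‖blockSeq z v (i + r)‖ := by rw [← norm_mul, ← h2]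
  have h5 : ‖blockSeq z v i‖ ≤
      ‖z‖ * ((‖x‖ + C * (r * (β + 1) : ℕ) + 1) ^ r * ‖blockSeq z v i‖) := by
    conv_lhs => rw [h4]
    gcongr
  by_contra hlt
  rw [not_le] at hlt
  nlinarith

theorem blockSeq_prod {z : ℂ} (hz : z ≠ 0) {v : Fin r → ℂ} {u : ℤ → ℂ}
    (hq : ∀ i, blockSeq z v (i + 1) * u i = blockSeq z v i) {i : ℤ} (h0 : blockSeq z v i ≠ 0) :
    z = ∏ p ∈ Finset.range r, u (i - 1 - p) := by
  have h1 := prod_ratio hq i r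
  have h2 := blockSeq_eq_mul hz v (i - r)
  rw [sub_add_cancel] at h2
  rw [h2, mul_comm z] at h1
  exact (mul_left_cancel₀ h0 h1).symm

/-- For large `x` at most one root of `f(·, x)` lies in the unit disk. -/
theorem exists_root_unique (H : IsPeriodicHessenberg r (r * (β + 1)) (toeplitz β A)) :
    ∃ T : ℝ, ∀ x : ℂ, T ≤ ‖x‖ → ∀ z₁ z₂ : ℂ, z₁ ≠ 0 → z₂ ≠ 0 → ‖z₁‖ ≤ 1 → ‖z₂‖ ≤ 1 →
      f β A z₁ x = 0 → f β A z₂ x = 0 → z₁ = z₂ := by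
  obtain ⟨C, hC⟩ := exists_norm_toeplitz_le β A
  have hC0 : 0 ≤ C := (norm_nonneg _).trans (hC 0 0)
  set m := r * (β + 1) with hm
  -- Chosen so that κ = K⁻¹ satisfies κ ≤ 1 and κ²Cm² < 1, the contraction condition.
  set K : ℝ := C * m ^ 2 + 1 with hK
  have hK1 : 1 ≤ K := by
    have : 0 ≤ C * (m : ℝ) ^ 2 := by positivity
    linarith
  have hK0 : 0 < K := by linarith
  have hκ1 : K⁻¹ ≤ 1 := inv_le_one_of_one_le₀ hK1
  have hκ : (K⁻¹) ^ 2 * (C * m ^ 2) < 1 := by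
    rw [inv_pow, inv_mul_eq_div, div_lt_one (by positivity)]
    nlinarith
  refine ⟨K + C * m, fun x hx z₁ z₂ hz₁ hz₂ hn₁ hn₂ h₁ h₂ => ?_⟩
  -- A root in the unit disk gives a nonvanishing solution with ratios at most K⁻¹, and the root is
  -- recovered as the product of the ratios over a period; uniqueness of small ratio solutions then
  -- identifies any two such roots.
  have key : ∀ z : ℂ, z ≠ 0 → ‖z‖ ≤ 1 → f β A z x = 0 → ∃ u : ℤ → ℂ,
      IsRatioSolution m (toeplitz β A) x u ∧ (∀ i, ‖u i‖ ≤ K⁻¹) ∧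
      z = ∏ p ∈ Finset.range r, u (0 - 1 - p) := by
    intro z hz hz1 h
    obtain ⟨v, hv, hvx⟩ := (f_eq_zero_iff β A z x).mp h
    obtain ⟨i₀, hi0, hi⟩ := exists_record hz1 hv
    have hs := (isSeqSolution_blockSeq_iff β A H hz x v).mpr hvx
    have hprop := hs.ne_zero_and_norm_le hC (Nat.one_le_iff_ne_zero.mpr (NeZero.ne r)) hz
      (blockSeq_eq_mul hz v) hK1 hx hi hi0
    have hq : ∀ i, blockSeq z v (i + 1) * (blockSeq z v i / blockSeq z v (i + 1))
        = blockSeq z v i := fun i => mul_div_cancel₀ _ (hprop (i + 1)).1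
    refine ⟨fun i => blockSeq z v i / blockSeq z v (i + 1),
      hs.isRatioSolution hq fun i => (hprop i).1, fun i => ?_, blockSeq_prod hz hq (hprop 0).1⟩
    rw [norm_div, div_le_iff₀ (norm_pos_iff.mpr (hprop (i + 1)).1)]
    exact (hprop i).2
  obtain ⟨u₁, hu₁, hκ₁, e₁⟩ := key z₁ hz₁ hn₁ h₁
  obtain ⟨u₂, hu₂, hκ₂, e₂⟩ := key z₂ hz₂ hn₂ h₂
  rw [e₁, e₂, hu₁.eq_of_norm_le hu₂ hC hκ1 hκ hκ₁ hκ₂]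

theorem prod_range_mod (u : ℤ → ℂ) (hper : ∀ i, u (i + r) = u i) (i : ℤ) :
    u i = u (residue r i : ℕ) := by
  have h : ∀ k : ℤ, ∀ j : ℤ, u (j + r * k) = u j := by
    intro k
    induction k using Int.induction_on with
    | zero => simp
    | succ k ih => intro j; rw [mul_add, mul_one, ← add_assoc, hper, ih]
    | pred k ih =>
      intro j
      rw [← ih j, ← hper]
      congr 1
      ring
  conv_lhs => rw [← mul_ediv_add_residue (r := r) i, add_comm, h]

/-- A periodic solution of the ratio equation yields a root of `f(·, x)`. -/
theorem f_prod_eq_zero (H : IsPeriodicHessenberg r (r * (β + 1)) (toeplitz β A)) {x : ℂ}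
    {u : ℤ → ℂ} (hu : IsRatioSolution (r * (β + 1)) (toeplitz β A) x u) (hu0 : ∀ i, u i ≠ 0)
    (hper : ∀ i, u (i + r) = u i) : f β A (∏ p ∈ Finset.range r, u p) x = 0 := by
  set z := ∏ p ∈ Finset.range r, u p with hz
  have hz0 : z ≠ 0 := Finset.prod_ne_zero_iff.mpr fun p _ => hu0 p
  -- Components with v_b/v_{b+1} = u_b; the factor z closes the period at the block boundary.
  let v : Fin r → ℂ := fun b => ∏ p ∈ Finset.range b, (u p)⁻¹
  have hv0 : ∀ b, v b ≠ 0 := fun b => Finset.prod_ne_zero_iff.mpr fun p _ => inv_ne_zero (hu0 p)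
  have hq : ∀ i, blockSeq z v (i + 1) * u i = blockSeq z v i := by
    intro i
    set k := i / (r : ℤ) with hk
    set b := residue r i with hb
    have hi : r * k + (b : ℕ) = i := mul_ediv_add_residue i
    have hui : u i = u (b : ℕ) := prod_range_mod u hper i
    by_cases hlt : (b : ℕ) + 1 < r
    · have e : i + 1 = r * k + ((⟨b + 1, hlt⟩ : Fin r) : ℕ) := by push_cast; omega
      rw [blockSeq, blockSeq, e, mul_add_ediv, residue_mul_add, ← hk, ← hb, hui]
      simp only [v]
      rw [Finset.prod_range_succ]
      have := hu0 (b : ℕ)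
      field_simp
    · have hbr : (b : ℕ) + 1 = r := by have := b.2; omega
      have e : i + 1 = r * (k + 1) + ((0 : Fin r) : ℕ) := by
        rw [Fin.val_zero, mul_add, mul_one]
        push_cast
        have : ((b : ℕ) : ℤ) + 1 = r := by exact_mod_cast hbr
        omega
      rw [blockSeq, blockSeq, e, mul_add_ediv, residue_mul_add, ← hk, ← hb, hui, neg_add,
        zpow_add₀ hz0, zpow_neg_one]
      have hzb : z = (∏ p ∈ Finset.range (b : ℕ), u p) * u (b : ℕ) := by
        rw [← Finset.prod_range_succ, hbr]
      have hvb : v b * ∏ p ∈ Finset.range (b : ℕ), u p = 1 := by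
        simp only [v]
        rw [← Finset.prod_mul_distrib]
        exact Finset.prod_eq_one fun p _ => inv_mul_cancel₀ (hu0 p)
      have hv00 : v 0 = 1 := by simp [v]
      rw [hv00, mul_one, mul_assoc]
      congr 1
      rw [inv_mul_eq_iff_eq_mul₀ hz0, hzb, mul_comm, ← mul_assoc]
      linear_combination (-u (b : ℕ)) * hvb
  refine (f_eq_zero_iff β A z x).mpr ⟨v, fun h => hv0 0 (congrFun h 0), ?_⟩
  exact (isSeqSolution_blockSeq_iff β A H hz0 x v).mp (hu.isSeqSolution hq)

end SymbolSequence

/-! ### The limit rk/n → s. -/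

section RatioFilter

variable {r : ℕ} {s : ℝ}

theorem tendsto_fst_ratioFilter : Tendsto Prod.fst (ratioFilter r s) atTop :=
  tendsto_fst.mono_left inf_le_left

theorem tendsto_snd_ratioFilter : Tendsto Prod.snd (ratioFilter r s) atTop :=
  tendsto_snd.mono_left inf_le_left

theorem tendsto_ratio_ratioFilter :
    Tendsto (fun p : ℕ × ℕ => (r : ℝ) * p.1 / p.2) (ratioFilter r s) (𝓝 s) :=
  tendsto_comap.mono_left inf_le_right

theorem tendsto_ratioFilter {ι : Type*} {l : Filter ι} {k n : ι → ℕ} (hk : Tendsto k l atTop)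
    (hn : Tendsto n l atTop) (h : Tendsto (fun i => (r : ℝ) * k i / n i) l (𝓝 s)) :
    Tendsto (fun i => (k i, n i)) l (ratioFilter r s) :=
  tendsto_inf.mpr ⟨hk.prodMk hn, tendsto_comap_iff.mpr h⟩

theorem eventually_le_ratioFilter (hr : 1 ≤ r) (c : ℤ) :
    ∀ᶠ p in ratioFilter r s, c ≤ (r : ℤ) * (p.1 : ℕ) := by
  filter_upwards [tendsto_fst_ratioFilter.eventually (eventually_ge_atTop c.toNat)] with p hp
  have h1 : (1 : ℤ) ≤ r := by exact_mod_cast hr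
  have h2 : c ≤ p.1 := by omega
  nlinarith [Int.natCast_nonneg p.1]

theorem tendsto_shift_ratioFilter (e : ℤ) :
    Tendsto (fun p : ℕ × ℕ => (((p.1 : ℤ) + e).toNat, p.2)) (ratioFilter r s)
      (ratioFilter r s) := by
  refine tendsto_ratioFilter ?_ tendsto_snd_ratioFilter ?_
  · refine tendsto_atTop.mpr fun b => ?_
    filter_upwards [tendsto_fst_ratioFilter.eventually (eventually_ge_atTop (b + e.natAbs))]
      with p hp
    omega
  · have h1 : Tendsto (fun p : ℕ × ℕ => (r : ℝ) * e / p.2) (ratioFilter r s) (𝓝 0) :=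
      Tendsto.div_atTop tendsto_const_nhds (tendsto_natCast_atTop_atTop.comp
        tendsto_snd_ratioFilter)
    have h2 := (tendsto_ratio_ratioFilter (r := r) (s := s)).add h1
    rw [add_zero] at h2
    refine h2.congr' ?_
    filter_upwards [tendsto_fst_ratioFilter.eventually (eventually_ge_atTop e.natAbs)] with p hp
    have h3 : ((((p.1 : ℤ) + e).toNat : ℕ) : ℝ) = (p.1 : ℝ) + e := by
      have : ((((p.1 : ℤ) + e).toNat : ℕ) : ℤ) = (p.1 : ℤ) + e := by omega
      exact_mod_cast this
    rw [h3]
    ring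

/-- The block containing row ⌊ns⌋ provides one concrete path in the filter: it proves nontriviality,
and it is the path used in the averaging over s. -/
theorem tendsto_floor_ratioFilter (hr : 1 ≤ r) (hs : 0 < s) :
    Tendsto (fun n : ℕ => (⌊(n : ℝ) * s⌋₊ / r, n)) atTop (ratioFilter r s) := by
  have hfl : Tendsto (fun n : ℕ => ⌊(n : ℝ) * s⌋₊) atTop atTop :=
    tendsto_nat_floor_atTop.comp (tendsto_natCast_atTop_atTop.atTop_mul_const hs)
  refine tendsto_ratioFilter ?_ tendsto_id ?_
  · exact (Nat.tendsto_div_const_atTop (by omega)).comp hfl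
  · have h1 : Tendsto (fun n : ℕ => ((r : ℝ) + 1) / n) atTop (𝓝 0) :=
      tendsto_const_nhds.div_atTop tendsto_natCast_atTop_atTop
    have h2 : Tendsto (fun n : ℕ => s - ((r : ℝ) + 1) / n) atTop (𝓝 s) := by
      simpa using (tendsto_const_nhds (x := s)).sub h1
    have key : ∀ n : ℕ, (n : ℝ) * s - (r + 1) ≤ (r : ℝ) * ((⌊(n : ℝ) * s⌋₊ / r : ℕ) : ℝ) ∧
        (r : ℝ) * ((⌊(n : ℝ) * s⌋₊ / r : ℕ) : ℝ) ≤ n * s := by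
      intro n
      have h0 : 0 ≤ (n : ℝ) * s := by positivity
      have h3 := Nat.floor_le h0
      have h4 := (Nat.lt_floor_add_one ((n : ℝ) * s)).le
      have h5 : r * (⌊(n : ℝ) * s⌋₊ / r) ≤ ⌊(n : ℝ) * s⌋₊ := Nat.mul_div_le _ _
      have h6 : ⌊(n : ℝ) * s⌋₊ ≤ r * (⌊(n : ℝ) * s⌋₊ / r) + r := by
        have := Nat.div_add_mod ⌊(n : ℝ) * s⌋₊ r
        have := Nat.mod_lt ⌊(n : ℝ) * s⌋₊ hr
        omega
      have h5' : (r : ℝ) * ((⌊(n : ℝ) * s⌋₊ / r : ℕ) : ℝ) ≤ ⌊(n : ℝ) * s⌋₊ := by exact_mod_cast h5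
      have h6' : (⌊(n : ℝ) * s⌋₊ : ℝ) ≤ (r : ℝ) * ((⌊(n : ℝ) * s⌋₊ / r : ℕ) : ℝ) + r := by
        exact_mod_cast h6
      constructor <;> linarith
    refine tendsto_of_tendsto_of_tendsto_of_le_of_le' h2 tendsto_const_nhds ?_ ?_
    · filter_upwards [eventually_gt_atTop 0] with n hn
      have hn' : (0 : ℝ) < n := by exact_mod_cast hn
      have := (key n).1
      rw [le_div_iff₀ hn', sub_mul, div_mul_cancel₀ _ hn'.ne']
      linarith
    · filter_upwards [eventually_gt_atTop 0] with n hn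
      have hn' : (0 : ℝ) < n := by exact_mod_cast hn
      have := (key n).2
      rw [div_le_iff₀ hn']
      linarith

theorem neBot_ratioFilter (hr : 1 ≤ r) (hs : 0 < s) : (ratioFilter r s).NeBot :=
  (tendsto_floor_ratioFilter hr hs).neBot

end RatioFilter

/-! ### Reality of the recurrence coefficients. -/

section Reality

theorem eq_zero_of_sum_C_mul_eq_zero {Q : ℕ → ℂ[X]} (hm : ∀ k, (Q k).Monic)
    (hd : ∀ k, (Q k).natDegree = k) (N : ℕ) (c : ℕ → ℂ)
    (h : ∑ j ∈ Finset.range N, C (c j) * Q j = 0) : ∀ j < N, c j = 0 := by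
  induction N with
  | zero => intro j hj; omega
  | succ N ih =>
    have hN : c N = 0 := by
      have h1 := congrArg (fun p => coeff p N) h
      simp only [finsetSum_coeff, coeff_C_mul, coeff_zero] at h1
      rw [Finset.sum_range_succ, Finset.sum_eq_zero] at h1
      · have h2 := (hm N).coeff_natDegree
        rw [hd N] at h2
        rwa [h2, zero_add, mul_one] at h1
      · intro j hj
        rw [coeff_eq_zero_of_natDegree_lt (by rw [hd]; exact Finset.mem_range.mp hj), mul_zero]
    rw [Finset.sum_range_succ, hN, C_0, zero_mul, add_zero] at h
    intro j hj
    rcases (show j < N ∨ j = N by omega) with hj | rfl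
    · exact ih h j hj
    · exact hN

variable {r β : ℕ} {J : ℕ → ℕ → ℂ} {Q : ℕ → ℂ[X]} {x : (k : ℕ) → Fin k → ℝ}

/-- Real zeros make every Q_k conjugation invariant. Conjugating the recurrence gives a second
expansion of X Q_i in the basis (Q_j), and coordinates are unique. -/
theorem IsGeneratedBy.conj_eq (hQ : IsGeneratedBy r β J Q) (hx : HasInterlacingZeros Q x)
    (i j : ℕ) : (starRingEnd ℂ) (J i j) = J i j := by
  have hconj : ∀ k, (Q k).map (starRingEnd ℂ) = Q k := by
    intro k
    rw [hx.eq_prod hQ.monic hQ.natDegree_eq k, Polynomial.map_prod]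
    simp
  rcases lt_or_ge (i + 1) j with h | h
  · rw [hQ.upper_zero i j h, map_zero]
  · have h1 := hQ.recurrence i
    have h2 := congrArg (Polynomial.map (starRingEnd ℂ)) h1
    rw [Polynomial.map_mul, map_X, hconj, Polynomial.map_sum, h1] at h2
    simp only [Polynomial.map_mul, map_C, hconj] at h2
    have h3 : ∑ j ∈ Finset.range (i + 2), C ((starRingEnd ℂ) (J i j) - J i j) * Q j = 0 := by
      simp only [C_sub, sub_mul, Finset.sum_sub_distrib]
      rw [← h2, sub_self]
    exact sub_eq_zero.mp (eq_zero_of_sum_C_mul_eq_zero hQ.monic hQ.natDegree_eq _ _ h3 j (by omega))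

end Reality

/-! ### Ratio asymptotics. -/

section Toeplitz

variable {r : ℕ} [NeZero r] {β : ℕ} {J : ℕ → ℕ → ℕ → ℂ} {Q : ℕ → ℕ → ℂ[X]}
  {A : ℝ → ℤ → Matrix (Fin r) (Fin r) ℂ} {x : ℕ → (k : ℕ) → Fin k → ℝ} {s : ℝ}

theorem one_le_of_neZero (r : ℕ) [NeZero r] : 1 ≤ r := Nat.one_le_iff_ne_zero.mpr (NeZero.ne r)

/-- Entries at fixed offsets from the moving corner (rk, rk) stay in blocks at bounded distance from
block k, which does not change the limit of rk/n. Entries outside the band are eventually exactly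
zero. -/
theorem IsLocallyBlockToeplitz.tendsto_toeplitz (hA : IsLocallyBlockToeplitz r β J A)
    (hQ : ∀ n, IsGeneratedBy r β (J n) (Q n)) (hs : 0 ≤ s) (i j : ℤ) :
    Tendsto (fun p : ℕ × ℕ => J p.2 ((r : ℤ) * (p.1 : ℕ) + i).toNat ((r : ℤ) * (p.1 : ℕ) + j).toNat)
      (ratioFilter r s) (𝓝 (toeplitz β (A s) i j)) := by
  have hr := one_le_of_neZero r
  have hr0 := natCast_pos_of_neZero r
  have hi := mul_ediv_add_residue (r := r) i
  have hj := mul_ediv_add_residue (r := r) j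
  have hi2 : ((residue r i : ℕ) : ℤ) < r := by exact_mod_cast (residue r i).2
  have hj2 : ((residue r j : ℕ) : ℤ) < r := by exact_mod_cast (residue r j).2
  have hev : ∀ᶠ p in ratioFilter r s, |i| ≤ (r : ℤ) * (p.1 : ℕ) ∧ |j| ≤ (r : ℤ) * (p.1 : ℕ) :=
    (eventually_le_ratioFilter hr _).and (eventually_le_ratioFilter hr _)
  have hdiv : ∀ (p : ℕ) (e : ℤ), |e| ≤ (r : ℤ) * p →
      (((((r : ℤ) * p + e).toNat / r : ℕ)) : ℤ) = p + e / r := by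
    intro p e he
    rw [Int.natCast_div, Int.toNat_of_nonneg (by have := neg_abs_le e; linarith), add_comm,
      Int.add_mul_ediv_left _ _ hr0.ne', add_comm]
  rw [toeplitz]
  split_ifs with h
  · have h1 := ((hA s hs _ h (residue r i) (residue r j)).comp
      (tendsto_shift_ratioFilter (i / r)))
    refine h1.congr' ?_
    filter_upwards [hev, tendsto_fst_ratioFilter.eventually
      (eventually_ge_atTop ((i / r).natAbs + (j / r).natAbs))] with p hp hp2
    simp only [Function.comp, block, Matrix.of_apply]
    congr 1
    · zify
      rw [Int.toNat_of_nonneg (by omega), Int.toNat_of_nonneg (by have := neg_abs_le i; linarith)]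
      linear_combination hi
    · zify
      rw [Int.toNat_of_nonneg (show 0 ≤ (p.1 : ℤ) + i / r by omega),
        Int.toNat_of_nonneg (by omega), Int.toNat_of_nonneg (by have := neg_abs_le j; linarith)]
      linear_combination hj
  · refine tendsto_const_nhds.congr' ?_
    filter_upwards [hev] with p hp
    have e1 := hdiv p.1 i hp.1
    have e2 := hdiv p.1 j hp.2
    rw [Finset.mem_Icc, not_and_or, not_le, not_le] at h
    symm
    rcases h with h | h
    · refine (hQ p.2).upper_zero _ _ ?_
      have h2 : i + 1 < j := by
        have : i / (r : ℤ) + 2 ≤ j / r := by omega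
        nlinarith
      have := neg_abs_le i
      omega
    · exact (hQ p.2).banded _ _ (by zify; omega)

theorem IsLocallyBlockToeplitz.isPeriodicHessenberg (hA : IsLocallyBlockToeplitz r β J A)
    (hQ : ∀ n, IsGeneratedBy r β (J n) (Q n)) (hs : 0 < s) :
    IsPeriodicHessenberg r (r * (β + 1)) (toeplitz β (A s)) where
  periodic := toeplitz_periodic β (A s)
  superdiag i := by
    have hr := one_le_of_neZero r
    have := neBot_ratioFilter hr hs
    refine tendsto_nhds_unique (hA.tendsto_toeplitz hQ hs.le i (i + 1)) ?_
    refine tendsto_const_nhds.congr' ?_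
    filter_upwards [eventually_le_ratioFilter hr (-i)] with p hp
    have : ((r : ℤ) * (p.1 : ℕ) + (i + 1)).toNat = ((r : ℤ) * (p.1 : ℕ) + i).toNat + 1 := by omega
    rw [this, (hQ p.2).superdiag_one]
  upper i j hij := by
    have hr := one_le_of_neZero r
    have := neBot_ratioFilter hr hs
    refine tendsto_nhds_unique (hA.tendsto_toeplitz hQ hs.le i j) ?_
    refine tendsto_const_nhds.congr' ?_
    filter_upwards [eventually_le_ratioFilter hr (-i)] with p hp
    rw [(hQ p.2).upper_zero]
    omega
  lower := toeplitz_lower β (A s)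

theorem IsLocallyBlockToeplitz.conj_eq (hA : IsLocallyBlockToeplitz r β J A)
    (hQ : ∀ n, IsGeneratedBy r β (J n) (Q n)) (hx : ∀ n, HasInterlacingZeros (Q n) (x n))
    (hs : 0 < s) {j : ℤ} (hj : j ∈ Finset.Icc (-1 : ℤ) β) (a b : Fin r) :
    (starRingEnd ℂ) (A s j a b) = A s j a b := by
  have := neBot_ratioFilter (one_le_of_neZero r) hs
  refine tendsto_nhds_unique ((Complex.continuous_conj.tendsto _).comp (hA s hs.le j hj a b))
    ((hA s hs.le j hj a b).congr fun p => ?_)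
  simp only [Function.comp, block, Matrix.of_apply]
  rw [(hQ p.2).conj_eq (hx p.2)]

/-- Row N divided by Q_{N+1}; the bound on N keeps the whole band inside the matrix and the
subtractions in ℕ exact. -/
theorem IsGeneratedBy.ratio_eq {J : ℕ → ℕ → ℂ} {Q : ℕ → ℂ[X]} (hQ : IsGeneratedBy r β J Q) {z : ℂ}
    (hz : ∀ k, (Q k).eval z ≠ 0) {N : ℕ} (hN : r * (β + 1) ≤ N) :
    z * ratio Q N z = 1 + ratio Q N z * ∑ l ∈ Finset.range (r * (β + 1)), J N (N - l) *
      ∏ p ∈ Finset.range l, ratio Q (N - 1 - p) z := by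
  have h1 := congrArg (eval z) (hQ.recurrence N)
  simp only [eval_mul, eval_X, eval_finsetSum, eval_C] at h1
  rw [Finset.sum_range_succ, hQ.superdiag_one, one_mul] at h1
  have hprod : ∀ l ≤ N, (Q (N - l)).eval z
      = (Q N).eval z * ∏ p ∈ Finset.range l, ratio Q (N - 1 - p) z := by
    intro l hl
    induction l with
    | zero => simp
    | succ l ih =>
      rw [Finset.prod_range_succ, ← mul_assoc, ← ih (by omega), ratio,
        show N - 1 - l + 1 = N - l by omega, mul_div_cancel₀ _ (hz _),
        show N - 1 - l = N - (l + 1) by omega]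
  have h2 : ∑ j ∈ Finset.range (N + 1), J N j * (Q j).eval z
      = ∑ l ∈ Finset.range (r * (β + 1)), J N (N - l) * (Q (N - l)).eval z := by
    rw [← Finset.sum_range_reflect]
    simp only [Nat.add_sub_cancel]
    symm
    refine Finset.sum_subset (Finset.range_subset_range.mpr (by omega)) fun l hl hl2 => ?_
    rw [Finset.mem_range] at hl hl2
    rw [hQ.banded, zero_mul]
    have hr := one_le_of_neZero r
    have h3 : N - l + r * (β + 1) ≤ N := by omega
    have h4 : (N - l + r * (β + 1)) / r ≤ N / r := Nat.div_le_div_right h3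
    rw [Nat.add_mul_div_left _ _ (by omega)] at h4
    omega
  rw [h2] at h1
  have h3 : ∑ l ∈ Finset.range (r * (β + 1)), J N (N - l) * (Q (N - l)).eval z
      = (Q N).eval z * ∑ l ∈ Finset.range (r * (β + 1)), J N (N - l) *
        ∏ p ∈ Finset.range l, ratio Q (N - 1 - p) z := by
    rw [Finset.mul_sum]
    refine Finset.sum_congr rfl fun l hl => ?_
    rw [hprod l (by have := Finset.mem_range.mp hl; omega)]
    ring
  rw [h3] at h1
  have h4 := hz (N + 1)
  rw [ratio]
  field_simp
  linear_combination h1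

/-- A bi-infinite family of ratio functions solving the limiting recurrence. -/
structure IsLimitRatio (m : ℕ) (a : ℤ → ℤ → ℂ) (U : ℤ → ℂ → ℂ) : Prop where
  stieltjes : ∀ i, IsStieltjesLike (U i)
  solution : ∀ z, 0 < z.im → IsRatioSolution m a z fun i => U i z

theorem IsLimitRatio.ne_zero {m : ℕ} {a : ℤ → ℤ → ℂ} {U : ℤ → ℂ → ℂ} (h : IsLimitRatio m a U)
    (i : ℤ) {z : ℂ} (hz : 0 < z.im) : U i z ≠ 0 := by
  intro h0
  have := h.solution z hz i
  simp [h0] at this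

/-- Since |U_i| ≤ 1/Im z, both families are small solutions of the ratio equation when Im z > Cm² +
1, where contraction gives equality; the identity theorem does the rest. -/
theorem IsLimitRatio.eqOn {m : ℕ} {a : ℤ → ℤ → ℂ} {U V : ℤ → ℂ → ℂ} (hU : IsLimitRatio m a U)
    (hV : IsLimitRatio m a V) (hC : ∃ C : ℝ, ∀ i j, ‖a i j‖ ≤ C) (i : ℤ) :
    Set.EqOn (U i) (V i) upperHalf := by
  obtain ⟨C, hC⟩ := hC
  have hC0 : 0 ≤ C := (norm_nonneg _).trans (hC 0 0)
  set T : ℝ := C * m ^ 2 + 1 with hT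
  have hT1 : 1 ≤ T := by
    have : 0 ≤ C * (m : ℝ) ^ 2 := by positivity
    linarith
  have hlarge : ∀ z : ℂ, T < z.im → U i z = V i z := by
    intro z hz
    have hz0 : 0 < z.im := by linarith
    have hκ : z.im⁻¹ ≤ T⁻¹ := inv_anti₀ (by linarith) hz.le
    refine congrFun ((hU.solution z hz0).eq_of_norm_le (hV.solution z hz0) hC (κ := T⁻¹)
      (inv_le_one_of_one_le₀ hT1) ?_ (fun i => ((hU.stieltjes i).norm_le hz0).trans hκ)
      (fun i => ((hV.stieltjes i).norm_le hz0).trans hκ)) i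
    rw [inv_pow, inv_mul_eq_div, div_lt_one (by positivity)]
    nlinarith
  have hmem : ((T + 1 : ℝ) : ℂ) * Complex.I ∈ upperHalf := by
    rw [mem_upperHalf]; simp; linarith
  refine AnalyticOnNhd.eqOn_of_preconnected_of_eventuallyEq
    ((hU.stieltjes i).differentiableOn.analyticOnNhd isOpen_upperHalf)
    ((hV.stieltjes i).differentiableOn.analyticOnNhd isOpen_upperHalf) isPreconnected_upperHalf
    hmem ?_
  have hopen : IsOpen {z : ℂ | T < z.im} := isOpen_lt continuous_const Complex.continuous_im
  filter_upwards [hopen.mem_nhds (show ((T + 1 : ℝ) : ℂ) * Complex.I ∈ {z : ℂ | T < z.im} by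
    simp)] with z hz using hlarge z hz

-- Together with uniqueness this yields the r-periodicity of the limiting ratios.
omit [NeZero r] in
theorem IsLimitRatio.shift {m : ℕ} {a : ℤ → ℤ → ℂ} {U : ℤ → ℂ → ℂ} (hU : IsLimitRatio m a U)
    (ha : IsPeriodicHessenberg r m a) : IsLimitRatio m a fun i => U (i + r) where
  stieltjes i := hU.stieltjes _
  solution z hz i := by
    have h := hU.solution z hz (i + r)
    simp only at h ⊢
    rw [h]
    congr 2
    refine Finset.sum_congr rfl fun l _ => ?_
    rw [← ha.periodic i (i - l)]
    rw [show i - (l : ℤ) + r = i + r - l by ring]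
    congr 1
    refine Finset.prod_congr rfl fun p _ => ?_
    rw [show i - 1 - (p : ℤ) + r = i + r - 1 - p by ring]

/-- Along an ultrafilter the bounded ratios converge for all i and z at once, and the ratio equation
passes to the limit. -/
theorem exists_isLimitRatio_ultrafilter (hA : IsLocallyBlockToeplitz r β J A)
    (hQ : ∀ n, IsGeneratedBy r β (J n) (Q n)) (hx : ∀ n, HasInterlacingZeros (Q n) (x n))
    (hs : 0 < s) (𝒰 : Ultrafilter (ℕ × ℕ)) (h𝒰 : (𝒰 : Filter (ℕ × ℕ)) ≤ ratioFilter r s) :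
    ∃ U : ℤ → ℂ → ℂ, IsLimitRatio (r * (β + 1)) (toeplitz β (A s)) U ∧
      ∀ i z, 0 < z.im → Tendsto (fun p : ℕ × ℕ => ratio (Q p.2) ((r : ℤ) * (p.1 : ℕ) + i).toNat z)
        𝒰 (𝓝 (U i z)) := by
  have hst : ∀ n i, IsStieltjesLike (ratio (Q n) i) := fun n i =>
    (hx n).isStieltjesLike_ratio (hQ n).monic (hQ n).natDegree_eq i
  have hlim : ∀ (i : ℤ) (z : ℂ), ∃ w, 0 < z.im → Tendsto (fun p : ℕ × ℕ =>
      ratio (Q p.2) ((r : ℤ) * (p.1 : ℕ) + i).toNat z) 𝒰 (𝓝 w) := by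
    intro i z
    by_cases hz : 0 < z.im
    · obtain ⟨w, _, hw⟩ := (isCompact_closedBall (0 : ℂ) z.im⁻¹).ultrafilter_le_nhds
        (𝒰.map fun p : ℕ × ℕ => ratio (Q p.2) ((r : ℤ) * (p.1 : ℕ) + i).toNat z) (by
          rw [le_principal_iff]
          refine Eventually.of_forall (f := (𝒰 : Filter (ℕ × ℕ))) fun p => ?_
          refine mem_closedBall_zero_iff.mpr ?_
          exact (hst _ _).norm_le hz)
      exact ⟨w, fun _ => hw⟩
    · exact ⟨0, fun h => absurd h hz⟩
  choose U hU using hlim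
  refine ⟨U, ⟨fun i => ?_, fun z hz i => ?_⟩, hU⟩
  · exact IsStieltjesLike.of_tendsto (l := (𝒰 : Filter (ℕ × ℕ))) (fun p => hst _ _)
      fun z hz => hU i z hz
  · refine tendsto_nhds_unique ((hU i z hz).const_mul z) ?_
    have h1 : Tendsto (fun p : ℕ × ℕ => 1 + ratio (Q p.2) ((r : ℤ) * (p.1 : ℕ) + i).toNat z *
        ∑ l ∈ Finset.range (r * (β + 1)), J p.2 ((r : ℤ) * (p.1 : ℕ) + i).toNat
          ((r : ℤ) * (p.1 : ℕ) + (i - l)).toNat * ∏ q ∈ Finset.range l,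
          ratio (Q p.2) ((r : ℤ) * (p.1 : ℕ) + (i - 1 - q)).toNat z) 𝒰
        (𝓝 (1 + U i z * ∑ l ∈ Finset.range (r * (β + 1)), toeplitz β (A s) i (i - l) *
          ∏ p ∈ Finset.range l, U (i - 1 - p) z)) := by
      refine ((hU i z hz).mul (tendsto_finsetSum _ fun l _ => ?_)).const_add 1
      exact ((hA.tendsto_toeplitz hQ hs.le i (i - l)).mono_left h𝒰).mul
        (tendsto_finsetProd _ fun q _ => hU _ z hz)
    refine h1.congr' ?_
    filter_upwards [h𝒰 (eventually_le_ratioFilter (one_le_of_neZero r)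
      ((r * (β + 1) : ℕ) + |i|))] with p hp
    have hp' : ((r * (β + 1) : ℕ) : ℤ) + |i| ≤ (r : ℤ) * (p.1 : ℕ) := hp
    have := neg_abs_le i
    rw [(hQ p.2).ratio_eq (fun k => (hx p.2).eval_ne_zero (hQ p.2).monic (hQ p.2).natDegree_eq k hz)
      (N := ((r : ℤ) * (p.1 : ℕ) + i).toNat) (by omega)]
    congr 2
    refine Finset.sum_congr rfl fun l _ => ?_
    rw [show ((r : ℤ) * (p.1 : ℕ) + (i - l)).toNat = ((r : ℤ) * (p.1 : ℕ) + i).toNat - l by omega]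
    congr 1
    refine Finset.prod_congr rfl fun q _ => ?_
    rw [show ((r : ℤ) * (p.1 : ℕ) + (i - 1 - q)).toNat
      = ((r : ℤ) * (p.1 : ℕ) + i).toNat - 1 - q by omega]

/-- Ratio asymptotics. -/
theorem exists_isLimitRatio (hA : IsLocallyBlockToeplitz r β J A)
    (hQ : ∀ n, IsGeneratedBy r β (J n) (Q n)) (hx : ∀ n, HasInterlacingZeros (Q n) (x n))
    (hs : 0 < s) :
    ∃ U : ℤ → ℂ → ℂ, IsLimitRatio (r * (β + 1)) (toeplitz β (A s)) U ∧
      ∀ i z, 0 < z.im → Tendsto (fun p : ℕ × ℕ => ratio (Q p.2) ((r : ℤ) * (p.1 : ℕ) + i).toNat z)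
        (ratioFilter r s) (𝓝 (U i z)) := by
  have := neBot_ratioFilter (one_le_of_neZero r) hs
  obtain ⟨U, hU, -⟩ := exists_isLimitRatio_ultrafilter hA hQ hx hs
    (Ultrafilter.of (ratioFilter r s)) (Ultrafilter.of_le _)
  refine ⟨U, hU, fun i z hz => ?_⟩
  -- Every ultrafilter limit is a limit family, hence the same one, so the full limit exists.
  rw [tendsto_iff_ultrafilter]
  intro 𝒰 h𝒰
  obtain ⟨V, hV, hlim⟩ := exists_isLimitRatio_ultrafilter hA hQ hx hs 𝒰 h𝒰
  rw [hU.eqOn hV (exists_norm_toeplitz_le β (A s)) i hz]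
  exact hlim i z hz

end Toeplitz

/-! ### The characteristic polynomial as a function of two variables. -/

section Bivariate

/-- The function of two variables `(z, x)` defined by a polynomial in `z` over `ℂ[x]`. -/
def bivEval (e : ℂ[X][X]) (p : ℂ × ℂ) : ℂ := e.evalEval p.2 p.1

theorem contDiff_eval {n : WithTop ℕ∞} (a : ℂ[X]) : ContDiff ℂ n fun x : ℂ => a.eval x := by
  simpa [Polynomial.aeval_def] using a.contDiff_aeval (𝕜 := ℂ) n

theorem contDiff_bivEval {n : WithTop ℕ∞} (e : ℂ[X][X]) : ContDiff ℂ n (bivEval e) := by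
  induction e using Polynomial.induction_on' with
  | add p q hp hq =>
    have : bivEval (p + q) = fun x => bivEval p x + bivEval q x := by
      ext x; simp [bivEval, evalEval_add]
    rw [this]
    exact hp.add hq
  | monomial k a =>
    have : bivEval (monomial k a) = fun x : ℂ × ℂ => a.eval x.2 * x.1 ^ k := by
      ext x
      simp [bivEval, evalEval, eval_monomial]
    rw [this]
    exact ((contDiff_eval a).comp contDiff_snd).mul (contDiff_fst.pow k)

theorem continuous_bivEval (e : ℂ[X][X]) : Continuous (bivEval e) :=
  (contDiff_bivEval (n := 0) e).continuous

theorem hasStrictFDerivAt_bivEval (e : ℂ[X][X]) (p : ℂ × ℂ) :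
    HasStrictFDerivAt (bivEval e) (fderiv ℂ (bivEval e) p) p :=
  (contDiff_bivEval (n := 1) e).contDiffAt.hasStrictFDerivAt one_ne_zero

theorem continuous_fderiv_bivEval (e : ℂ[X][X]) : Continuous (fderiv ℂ (bivEval e)) :=
  (contDiff_bivEval (n := 1) e).continuous_fderiv one_ne_zero

theorem fderiv_bivEval_fst (e : ℂ[X][X]) (z x : ℂ) :
    fderiv ℂ (bivEval e) (z, x) (1, 0) = bivEval (derivative e) (z, x) := by
  have h1 : HasDerivAt (fun w : ℂ => (w, x)) (1, 0) z :=
    (hasDerivAt_id z).prodMk (hasDerivAt_const z x)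
  have h2 := (hasStrictFDerivAt_bivEval e (z, x)).hasFDerivAt.comp_hasDerivAt z h1
  have h3 : HasDerivAt (bivEval e ∘ fun w : ℂ => (w, x)) (bivEval (derivative e) (z, x)) z := by
    have : (bivEval e ∘ fun w : ℂ => (w, x)) = fun w => (e.map (evalRingHom x)).eval w := by
      ext w
      simp only [Function.comp, bivEval, map_evalRingHom_eval]
    rw [this, bivEval, ← map_evalRingHom_eval, ← derivative_map]
    exact Polynomial.hasDerivAt _ _
  exact h2.unique h3

theorem fderiv_bivEval_apply (e : ℂ[X][X]) (z x a b : ℂ) :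
    fderiv ℂ (bivEval e) (z, x) (a, b)
      = a * bivEval (derivative e) (z, x) + b * fderiv ℂ (bivEval e) (z, x) (0, 1) := by
  rw [← fderiv_bivEval_fst, ← smul_eq_mul, ← smul_eq_mul, ← map_smul, ← map_smul, ← map_add]
  simp

variable {r : ℕ} (β : ℕ) (A : ℤ → Matrix (Fin r) (Fin r) ℂ)

/-- `rootPoly` as a polynomial in `z` with coefficients in `ℂ[x]`. -/
def bivPoly : ℂ[X][X] :=
  (∑ j ∈ Finset.Icc (-1 : ℤ) β, (X : ℂ[X][X]) ^ (j + 1).toNat •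
      (A j).map ((C : ℂ[X] →+* ℂ[X][X]).comp (C : ℂ →+* ℂ[X]))
    - (C (X : ℂ[X]) * X : ℂ[X][X]) • (1 : Matrix (Fin r) (Fin r) ℂ[X][X])).det

theorem bivPoly_map (x : ℂ) : (bivPoly β A).map (evalRingHom x) = rootPoly β A x := by
  rw [bivPoly, rootPoly, ← coe_mapRingHom, RingHom.map_det]
  congr 1
  ext1 a b
  simp only [RingHom.mapMatrix_apply, Matrix.map_apply, Matrix.sub_apply, Matrix.sum_apply,
    Matrix.smul_apply, smul_eq_mul, map_sub, map_sum, coe_mapRingHom, RingHom.comp_apply,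
    Matrix.one_apply]
  split_ifs <;> simp

theorem bivEval_bivPoly (z x : ℂ) : bivEval (bivPoly β A) (z, x) = (rootPoly β A x).eval z := by
  rw [bivEval, ← map_evalRingHom_eval, bivPoly_map]

theorem bivEval_bivPoly_eq_zero_iff {z : ℂ} (hz : z ≠ 0) (x : ℂ) :
    bivEval (bivPoly β A) (z, x) = 0 ↔ f β A z x = 0 := by
  rw [bivEval_bivPoly, eval_rootPoly β A x hz, mul_eq_zero]
  simp [hz]

theorem bivEval_derivative_bivPoly (z x : ℂ) :
    bivEval (derivative (bivPoly β A)) (z, x) = (rootPoly β A x).derivative.eval z := by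
  rw [bivEval, ← map_evalRingHom_eval, ← derivative_map, bivPoly_map]

end Bivariate

/-! ### The root of smallest modulus. -/

section MinRoot

variable {r : ℕ} {β : ℕ} {A : ℤ → Matrix (Fin r) (Fin r) ℂ}

/-- `z` is a nonzero root of `f(·, x)` of smallest modulus. -/
structure IsMinRoot (β : ℕ) (A : ℤ → Matrix (Fin r) (Fin r) ℂ) (x z : ℂ) : Prop where
  ne_zero : z ≠ 0
  root : f β A z x = 0
  le : ∀ w, w ≠ 0 → f β A w x = 0 → ‖z‖ ≤ ‖w‖

/-- Keeps limits of roots away from the excluded value 0, locally uniformly in x; the minimum with 1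
covers roots outside the unit disk. -/
theorem exists_le_norm_root [NeZero r]
    (H : IsPeriodicHessenberg r (r * (β + 1)) (toeplitz β A)) (R : ℝ) :
    ∃ δ > 0, ∀ x : ℂ, ‖x‖ ≤ R → ∀ z : ℂ, z ≠ 0 → f β A z x = 0 → δ ≤ ‖z‖ := by
  obtain ⟨C, hC⟩ := exists_norm_toeplitz_le β A
  have hC0 : 0 ≤ C := (norm_nonneg _).trans (hC 0 0)
  set B : ℝ := (max R 0 + C * (r * (β + 1) : ℕ) + 1) ^ r with hB
  have hB0 : 0 < B := by positivity
  refine ⟨min 1 B⁻¹, by positivity, fun x hx z hz h => ?_⟩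
  rcases le_or_gt ‖z‖ 1 with h1 | h1
  · refine (min_le_right _ _).trans ?_
    have h2 := pow_mul_norm_ge_one_of_root β A H hC hz h1 h
    have h3 : (‖x‖ + C * (r * (β + 1) : ℕ) + 1) ^ r ≤ B := by
      rw [hB]
      gcongr
      exact hx.trans (le_max_left _ _)
    have h4 : 1 ≤ B * ‖z‖ := h2.trans (by gcongr)
    rw [← one_div, div_le_iff₀ hB0]
    linarith
  · exact (min_le_left _ _).trans h1.le

/-- If it vanished identically, every nonzero z would be a root, contradicting the lower bound on
roots. -/
theorem rootPoly_ne_zero [NeZero r]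
    (H : IsPeriodicHessenberg r (r * (β + 1)) (toeplitz β A)) (x : ℂ) : rootPoly β A x ≠ 0 := by
  intro h0
  obtain ⟨δ, hδ, h⟩ := exists_le_norm_root H ‖x‖
  have hz : ((δ / 2 : ℝ) : ℂ) ≠ 0 := by
    exact_mod_cast (half_pos hδ).ne'
  have h1 := h x le_rfl _ hz (by
    rw [← bivEval_bivPoly_eq_zero_iff β A hz, bivEval_bivPoly, h0, eval_zero])
  rw [Complex.norm_real, Real.norm_of_nonneg (half_pos hδ).le] at h1
  linarith

theorem mem_roots_iff [NeZero r] (H : IsPeriodicHessenberg r (r * (β + 1)) (toeplitz β A))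
    {x z : ℂ} : z ∈ roots β A x ↔ z ≠ 0 ∧ f β A z x = 0 := by
  rw [roots, Multiset.mem_filter, mem_roots (rootPoly_ne_zero H x), IsRoot.def, and_comm]
  refine and_congr_right fun hz => ?_
  rw [← bivEval_bivPoly, bivEval_bivPoly_eq_zero_iff β A hz]

theorem IsMinRoot.mem_Gamma1 [NeZero r] (H : IsPeriodicHessenberg r (r * (β + 1)) (toeplitz β A))
    {x z w : ℂ} {t : Multiset ℂ} (hz : IsMinRoot β A x z) (ht : roots β A x = z ::ₘ w ::ₘ t)
    (hw : ‖w‖ ≤ ‖z‖) : x ∈ Gamma1 β A := by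
  have hmem : ∀ v ∈ roots β A x, ‖z‖ ≤ ‖v‖ := fun v hv =>
    hz.le v ((mem_roots_iff H).mp hv).1 ((mem_roots_iff H).mp hv).2
  refine ⟨z, w, t, ht, le_antisymm (hmem w ?_) hw, fun v hv => hw.trans (hmem v ?_)⟩ <;>
  · rw [ht]; simp_all

theorem IsMinRoot.eq_of_notMem_Gamma1 [NeZero r]
    (H : IsPeriodicHessenberg r (r * (β + 1)) (toeplitz β A)) {x z w : ℂ}
    (hx : x ∉ Gamma1 β A) (hz : IsMinRoot β A x z) (hw : IsMinRoot β A x w) : z = w := by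
  by_contra hne
  obtain ⟨t, ht⟩ := Multiset.exists_cons_of_mem ((mem_roots_iff H).mpr ⟨hz.ne_zero, hz.root⟩)
  have hwt : w ∈ t := by
    have h1 := (mem_roots_iff H).mpr ⟨hw.ne_zero, hw.root⟩
    rw [ht, Multiset.mem_cons] at h1
    exact h1.resolve_left (Ne.symm hne)
  obtain ⟨m, hm⟩ := Multiset.exists_cons_of_mem hwt
  rw [hm] at ht
  exact hx (hz.mem_Gamma1 H ht (hw.le z hz.ne_zero hz.root))

/-- A multiple smallest root would occur twice in `roots`, putting x into Γ₁. -/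
theorem IsMinRoot.derivative_ne_zero [NeZero r]
    (H : IsPeriodicHessenberg r (r * (β + 1)) (toeplitz β A)) {x z : ℂ}
    (hx : x ∉ Gamma1 β A) (hz : IsMinRoot β A x z) :
    bivEval (derivative (bivPoly β A)) (z, x) ≠ 0 := by
  classical
  intro h0
  rw [bivEval_derivative_bivPoly] at h0
  have hroot : (rootPoly β A x).IsRoot z := by
    rw [IsRoot.def, ← bivEval_bivPoly, bivEval_bivPoly_eq_zero_iff β A hz.ne_zero]
    exact hz.root
  have h1 := (one_lt_rootMultiplicity_iff_isRoot (rootPoly_ne_zero H x)).mpr ⟨hroot, h0⟩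
  obtain ⟨t, ht⟩ := Multiset.exists_cons_of_mem ((mem_roots_iff H).mpr ⟨hz.ne_zero, hz.root⟩)
  have hcount : 1 < (roots β A x).count z := by
    rw [roots, Multiset.count_filter_of_pos (p := fun z => z ≠ 0) hz.ne_zero, count_roots]
    exact h1
  rw [ht, Multiset.count_cons_self] at hcount
  have hzt : z ∈ t := Multiset.count_pos.mp (by omega)
  obtain ⟨m, hm⟩ := Multiset.exists_cons_of_mem hzt
  rw [hm] at ht
  exact hx (hz.mem_Gamma1 H ht le_rfl)

/-- Continuity of the roots: near a root of `f(·, x₀)` there are roots of `f(·, x)`. -/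
theorem eventually_exists_root [NeZero r]
    (H : IsPeriodicHessenberg r (r * (β + 1)) (toeplitz β A)) {x₀ w : ℂ} (hw : w ≠ 0)
    (h : f β A w x₀ = 0) {ε : ℝ} (hε : 0 < ε) :
    ∀ᶠ x in 𝓝 x₀, ∃ v, v ≠ 0 ∧ f β A v x = 0 ∧ ‖v - w‖ < ε := by
  have hw0 : 0 < ‖w‖ := norm_pos_iff.mpr hw
  set F := bivEval (bivPoly β A) with hF
  have hFc : Continuous F := continuous_bivEval _
  have hFw : F (w, x₀) = 0 := (bivEval_bivPoly_eq_zero_iff β A hw x₀).mpr h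
  classical
  -- A circle around w missing the finitely many roots at x₀, with ρ < ‖w‖ so that the closed disk
  -- excludes 0.
  obtain ⟨ρ, ⟨hρ0, hρ1⟩, hρ⟩ := (Set.Ioo_infinite (show 0 < min ε ‖w‖ by positivity)).exists_notMem_finset
    ((rootPoly β A x₀).roots.toFinset.image fun z => ‖z - w‖)
  rw [lt_min_iff] at hρ1
  have hne : ∀ z ∈ Metric.sphere w ρ, F (z, x₀) ≠ 0 := by
    intro z hz h0
    refine hρ (Finset.mem_image.mpr ⟨z, ?_, by simpa [dist_eq_norm] using hz⟩)
    rw [Multiset.mem_toFinset, mem_roots (rootPoly_ne_zero H x₀), IsRoot.def, ← bivEval_bivPoly]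
    exact h0
  obtain ⟨δ, hδ, hδF⟩ : ∃ δ > 0, ∀ z ∈ Metric.sphere w ρ, δ ≤ ‖F (z, x₀)‖ := by
    obtain ⟨z₀, hz₀, hmin⟩ := (isCompact_sphere w ρ).exists_isMinOn
      (NormedSpace.sphere_nonempty.mpr hρ0.le)
      (f := fun z => ‖F (z, x₀)‖) (by fun_prop)
    exact ⟨_, norm_pos_iff.mpr (hne z₀ hz₀), fun z hz => hmin hz⟩
  have hcomp : ∀ᶠ x in 𝓝 x₀, ∀ z ∈ Metric.sphere w ρ, δ / 2 < ‖F (z, x) - F (w, x)‖ := by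
    refine (isCompact_sphere w ρ).eventually_forall_of_forall_eventually fun z hz => ?_
    have hcont : Continuous fun p : ℂ × ℂ => ‖F (p.2, p.1) - F (w, p.1)‖ := by fun_prop
    refine (hcont.tendsto (x₀, z)).eventually (lt_mem_nhds ?_)
    simp only [hFw, sub_zero]
    have := hδF z hz
    linarith
  have hsmall : ∀ᶠ x in 𝓝 x₀, ‖F (w, x)‖ < δ / 4 := by
    have hcont : Continuous fun x : ℂ => ‖F (w, x)‖ := by fun_prop
    refine (hcont.tendsto x₀).eventually (gt_mem_nhds ?_)
    rw [hFw, norm_zero]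
    positivity
  filter_upwards [hcomp, hsmall] with x h1 h2
  have hpoly : ∀ z, F (z, x) = (rootPoly β A x).eval z := fun z => bivEval_bivPoly β A z x
  have hfreq : ∃ᶠ z in 𝓝 w, F (z, x) ≠ F (w, x) := by
    intro hev
    simp only [not_not, hpoly] at hev
    have hinf : (rootPoly β A x) = C ((rootPoly β A x).eval w) := by
      refine Polynomial.eq_of_infinite_eval_eq _ _ ?_
      refine Set.Infinite.mono (fun z hz => ?_) (infinite_of_mem_nhds w hev)
      simpa using hz
    obtain ⟨z₀, hz₀⟩ := NormedSpace.sphere_nonempty (x := w) (r := ρ) |>.mpr hρ0.le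
    have h3 := h1 z₀ hz₀
    rw [hpoly, hpoly, hinf, eval_C, eval_C, sub_self, norm_zero] at h3
    linarith
  have hd : DiffContOnCl ℂ (fun z => F (z, x)) (Metric.ball w ρ) := by
    have : Differentiable ℂ fun z => F (z, x) := by
      simp only [hpoly]
      exact Polynomial.differentiable _
    exact this.diffContOnCl
  -- Quantitative open mapping: the image of the disk contains the ball of radius δ/4 about F(w, x),
  -- and 0 lies in that ball.
  obtain ⟨v, hv, hv0⟩ := hd.ball_subset_image_closedBall hρ0 (fun z hz => (h1 z hz).le) hfreq
    (show (0 : ℂ) ∈ Metric.ball (F (w, x)) (δ / 2 / 2) by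
      rw [Metric.mem_ball, dist_comm, dist_zero_right]; linarith)
  rw [Metric.mem_closedBall, dist_eq_norm] at hv
  have hvne : v ≠ 0 := by
    rintro rfl
    rw [zero_sub, norm_neg] at hv
    linarith [hρ1.2]
  exact ⟨v, hvne, (bivEval_bivPoly_eq_zero_iff β A hvne x).mp hv0, hv.trans_lt hρ1.1⟩

/-- A root at x₀ strictly smaller than the limit would, by continuity of roots, have nearby roots at
X_i that beat ζ_i. -/
theorem isMinRoot_of_tendsto [NeZero r]
    (H : IsPeriodicHessenberg r (r * (β + 1)) (toeplitz β A)) {ι : Type*} {l : Filter ι} [l.NeBot]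
    {X ζ : ι → ℂ} {x₀ z₀ : ℂ} (hX : Tendsto X l (𝓝 x₀)) (hζ : Tendsto ζ l (𝓝 z₀))
    (h : ∀ᶠ i in l, IsMinRoot β A (X i) (ζ i)) : IsMinRoot β A x₀ z₀ := by
  have hz₀ : z₀ ≠ 0 := by
    obtain ⟨δ, hδ, hδz⟩ := exists_le_norm_root H (‖x₀‖ + 1)
    have h1 : δ ≤ ‖z₀‖ := by
      refine ge_of_tendsto hζ.norm ?_
      filter_upwards [h, hX.norm.eventually (gt_mem_nhds (lt_add_one ‖x₀‖))] with i hi hi2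
      exact hδz _ hi2.le _ hi.ne_zero hi.root
    exact norm_pos_iff.mp (hδ.trans_le h1)
  refine ⟨hz₀, ?_, fun w hw hw0 => ?_⟩
  · rw [← bivEval_bivPoly_eq_zero_iff β A hz₀]
    have h1 := ((continuous_bivEval (bivPoly β A)).tendsto (z₀, x₀)).comp (hζ.prodMk_nhds hX)
    refine tendsto_nhds_unique h1 (tendsto_const_nhds.congr' ?_)
    filter_upwards [h] with i hi
    exact ((bivEval_bivPoly_eq_zero_iff β A hi.ne_zero _).mpr hi.root).symm
  · refine le_of_forall_pos_le_add fun ε hε => ?_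
    refine le_of_tendsto hζ.norm ?_
    filter_upwards [h, hX.eventually (eventually_exists_root H hw hw0 hε)] with i hi hi2
    obtain ⟨v, hv, hv0, hvw⟩ := hi2
    have h1 := hi.le v hv hv0
    have h2 := norm_le_norm_add_norm_sub' v w
    linarith

theorem eventually_isMinRoot_norm_le [NeZero r]
    (H : IsPeriodicHessenberg r (r * (β + 1)) (toeplitz β A)) {x₀ : ℂ}
    (h : ∃ z, z ≠ 0 ∧ f β A z x₀ = 0) :
    ∃ B : ℝ, ∀ᶠ x in 𝓝 x₀, ∀ z, IsMinRoot β A x z → ‖z‖ ≤ B := by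
  obtain ⟨w, hw, hw0⟩ := h
  refine ⟨‖w‖ + 1, ?_⟩
  filter_upwards [eventually_exists_root H hw hw0 one_pos] with x hx z hz
  obtain ⟨v, hv, hv0, hvw⟩ := hx
  have h1 := hz.le v hv hv0
  have h2 := norm_le_norm_add_norm_sub' v w
  linarith

/-- Otherwise strictly smaller roots w(x) exist for x arbitrarily close to x₀. They are bounded, and
a limit of them is a smallest root at x₀, hence equals ζ(x₀) off Γ₁; but that root is simple, so no
second branch can approach it. -/
theorem eventually_isMinRoot [NeZero r]
    (H : IsPeriodicHessenberg r (r * (β + 1)) (toeplitz β A)) {x₀ : ℂ} {ζ : ℂ → ℂ}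
    (hζ : ContinuousAt ζ x₀) (hroot : ∀ᶠ x in 𝓝 x₀, ζ x ≠ 0 ∧ f β A (ζ x) x = 0)
    (hmin : IsMinRoot β A x₀ (ζ x₀)) (hx₀ : x₀ ∉ Gamma1 β A) :
    ∀ᶠ x in 𝓝 x₀, IsMinRoot β A x (ζ x) := by
  by_contra hcon
  have hex : ∃ᶠ x in 𝓝 x₀, ∃ w, w ≠ 0 ∧ f β A w x = 0 ∧ ‖w‖ < ‖ζ x‖ := by
    refine (Filter.not_eventually.mp hcon).and_eventually hroot |>.mono fun x hx => ?_
    by_contra hno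
    push Not at hno
    exact hx.1 ⟨hx.2.1, hx.2.2, hno⟩
  set S : Set ℂ := {x | ∃ w, w ≠ 0 ∧ f β A w x = 0 ∧ ‖w‖ < ‖ζ x‖} with hS
  have hne : (𝓝 x₀ ⊓ 𝓟 S).NeBot := frequently_mem_iff_neBot.mp hex
  set V := Ultrafilter.of (𝓝 x₀ ⊓ 𝓟 S) with hV
  have hV0 : (V : Filter ℂ) ≤ 𝓝 x₀ := (Ultrafilter.of_le _).trans inf_le_left
  have hVS : ∀ᶠ x in (V : Filter ℂ), x ∈ S :=
    (Ultrafilter.of_le _).trans inf_le_right (mem_principal_self S)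
  have hch : ∀ x, ∃ w, x ∈ S → w ≠ 0 ∧ f β A w x = 0 ∧ ‖w‖ < ‖ζ x‖ := fun x => by
    by_cases hx : x ∈ S
    · obtain ⟨w, hw⟩ := hx
      exact ⟨w, fun _ => hw⟩
    · exact ⟨0, fun h => absurd h hx⟩
  choose w hw using hch
  have hζV : Tendsto ζ V (𝓝 (ζ x₀)) := hζ.mono_left hV0
  obtain ⟨w₀, -, hw₀⟩ := (isCompact_closedBall (0 : ℂ) (‖ζ x₀‖ + 1)).ultrafilter_le_nhds
    (V.map w) (by
      rw [le_principal_iff]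
      change ∀ᶠ x in (V : Filter ℂ), w x ∈ Metric.closedBall 0 (‖ζ x₀‖ + 1)
      filter_upwards [hVS, hζV.norm.eventually (gt_mem_nhds (lt_add_one _))] with x hx hx2
      exact mem_closedBall_zero_iff.mpr ((hw x hx).2.2.le.trans hx2.le))
  have hw₀ : Tendsto w V (𝓝 w₀) := hw₀
  have hle : ‖w₀‖ ≤ ‖ζ x₀‖ := by
    refine le_of_tendsto_of_tendsto hw₀.norm hζV.norm ?_
    filter_upwards [hVS] with x hx using (hw x hx).2.2.le
  have hw₀0 : w₀ ≠ 0 := by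
    obtain ⟨δ, hδ, hδz⟩ := exists_le_norm_root H (‖x₀‖ + 1)
    have h1 : δ ≤ ‖w₀‖ := by
      refine ge_of_tendsto hw₀.norm ?_
      filter_upwards [hVS, hV0 (continuous_norm.continuousAt.eventually
        (gt_mem_nhds (lt_add_one ‖x₀‖)))] with x hx hx2
      exact hδz _ (le_of_lt hx2) _ (hw x hx).1 (hw x hx).2.1
    exact norm_pos_iff.mp (hδ.trans_le h1)
  set F := bivEval (bivPoly β A) with hF
  have hroot₀ : f β A w₀ x₀ = 0 := by
    rw [← bivEval_bivPoly_eq_zero_iff β A hw₀0]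
    have h1 := ((continuous_bivEval (bivPoly β A)).tendsto (w₀, x₀)).comp
      (hw₀.prodMk_nhds (tendsto_id'.mpr hV0))
    refine tendsto_nhds_unique h1 (tendsto_const_nhds.congr' ?_)
    filter_upwards [hVS] with x hx
    exact ((bivEval_bivPoly_eq_zero_iff β A (hw x hx).1 _).mpr (hw x hx).2.1).symm
  have hminw : IsMinRoot β A x₀ w₀ :=
    ⟨hw₀0, hroot₀, fun v hv hv0 => hle.trans (hmin.le v hv hv0)⟩
  have heq : w₀ = ζ x₀ := hminw.eq_of_notMem_Gamma1 H hx₀ hmin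
  have hD := hmin.derivative_ne_zero H hx₀
  set D := bivEval (derivative (bivPoly β A)) (ζ x₀, x₀) with hDdef
  -- Strict differentiability compares the zero values at (w x, x) and (ζ x, x), giving |D||w - ζ| ≤
  -- (|D|/2)|w - ζ| near x₀, so w = ζ.
  have hstrict := (hasStrictFDerivAt_bivEval (bivPoly β A) (ζ x₀, x₀)).isLittleO
  rw [heq] at hw₀
  have htend : Tendsto (fun x => ((w x, x), (ζ x, x))) V (𝓝 ((ζ x₀, x₀), (ζ x₀, x₀))) :=
    (hw₀.prodMk_nhds (tendsto_id'.mpr hV0)).prodMk_nhds (hζV.prodMk_nhds (tendsto_id'.mpr hV0))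
  have hlo := (hstrict.comp_tendsto htend).def (half_pos (norm_pos_iff.mpr hD))
  have hfalse : ∀ᶠ x in (V : Filter ℂ), False := by
    filter_upwards [hlo, hVS, hV0 hroot] with x h1 hx hx2
    simp only [Function.comp] at h1
    rw [(bivEval_bivPoly_eq_zero_iff β A (hw x hx).1 _).mpr (hw x hx).2.1,
      (bivEval_bivPoly_eq_zero_iff β A hx2.1 _).mpr hx2.2, Prod.mk_sub_mk, sub_self x,
      fderiv_bivEval_apply, zero_mul, add_zero, sub_self, zero_sub, norm_neg, norm_mul] at h1
    have h2 : ‖((w x - ζ x, 0) : ℂ × ℂ)‖ = ‖w x - ζ x‖ := by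
      rw [Prod.norm_def, norm_zero, max_eq_left (norm_nonneg _)]
    rw [h2] at h1
    have h3 : 0 < ‖D‖ := norm_pos_iff.mpr hD
    have h4 : w x - ζ x = 0 := by
      rw [← norm_le_zero_iff]
      by_contra hlt
      rw [not_le] at hlt
      nlinarith
    have h5 := (hw x hx).2.2
    rw [sub_eq_zero.mp h4] at h5
    exact lt_irrefl _ h5
  exact hfalse.exists.elim fun _ h => h

end MinRoot

/-! ### Boundary limits at real points. -/

theorem mem_closure_upperHalf (t : ℝ) : (t : ℂ) ∈ closure upperHalf := by
  have : closure upperHalf = {z : ℂ | 0 ≤ z.im} := Complex.closure_setOfPred_lt_im 0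
  rw [this]; simp

instance neBot_nhdsWithin_upperHalf (t : ℝ) : (𝓝[upperHalf] (t : ℂ)).NeBot :=
  mem_closure_iff_nhdsWithin_neBot.mp (mem_closure_upperHalf t)

/-- A continuous function on the upper half plane, bounded near a boundary point, with finitely many
limit points there, has a limit there. -/
theorem exists_tendsto_of_finite {g : ℂ → ℂ} {t : ℝ} (hg : ContinuousOn g upperHalf) {S : Set ℂ}
    (hS : S.Finite) {B : ℝ} (hB : ∀ᶠ x in 𝓝[upperHalf] (t : ℂ), ‖g x‖ ≤ B)
    (hlim : ∀ (𝒰 : Ultrafilter ℂ) (w : ℂ), (𝒰 : Filter ℂ) ≤ 𝓝[upperHalf] (t : ℂ) →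
      Tendsto g 𝒰 (𝓝 w) → w ∈ S) : ∃ w ∈ S, Tendsto g (𝓝[upperHalf] (t : ℂ)) (𝓝 w) := by
  have hex : ∀ 𝒰 : Ultrafilter ℂ, (𝒰 : Filter ℂ) ≤ 𝓝[upperHalf] (t : ℂ) →
      ∃ w ∈ S, Tendsto g 𝒰 (𝓝 w) := by
    intro 𝒰 h𝒰
    obtain ⟨w, -, hw⟩ := (isCompact_closedBall (0 : ℂ) B).ultrafilter_le_nhds (𝒰.map g) (by
      rw [le_principal_iff]
      change ∀ᶠ x in (𝒰 : Filter ℂ), g x ∈ Metric.closedBall 0 B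
      filter_upwards [h𝒰 hB] with x hx
      exact mem_closedBall_zero_iff.mpr hx)
    exact ⟨w, hlim 𝒰 w h𝒰 hw, hw⟩
  obtain ⟨w, hwS, hw⟩ := hex (Ultrafilter.of (𝓝[upperHalf] (t : ℂ))) (Ultrafilter.of_le _)
  refine ⟨w, hwS, ?_⟩
  have hiso : (S \ {w})ᶜ ∈ 𝓝 w :=
    (hS.subset Set.sdiff_subset).isClosed.isOpen_compl.mem_nhds (by simp)
  obtain ⟨ε₀, hε₀, hball⟩ := Metric.mem_nhds_iff.mp hiso
  have hbasis := Metric.nhdsWithin_basis_ball (x := (t : ℂ)) (s := upperHalf)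
  have key : ∀ ε, 0 < ε → ε < ε₀ → ∀ᶠ x in 𝓝[upperHalf] (t : ℂ), ‖g x - w‖ < ε := by
    intro ε hε hεε
    -- Values at distance exactly ε from w along a sequence of approach would produce a limit point
    -- in S at that distance, inside the ball isolating w.
    have hne : ∀ᶠ x in 𝓝[upperHalf] (t : ℂ), ‖g x - w‖ ≠ ε := by
      by_contra hcon
      have hfreq : ∃ᶠ x in 𝓝[upperHalf] (t : ℂ), x ∈ {x | ‖g x - w‖ = ε} := by
        rw [Filter.not_eventually] at hcon
        exact hcon.mono fun x hx => not_not.mp hx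
      have hnb := frequently_mem_iff_neBot.mp hfreq
      set 𝒱 := Ultrafilter.of (𝓝[upperHalf] (t : ℂ) ⊓ 𝓟 {x | ‖g x - w‖ = ε})
      have h1 : (𝒱 : Filter ℂ) ≤ 𝓝[upperHalf] (t : ℂ) := (Ultrafilter.of_le _).trans inf_le_left
      have h2 : ∀ᶠ x in (𝒱 : Filter ℂ), ‖g x - w‖ = ε :=
        (Ultrafilter.of_le _).trans inf_le_right (mem_principal_self _)
      obtain ⟨v, hvS, hv⟩ := hex 𝒱 h1
      have h3 : ‖v - w‖ = ε :=
        tendsto_nhds_unique (hv.sub_const w).norm (tendsto_const_nhds.congr' (h2.mono fun _ h => h.symm))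
      have h4 : v ∈ Metric.ball w ε₀ := by rw [Metric.mem_ball, dist_eq_norm, h3]; exact hεε
      refine hball h4 ⟨hvS, fun h => ?_⟩
      rw [Set.mem_singleton_iff.mp h, sub_self, norm_zero] at h3
      exact hε.ne h3
    obtain ⟨δ, hδ, hδs⟩ := hbasis.eventually_iff.mp hne
    -- Half disks are connected, so ‖g - w‖, being below ε somewhere and never equal to ε, stays
    -- below ε.
    have hconv : IsPreconnected (Metric.ball (t : ℂ) δ ∩ upperHalf) :=
      ((convex_ball _ _).inter convex_upperHalf).isPreconnected
    have hcont : ContinuousOn (fun x => ‖g x - w‖) (Metric.ball (t : ℂ) δ ∩ upperHalf) :=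
      ((hg.mono Set.inter_subset_right).sub continuousOn_const).norm
    have hmem : Metric.ball (t : ℂ) δ ∩ upperHalf ∈ 𝓝[upperHalf] (t : ℂ) := hbasis.mem_of_mem hδ
    have hsmall : ∀ᶠ x in (Ultrafilter.of (𝓝[upperHalf] (t : ℂ)) : Filter ℂ), ‖g x - w‖ < ε := by
      have := (hw.sub_const w).norm
      rw [sub_self, norm_zero] at this
      exact this.eventually (gt_mem_nhds hε)
    obtain ⟨x₁, hx₁, hx₁D⟩ := (hsmall.and (Ultrafilter.of_le _ hmem)).exists
    filter_upwards [hmem] with x hx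
    by_contra hge
    rw [not_lt] at hge
    obtain ⟨y, hy, hy2⟩ := hconv.intermediate_value hx₁D hx hcont ⟨hx₁.le, hge⟩
    exact hδs hy hy2
  rw [Metric.tendsto_nhds]
  intro ε hε
  filter_upwards [key (min ε (ε₀ / 2)) (by positivity)
    ((min_le_right _ _).trans_lt (half_lt_self hε₀))] with x hx
  rw [dist_eq_norm]
  exact hx.trans_le (min_le_left _ _)

/-! ### Identification of z₁ with the product of the limiting ratios. -/

/-- The data attached to a fixed value of `s`: the block coefficients of the symbol, and the limits
of the ratios of consecutive polynomials. -/
structure IsRegularSymbol {r : ℕ} [NeZero r] (β : ℕ) (A : ℤ → Matrix (Fin r) (Fin r) ℂ)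
    (U : ℤ → ℂ → ℂ) : Prop where
  hessenberg : IsPeriodicHessenberg r (r * (β + 1)) (toeplitz β A)
  limitRatio : IsLimitRatio (r * (β + 1)) (toeplitz β A) U
  conj_eq : ∀ j ∈ Finset.Icc (-1 : ℤ) β, ∀ a b, (starRingEnd ℂ) (A j a b) = A j a b
  exists_root : ∀ y : ℂ, ∃ z : ℂ, z ≠ 0 ∧ f β A z y = 0
  gamma_real : Gamma1 β A ⊆ Set.range ((↑) : ℝ → ℂ)

/-- The product of the ratios over a period. -/
def periodProd (r : ℕ) (U : ℤ → ℂ → ℂ) (x : ℂ) : ℂ := ∏ p ∈ Finset.range r, U p x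

theorem symbol_conj {r : ℕ} {β : ℕ} {A : ℤ → Matrix (Fin r) (Fin r) ℂ}
    (hA : ∀ j ∈ Finset.Icc (-1 : ℤ) β, ∀ a b, (starRingEnd ℂ) (A j a b) = A j a b) (z : ℂ) :
    symbol β A ((starRingEnd ℂ) z) = (symbol β A z).map (starRingEnd ℂ) := by
  ext a b
  simp only [symbol, Matrix.map_apply, Matrix.sum_apply, Matrix.smul_apply, smul_eq_mul, map_sum,
    map_mul, map_zpow₀]
  exact Finset.sum_congr rfl fun j hj => by rw [hA j hj]

theorem f_conj {r : ℕ} {β : ℕ} {A : ℤ → Matrix (Fin r) (Fin r) ℂ}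
    (hA : ∀ j ∈ Finset.Icc (-1 : ℤ) β, ∀ a b, (starRingEnd ℂ) (A j a b) = A j a b) (z x : ℂ) :
    f β A ((starRingEnd ℂ) z) ((starRingEnd ℂ) x) = (starRingEnd ℂ) (f β A z x) := by
  rw [f, f, RingHom.map_det, symbol_conj hA]
  congr 1
  ext a b
  simp only [RingHom.mapMatrix_apply, Matrix.map_apply, Matrix.sub_apply, Matrix.smul_apply,
    smul_eq_mul, map_sub, map_mul, Matrix.one_apply]
  split_ifs <;> simp

theorem IsMinRoot.conj {r : ℕ} {β : ℕ} {A : ℤ → Matrix (Fin r) (Fin r) ℂ}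
    (hA : ∀ j ∈ Finset.Icc (-1 : ℤ) β, ∀ a b, (starRingEnd ℂ) (A j a b) = A j a b) {x z : ℂ}
    (h : IsMinRoot β A x z) :
    IsMinRoot β A ((starRingEnd ℂ) x) ((starRingEnd ℂ) z) where
  ne_zero := by simpa using h.ne_zero
  root := by rw [f_conj hA, h.root, map_zero]
  le w hw hw0 := by
    have h1 := f_conj hA w ((starRingEnd ℂ) x)
    rw [Complex.conj_conj, hw0, map_zero] at h1
    have := h.le _ (by simpa using hw) h1
    simpa using this

theorem IsMinRoot.z1_eq {r : ℕ} [NeZero r] {β : ℕ} {A : ℤ → Matrix (Fin r) (Fin r) ℂ}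
    (H : IsPeriodicHessenberg r (r * (β + 1)) (toeplitz β A)) {x z : ℂ}
    (hx : x ∉ Gamma1 β A) (hz : IsMinRoot β A x z) : z1 β A x = z := by
  have h : ∃ z ∈ roots β A x, ∀ w ∈ roots β A x, ‖z‖ ≤ ‖w‖ :=
    ⟨z, (mem_roots_iff H).mpr ⟨hz.ne_zero, hz.root⟩, fun w hw =>
      hz.le w ((mem_roots_iff H).mp hw).1 ((mem_roots_iff H).mp hw).2⟩
  have h1 : IsMinRoot β A x (z1 β A x) := by
    rw [z1, dif_pos h]
    obtain ⟨h2, h3⟩ := h.choose_spec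
    exact ⟨((mem_roots_iff H).mp h2).1, ((mem_roots_iff H).mp h2).2, fun w hw hw0 =>
      h3 w ((mem_roots_iff H).mpr ⟨hw, hw0⟩)⟩
  exact h1.eq_of_notMem_Gamma1 H hx hz

namespace IsRegularSymbol

variable {r : ℕ} [NeZero r] {β : ℕ} {A : ℤ → Matrix (Fin r) (Fin r) ℂ} {U : ℤ → ℂ → ℂ}
  (h : IsRegularSymbol β A U)
include h

theorem periodic (i : ℤ) {x : ℂ} (hx : 0 < x.im) : U (i + r) x = U i x :=
  (h.limitRatio.shift h.hessenberg).eqOn h.limitRatio (exists_norm_toeplitz_le β A) i hx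

theorem notMem_Gamma1 {x : ℂ} (hx : x.im ≠ 0) : x ∉ Gamma1 β A := by
  intro hmem
  obtain ⟨t, rfl⟩ := h.gamma_real hmem
  simp at hx

theorem periodProd_ne_zero {x : ℂ} (hx : 0 < x.im) : periodProd r U x ≠ 0 :=
  Finset.prod_ne_zero_iff.mpr fun p _ => h.limitRatio.ne_zero p hx

theorem differentiableOn_periodProd : DifferentiableOn ℂ (periodProd r U) upperHalf := by
  have : DifferentiableOn ℂ (fun x => ∏ p ∈ Finset.range r, U p x) upperHalf :=
    DifferentiableOn.fun_finsetProd fun p _ => (h.limitRatio.stieltjes p).differentiableOn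
  exact this

theorem f_periodProd {x : ℂ} (hx : 0 < x.im) : f β A (periodProd r U x) x = 0 :=
  f_prod_eq_zero (u := fun i => U i x) β A h.hessenberg (h.limitRatio.solution x hx)
    (fun i => h.limitRatio.ne_zero i hx) fun i => h.periodic i hx

/-- The set where the product is a smallest root is open, because Γ₁ is real, and relatively closed,
because minimality survives limits; the half plane is connected. -/
theorem isMinRoot_periodProd {x : ℂ} (hx : 0 < x.im) : IsMinRoot β A x (periodProd r U x) := by
  set ζ := periodProd r U
  have hζc : ∀ y, 0 < y.im → ContinuousAt ζ y := fun y hy =>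
    (h.differentiableOn_periodProd.differentiableAt (isOpen_upperHalf.mem_nhds hy)).continuousAt
  set E : Set ℂ := {x | 0 < x.im ∧ IsMinRoot β A x (ζ x)} with hE
  have hopen : IsOpen E := by
    rw [isOpen_iff_mem_nhds]
    intro y hy
    have h1 := isOpen_upperHalf.mem_nhds hy.1
    filter_upwards [h1, eventually_isMinRoot h.hessenberg (hζc y hy.1)
      (by filter_upwards [h1] with x hx using ⟨h.periodProd_ne_zero hx, h.f_periodProd hx⟩)
      hy.2 (h.notMem_Gamma1 hy.1.ne')] with x hx1 hx2 using ⟨hx1, hx2⟩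
  have hclosed : closure E ∩ upperHalf ⊆ E := by
    rintro y ⟨hy, hy0⟩
    have := mem_closure_iff_nhdsWithin_neBot.mp hy
    refine ⟨hy0, isMinRoot_of_tendsto h.hessenberg (l := 𝓝[E] y) (X := id)
      (tendsto_id'.mpr nhdsWithin_le_nhds) ((hζc y hy0).mono_left nhdsWithin_le_nhds) ?_⟩
    filter_upwards [self_mem_nhdsWithin] with x hx using hx.2
  -- High on the imaginary axis all |U_p| ≤ 1, so the product is a root in the unit disk, and there
  -- is no other one there.
  have hne : (upperHalf ∩ E).Nonempty := by
    obtain ⟨T, hT⟩ := exists_root_unique β A h.hessenberg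
    set y : ℂ := ((max T 1 : ℝ) : ℂ) * Complex.I with hy
    have hyim : y.im = max T 1 := by simp [hy]
    have hy1 : 1 ≤ y.im := hyim ▸ le_max_right _ _
    have hy0 : 0 < y.im := by linarith
    have hTy : T ≤ ‖y‖ := ((le_max_left _ _).trans hyim.ge).trans
      ((le_abs_self _).trans (Complex.abs_im_le_norm y))
    have hn : ‖ζ y‖ ≤ 1 := by
      simp only [ζ, periodProd]
      rw [norm_prod]
      refine Finset.prod_le_one (fun _ _ => norm_nonneg _) fun p _ => ?_
      exact ((h.limitRatio.stieltjes p).norm_le hy0).trans (inv_le_one_of_one_le₀ hy1)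
    refine ⟨y, hy0, hy0, h.periodProd_ne_zero hy0, h.f_periodProd hy0, fun w hw hw0 => ?_⟩
    by_contra hlt
    rw [not_le] at hlt
    rw [hT y hTy w (ζ y) hw (h.periodProd_ne_zero hy0) (hlt.le.trans hn) hn hw0
      (h.f_periodProd hy0)] at hlt
    exact lt_irrefl _ hlt
  exact (isPreconnected_upperHalf.subset_of_closure_inter_subset hopen hne hclosed hx).2

theorem z1_eq_periodProd {x : ℂ} (hx : 0 < x.im) : z1 β A x = periodProd r U x :=
  (h.isMinRoot_periodProd hx).z1_eq h.hessenberg (h.notMem_Gamma1 hx.ne')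

theorem z1_conj {x : ℂ} (hx : x.im ≠ 0) :
    z1 β A ((starRingEnd ℂ) x) = (starRingEnd ℂ) (z1 β A x) := by
  have key : ∀ y : ℂ, 0 < y.im →
      z1 β A ((starRingEnd ℂ) y) = (starRingEnd ℂ) (z1 β A y) := by
    intro y hy
    rw [h.z1_eq_periodProd hy]
    refine ((h.isMinRoot_periodProd hy).conj h.conj_eq).z1_eq h.hessenberg (h.notMem_Gamma1 ?_)
    simpa using hy.ne'
  rcases lt_or_gt_of_ne hx with hx | hx
  · have := key ((starRingEnd ℂ) x) (by simpa using hx)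
    rw [Complex.conj_conj] at this
    rw [this, Complex.conj_conj]
  · exact key x hx

/-- Limit points at t are smallest roots of f(·, t), hence finitely many. The existence of a root at
t keeps the smallest roots bounded nearby. -/
theorem exists_boundary_limit (t : ℝ) :
    ∃ Z, IsMinRoot β A t Z ∧ Tendsto (periodProd r U) (𝓝[upperHalf] (t : ℂ)) (𝓝 Z) := by
  obtain ⟨B, hB⟩ := eventually_isMinRoot_norm_le h.hessenberg (h.exists_root t)
  have hmin : ∀ᶠ x in 𝓝[upperHalf] (t : ℂ), IsMinRoot β A x (periodProd r U x) := by
    filter_upwards [self_mem_nhdsWithin] with x hx using h.isMinRoot_periodProd hx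
  obtain ⟨Z, hZ, hlim⟩ := exists_tendsto_of_finite (t := t) (S := {z | IsMinRoot β A t z})
    h.differentiableOn_periodProd.continuousOn
    ((roots β A t).toFinset.finite_toSet.subset fun z hz => by
      simpa using (mem_roots_iff h.hessenberg).mpr ⟨hz.ne_zero, hz.root⟩) (B := B) (by
      filter_upwards [mem_nhdsWithin_of_mem_nhds hB, hmin] with x hx hx2 using hx _ hx2)
    (fun 𝒰 w h𝒰 hw => isMinRoot_of_tendsto h.hessenberg (l := (𝒰 : Filter ℂ)) (X := id)
      (tendsto_id'.mpr (h𝒰.trans nhdsWithin_le_nhds)) hw (h𝒰 hmin))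
  exact ⟨Z, hZ, hlim⟩

end IsRegularSymbol

/-! ### Algebraic functions: separable relations and derivatives. -/

theorem bivEval_mul (a b : ℂ[X][X]) (p : ℂ × ℂ) :
    bivEval (a * b) p = bivEval a p * bivEval b p := evalEval_mul _ _ _ _

theorem bivEval_add (a b : ℂ[X][X]) (p : ℂ × ℂ) :
    bivEval (a + b) p = bivEval a p + bivEval b p := evalEval_add _ _ _ _

theorem bivEval_C (c : ℂ[X]) (z x : ℂ) : bivEval (C c) (z, x) = c.eval x := evalEval_C _ _ _

theorem differentiableOn_bivEval_comp (e : ℂ[X][X]) {g : ℂ → ℂ} {s : Set ℂ}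
    (hg : DifferentiableOn ℂ g s) : DifferentiableOn ℂ (fun x => bivEval e (g x, x)) s :=
  ((contDiff_bivEval (n := 1) e).differentiable one_ne_zero).comp_differentiableOn
    (hg.prodMk differentiableOn_id)

theorem eq_zero_of_eval_upperHalf {c : ℂ[X]} (h : ∀ x : ℂ, 0 < x.im → c.eval x = 0) : c = 0 := by
  refine Polynomial.eq_zero_of_infinite_isRoot c (Set.Infinite.mono (fun x hx => h x hx)
    (infinite_of_mem_nhds Complex.I (isOpen_upperHalf.mem_nhds ?_)))
  simp [upperHalf]

/-- Analytic functions on a connected open set have no zero divisors, so one prime factor of F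
already vanishes along g. -/
theorem exists_irreducible_dvd {g : ℂ → ℂ} (hg : DifferentiableOn ℂ g upperHalf) (F : ℂ[X][X])
    (hF : F ≠ 0) (h : ∀ x : ℂ, 0 < x.im → bivEval F (g x, x) = 0) :
    ∃ e : ℂ[X][X], Irreducible e ∧ e ∣ F ∧ ∀ x : ℂ, 0 < x.im → bivEval e (g x, x) = 0 := by
  induction F using UniqueFactorizationMonoid.induction_on_prime with
  | h₁ => exact absurd rfl hF
  | h₂ u hu =>
    obtain ⟨v, hv⟩ := hu.exists_right_inv
    have h1 := congrArg (fun q => bivEval q (g Complex.I, Complex.I)) hv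
    simp only [bivEval_mul] at h1
    rw [h Complex.I (by simp), zero_mul] at h1
    simp [bivEval, evalEval_one] at h1
  | h₃ a p ha hp ih =>
    have hmul : ∀ x ∈ upperHalf, (fun x => bivEval p (g x, x)) x * (fun x => bivEval a (g x, x)) x = 0 :=
      fun x hx => by rw [← bivEval_mul]; exact h x hx
    rcases AnalyticOnNhd.eq_zero_or_eq_zero_of_mul_eq_zero
      ((differentiableOn_bivEval_comp p hg).analyticOnNhd isOpen_upperHalf)
      ((differentiableOn_bivEval_comp a hg).analyticOnNhd isOpen_upperHalf) hmul
      isPreconnected_upperHalf with h1 | h1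
    · exact ⟨p, hp.irreducible, dvd_mul_right _ _, h1⟩
    · obtain ⟨e, he, hea, h2⟩ := ih ha h1
      exact ⟨e, he, hea.mul_left _, h2⟩

/-- By Gauss's lemma e stays irreducible over ℂ(x), where characteristic zero makes it separable; c
arises from clearing denominators in the Bézout identity. -/
theorem exists_bezout_derivative {e : ℂ[X][X]} (he : Irreducible e) (hd : e.natDegree ≠ 0) :
    ∃ (a b : ℂ[X][X]) (c : ℂ[X]), c ≠ 0 ∧ a * e + b * derivative e = C c := by
  classical
  let K := FractionRing ℂ[X]
  let _ : NormalizedGCDMonoid ℂ[X] := Classical.choice inferInstance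
  have h1 : Irreducible (e.map (algebraMap ℂ[X] K)) :=
    (he.isPrimitive hd).irreducible_iff_irreducible_map_fraction_map.mp he
  obtain ⟨a, b, hab⟩ := h1.separable
  obtain ⟨d₁, hd₁, ha⟩ := IsLocalization.integerNormalization_spec (nonZeroDivisors ℂ[X]) a
  obtain ⟨d₂, hd₂, hb⟩ := IsLocalization.integerNormalization_spec (nonZeroDivisors ℂ[X]) b
  set a' := IsLocalization.integerNormalization (nonZeroDivisors ℂ[X]) a
  set b' := IsLocalization.integerNormalization (nonZeroDivisors ℂ[X]) b
  refine ⟨C d₂ * a', C d₁ * b', d₁ * d₂,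
    mul_ne_zero (nonZeroDivisors.ne_zero hd₁) (nonZeroDivisors.ne_zero hd₂), ?_⟩
  refine Polynomial.map_injective (algebraMap ℂ[X] K) (IsFractionRing.injective ℂ[X] K) ?_
  simp only [Polynomial.map_add, Polynomial.map_mul, map_C, ha, hb, map_mul]
  rw [derivative_map] at hab
  have hs : ∀ (d : ℂ[X]) (q : K[X]), d • q = C (algebraMap ℂ[X] K d) * q := fun d q => by
    rw [← smul_eq_C_mul, algebraMap_smul]
  rw [hs, hs]
  linear_combination (C (algebraMap ℂ[X] K d₁) * C (algebraMap ℂ[X] K d₂)) * hab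

/-- A polynomial relation satisfied by `g`, with a derivative that vanishes along `g` only above the
zeros of a nonzero polynomial `c`. -/
theorem exists_separable_relation {g : ℂ → ℂ} (hg : DifferentiableOn ℂ g upperHalf)
    (F : ℂ[X][X]) (hF : F ≠ 0) (h : ∀ x : ℂ, 0 < x.im → bivEval F (g x, x) = 0) :
    ∃ (e : ℂ[X][X]) (c : ℂ[X]), c ≠ 0 ∧ e ∣ F ∧ (∀ x : ℂ, 0 < x.im → bivEval e (g x, x) = 0) ∧
      ∀ z x : ℂ, bivEval e (z, x) = 0 → c.eval x ≠ 0 → bivEval (derivative e) (z, x) ≠ 0 := by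
  obtain ⟨e, he, heF, hvan⟩ := exists_irreducible_dvd hg F hF h
  -- A factor free of z would be a polynomial in x vanishing on the whole half plane.
  have hd : e.natDegree ≠ 0 := by
    intro h0
    obtain ⟨c, hc⟩ : ∃ c, e = C c := ⟨_, eq_C_of_natDegree_eq_zero h0⟩
    have : c = 0 := eq_zero_of_eval_upperHalf fun x hx => by
      have := hvan x hx
      rwa [hc, bivEval_C] at this
    rw [this, C_0] at hc
    exact he.ne_zero hc
  obtain ⟨a, b, c, hc, hab⟩ := exists_bezout_derivative he hd
  refine ⟨e, c, hc, heF, hvan, fun z x hz hcx h0 => hcx ?_⟩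
  rw [← bivEval_C c z x, ← hab, bivEval_add, bivEval_mul, bivEval_mul, hz, h0]
  ring

/-- The partial derivative of `bivEval e` with respect to the second variable. -/
def bivDeriv (e : ℂ[X][X]) (p : ℂ × ℂ) : ℂ := fderiv ℂ (bivEval e) p (0, 1)

theorem continuous_bivDeriv (e : ℂ[X][X]) : Continuous (bivDeriv e) :=
  (continuous_fderiv_bivEval e).clm_apply continuous_const

theorem bivDeriv_add_eq_zero {e : ℂ[X][X]} {g : ℂ → ℂ} {d x : ℂ} (hg : HasDerivAt g d x)
    (h : ∀ᶠ y in 𝓝 x, bivEval e (g y, y) = 0) :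
    d * bivEval (derivative e) (g x, x) + bivDeriv e (g x, x) = 0 := by
  have h1 := HasFDerivAt.comp_hasDerivAt (f := fun y => (g y, y)) x
    (hasStrictFDerivAt_bivEval e (g x, x)).hasFDerivAt (hg.prodMk (hasDerivAt_id' x))
  have h2 : HasDerivAt (bivEval e ∘ fun y => (g y, y)) 0 x :=
    (hasDerivAt_const x (0 : ℂ)).congr_of_eventuallyEq h
  have h3 := h1.unique h2
  rw [fderiv_bivEval_apply, one_mul] at h3
  exact h3

/-- Provides the analytic continuation of a branch across a real boundary point, together with the
fact that it captures every nearby solution. -/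
theorem exists_implicit {e : ℂ[X][X]} {z x : ℂ} (h0 : bivEval e (z, x) = 0)
    (hz : bivEval (derivative e) (z, x) ≠ 0) :
    ∃ ψ : ℂ → ℂ, ψ x = z ∧
      HasDerivAt ψ (-bivDeriv e (z, x) / bivEval (derivative e) (z, x)) x ∧
      (∀ᶠ y in 𝓝 x, bivEval e (ψ y, y) = 0) ∧
      ∀ᶠ p : ℂ × ℂ in 𝓝 (x, z), bivEval e (p.2, p.1) = 0 → ψ p.1 = p.2 := by
  set G : ℂ × ℂ → ℂ := fun p => bivEval e p.swap with hG
  have hGd : ContDiff ℂ 1 G := (contDiff_bivEval e).comp (contDiff_snd.prodMk contDiff_fst)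
  have hs := hGd.contDiffAt.hasStrictFDerivAt (x := (x, z)) one_ne_zero
  have hval : fderiv ℂ G (x, z) (0, 1) = bivEval (derivative e) (z, x) := by
    have h1 : HasDerivAt (fun w : ℂ => (x, w)) ((0, 1) : ℂ × ℂ) z :=
      (hasDerivAt_const z x).prodMk (hasDerivAt_id z)
    have h2 := hs.hasFDerivAt.comp_hasDerivAt z h1
    have h3 : HasDerivAt (fun w : ℂ => (w, x)) ((1, 0) : ℂ × ℂ) z :=
      (hasDerivAt_id z).prodMk (hasDerivAt_const z x)
    have h4 := (hasStrictFDerivAt_bivEval e (z, x)).hasFDerivAt.comp_hasDerivAt z h3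
    rw [← fderiv_bivEval_fst]
    exact h2.unique h4
  have hinv : (fderiv ℂ G (x, z) ∘L .inr ℂ ℂ ℂ).IsInvertible := by
    refine ⟨ContinuousLinearEquiv.unitsEquivAut ℂ (Units.mk0 _ hz), ?_⟩
    ext
    simp [hval]
  have hψ := hs.tendsto_implicitFunctionOfProdDomain hinv
  have hd := hs.hasStrictFDerivAt_implicitFunctionOfProdDomain hinv
  have hev := hs.eventually_apply_implicitFunctionOfProdDomain hinv
  have hiff := hs.eventually_apply_eq_iff_implicitFunctionOfProdDomain hinv
  set ψ := hs.implicitFunctionOfProdDomain hinv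
  have hψx : ψ x = z := tendsto_nhds_unique hd.continuousAt hψ
  have hGz : G (x, z) = 0 := h0
  have hroot : ∀ᶠ y in 𝓝 x, bivEval e (ψ y, y) = 0 := by
    filter_upwards [hev] with y hy
    rw [hGz] at hy
    exact hy
  have hder := hd.hasFDerivAt.hasDerivAt
  have h5 := bivDeriv_add_eq_zero hder hroot
  rw [hψx] at h5
  refine ⟨ψ, hψx, ?_, hroot, ?_⟩
  · refine hder.congr_deriv ?_
    rw [eq_div_iff hz]
    linear_combination h5
  · filter_upwards [hiff] with p hp hp0
    rw [hGz] at hp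
    exact hp.mp hp0

/-- Implicit differentiation writes g' as a continuous function of (g x, x) near (Z, t). -/
theorem tendsto_deriv_of_relation {e : ℂ[X][X]} {Ω : Set ℂ} (hΩ : IsOpen Ω) {g : ℂ → ℂ}
    (hg : DifferentiableOn ℂ g Ω) (h : ∀ x ∈ Ω, bivEval e (g x, x) = 0) {t Z : ℂ}
    (hZ : Tendsto g (𝓝[Ω] t) (𝓝 Z)) (hne : bivEval (derivative e) (Z, t) ≠ 0) :
    Tendsto (deriv g) (𝓝[Ω] t) (𝓝 (-bivDeriv e (Z, t) / bivEval (derivative e) (Z, t))) := by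
  have hpair : Tendsto (fun x => (g x, x)) (𝓝[Ω] t) (𝓝 (Z, t)) :=
    hZ.prodMk_nhds (tendsto_id'.mpr nhdsWithin_le_nhds)
  have h1 := ((continuous_bivEval (derivative e)).tendsto (Z, t)).comp hpair
  have h2 := ((continuous_bivDeriv e).tendsto (Z, t)).comp hpair
  refine (h2.neg.div h1 hne).congr' ?_
  filter_upwards [self_mem_nhdsWithin, h1.eventually_ne hne] with x hx hx2
  have h3 := bivDeriv_add_eq_zero (hg.differentiableAt (hΩ.mem_nhds hx)).hasDerivAt
    (by filter_upwards [hΩ.mem_nhds hx] with y hy using h y hy)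
  change -bivDeriv e (g x, x) / bivEval (derivative e) (g x, x) = deriv g x
  rw [div_eq_iff (show bivEval (derivative e) (g x, x) ≠ 0 from hx2)]
  linear_combination -h3

/-- If the modulus of `ψ` at `t + iy` is at most that at `t - iy`, the logarithmic derivative at `t`
has nonnegative imaginary part. -/
theorem im_div_nonneg_of_norm_le {ψ : ℂ → ℂ} {t : ℝ} {d : ℂ} (hψ : HasDerivAt ψ d t)
    (h : ∀ᶠ y : ℝ in 𝓝[>] 0, ‖ψ (t + y * Complex.I)‖ ≤ ‖ψ (t - y * Complex.I)‖) :
    0 ≤ (d / ψ t).im := by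
  have h1 : HasDerivAt (fun y : ℝ => ψ (t + y * Complex.I)) (d * Complex.I) 0 := by
    have h2 : HasDerivAt (fun y : ℝ => (t : ℂ) + y * Complex.I) Complex.I 0 := by
      simpa using ((Complex.ofRealCLM.hasDerivAt (x := (0 : ℝ))).mul_const Complex.I).const_add (t : ℂ)
    have h3 : HasDerivAt ψ d ((t : ℂ) + ((0 : ℝ) : ℂ) * Complex.I) := by simpa using hψ
    exact h3.comp (0 : ℝ) h2
  have h2 : HasDerivAt (fun y : ℝ => ψ (t - y * Complex.I)) (-(d * Complex.I)) 0 := by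
    have h2 : HasDerivAt (fun y : ℝ => (t : ℂ) - y * Complex.I) (-Complex.I) 0 := by
      simpa using ((Complex.ofRealCLM.hasDerivAt (x := (0 : ℝ))).mul_const Complex.I).const_sub (t : ℂ)
    have h3 : HasDerivAt ψ d ((t : ℂ) - ((0 : ℝ) : ℂ) * Complex.I) := by simpa using hψ
    have h4 := h3.comp (0 : ℝ) h2
    rw [mul_neg] at h4
    exact h4
  -- The function |ψ(t+iy)|² - |ψ(t-iy)|² vanishes at y = 0 and is nonpositive for small y > 0; its
  -- derivative at 0 is -4 Im(conj ψ(t) · d).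
  have h3 := h1.norm_sq.sub h2.norm_sq
  simp only [Complex.ofReal_zero, zero_mul, add_zero, sub_zero] at h3
  have h4 : 2 * inner ℝ (ψ t) (d * Complex.I) - 2 * inner ℝ (ψ t) (-(d * Complex.I)) ≤ 0 := by
    have h5 := (hasDerivWithinAt_iff_tendsto_slope' (s := Set.Ioi (0 : ℝ)) (by simp)).mp
      h3.hasDerivWithinAt
    refine le_of_tendsto h5 ?_
    filter_upwards [h, self_mem_nhdsWithin] with y hy hy0
    have hy0' : (0 : ℝ) < y := hy0
    rw [slope_def_field]
    simp only [Pi.sub_apply, Complex.ofReal_zero, zero_mul, add_zero, sub_zero, sub_self]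
    refine div_nonpos_of_nonpos_of_nonneg ?_ hy0'.le
    have := pow_le_pow_left₀ (norm_nonneg _) hy 2
    linarith
  rw [inner_neg_right, Complex.inner] at h4
  have h6 : ((starRingEnd ℂ) (ψ t) * (d * Complex.I)).re = -((starRingEnd ℂ) (ψ t) * d).im := by
    rw [← mul_assoc, Complex.mul_I_re]
  have h7 : 0 ≤ ((starRingEnd ℂ) (ψ t) * d).im := by
    have : (d * Complex.I * (starRingEnd ℂ) (ψ t)).re
      = ((starRingEnd ℂ) (ψ t) * (d * Complex.I)).re := by rw [mul_comm]
    linarith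
  rw [Complex.div_im]
  have h8 : ((starRingEnd ℂ) (ψ t) * d).im = (ψ t).re * d.im - (ψ t).im * d.re := by
    simp; ring
  rw [h8] at h7
  rw [← sub_div]
  exact div_nonneg (by linarith) (Complex.normSq_nonneg _)

/-! ### Boundary values and the density of μ₁. -/

/-- The open lower half plane. -/
def lowerHalf : Set ℂ := {w : ℂ | w.im < 0}

theorem isOpen_lowerHalf : IsOpen lowerHalf := isOpen_lt Complex.continuous_im continuous_const

theorem tendsto_conj_lowerHalf (t : ℝ) :
    Tendsto (starRingEnd ℂ) (𝓝[lowerHalf] (t : ℂ)) (𝓝[upperHalf] (t : ℂ)) := by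
  refine tendsto_nhdsWithin_iff.mpr ⟨?_, ?_⟩
  · have := (Complex.continuous_conj.tendsto (t : ℂ))
    rw [Complex.conj_ofReal] at this
    exact this.mono_left nhdsWithin_le_nhds
  · filter_upwards [self_mem_nhdsWithin] with x hx
    have : x.im < 0 := hx
    simpa [upperHalf] using this

theorem neBot_nhdsWithin_lowerHalf (t : ℝ) : (𝓝[lowerHalf] (t : ℂ)).NeBot := by
  refine mem_closure_iff_nhdsWithin_neBot.mp ?_
  have : closure lowerHalf = {z : ℂ | z.im ≤ 0} := Complex.closure_setOfPred_im_lt 0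
  rw [this]; simp

/-- The boundary values from the upper half plane of the smallest root and of its derivative. -/
structure HasBoundaryValues (g : ℂ → ℂ) (t : ℝ) (Z d : ℂ) : Prop where
  tendsto : Tendsto g (𝓝[upperHalf] (t : ℂ)) (𝓝 Z)
  tendsto_deriv : Tendsto (deriv g) (𝓝[upperHalf] (t : ℂ)) (𝓝 d)

namespace IsRegularSymbol

variable {r : ℕ} [NeZero r] {β : ℕ} {A : ℤ → Matrix (Fin r) (Fin r) ℂ} {U : ℤ → ℂ → ℂ}

theorem z1_eqOn_upper (h : IsRegularSymbol β A U) :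
    Set.EqOn (z1 β A) (periodProd r U) upperHalf := fun _ hx => h.z1_eq_periodProd hx

theorem z1_eqOn_lower (h : IsRegularSymbol β A U) :
    Set.EqOn (z1 β A) ((starRingEnd ℂ) ∘ periodProd r U ∘ (starRingEnd ℂ)) lowerHalf := by
  intro x hx
  have hx0 : x.im < 0 := hx
  have hx1 : 0 < ((starRingEnd ℂ) x).im := by simpa using hx0
  simp only [Function.comp]
  rw [← h.z1_eq_periodProd hx1, h.z1_conj hx0.ne, Complex.conj_conj]

theorem deriv_z1_upper (h : IsRegularSymbol β A U) {x : ℂ} (hx : x ∈ upperHalf) :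
    deriv (z1 β A) x = deriv (periodProd r U) x :=
  (h.z1_eqOn_upper.eventuallyEq_of_mem (isOpen_upperHalf.mem_nhds hx)).deriv_eq

theorem deriv_z1_lower (h : IsRegularSymbol β A U) {x : ℂ} (hx : x ∈ lowerHalf) :
    deriv (z1 β A) x = (starRingEnd ℂ) (deriv (periodProd r U) ((starRingEnd ℂ) x)) := by
  rw [(h.z1_eqOn_lower.eventuallyEq_of_mem (isOpen_lowerHalf.mem_nhds hx)).deriv_eq,
    deriv_conj_conj]
  rfl

theorem density_eq (h : IsRegularSymbol β A U) {t : ℝ} {Z d : ℂ}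
    (hb : HasBoundaryValues (periodProd r U) t Z d) :
    density β A t = ((1 / (Real.pi * r) * (d / Z).im : ℝ) : ℂ) := by
  have hU : (𝓝[{w : ℂ | 0 < w.im}] (t : ℂ)).NeBot := neBot_nhdsWithin_upperHalf t
  have hL : (𝓝[{w : ℂ | w.im < 0}] (t : ℂ)).NeBot := neBot_nhdsWithin_lowerHalf t
  have h1 : upperValue (z1 β A) t = Z := by
    refine Tendsto.limUnder_eq (hb.tendsto.congr' ?_)
    filter_upwards [self_mem_nhdsWithin] with x hx using (h.z1_eqOn_upper hx).symm
  have h2 : upperValue (deriv (z1 β A)) t = d := by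
    refine Tendsto.limUnder_eq (hb.tendsto_deriv.congr' ?_)
    filter_upwards [self_mem_nhdsWithin] with x hx using (h.deriv_z1_upper hx).symm
  have h3 : lowerValue (z1 β A) t = (starRingEnd ℂ) Z := by
    refine Tendsto.limUnder_eq (((Complex.continuous_conj.tendsto _).comp
      (hb.tendsto.comp (tendsto_conj_lowerHalf t))).congr' ?_)
    filter_upwards [self_mem_nhdsWithin] with x hx using (h.z1_eqOn_lower hx).symm
  have h4 : lowerValue (deriv (z1 β A)) t = (starRingEnd ℂ) d := by
    refine Tendsto.limUnder_eq (((Complex.continuous_conj.tendsto _).comp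
      (hb.tendsto_deriv.comp (tendsto_conj_lowerHalf t))).congr' ?_)
    filter_upwards [self_mem_nhdsWithin] with x hx using (h.deriv_z1_lower hx).symm
  rw [density, h1, h2, h3, h4, ← map_div₀, Complex.sub_conj]
  have hr : (r : ℂ) ≠ 0 := by exact_mod_cast NeZero.ne r
  have hpi : (Real.pi : ℂ) ≠ 0 := by exact_mod_cast Real.pi_ne_zero
  push_cast
  field_simp [Complex.I_ne_zero]

/-- At all but finitely many real points the boundary values exist, the density is nonnegative, and
it vanishes off `Γ₁`. -/
theorem exists_finite_boundary (h : IsRegularSymbol β A U) :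
    ∃ S : Set ℝ, S.Finite ∧ ∀ t ∉ S, ∃ Z d, HasBoundaryValues (periodProd r U) t Z d ∧ Z ≠ 0 ∧
      0 ≤ (d / Z).im ∧ ((t : ℂ) ∉ Gamma1 β A → (d / Z).im = 0) := by
  set ζ := periodProd r U with hζ
  have hζd := h.differentiableOn_periodProd
  have hF0 : bivPoly β A ≠ 0 := by
    intro h0
    have h1 := bivPoly_map β A 0
    rw [h0, Polynomial.map_zero] at h1
    exact rootPoly_ne_zero h.hessenberg 0 h1.symm
  have hFζ : ∀ x : ℂ, 0 < x.im → bivEval (bivPoly β A) (ζ x, x) = 0 := fun x hx =>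
    (bivEval_bivPoly_eq_zero_iff β A (h.periodProd_ne_zero hx) x).mpr (h.f_periodProd hx)
  obtain ⟨e, c, hc, heF, he, hsep⟩ := exists_separable_relation hζd _ hF0 hFζ
  -- Outside the real zeros of c the relation e can be solved for z at the boundary value.
  refine ⟨{t : ℝ | c.eval (t : ℂ) = 0}, ?_, fun t ht => ?_⟩
  · change (((↑) : ℝ → ℂ) ⁻¹' {z | c.eval z = 0}).Finite
    refine Set.Finite.preimage (f := ((↑) : ℝ → ℂ)) Complex.ofReal_injective.injOn
      (c.roots.toFinset.finite_toSet.subset fun z hz => ?_)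
    simpa [hc] using hz
  obtain ⟨Z, hZmin, hZ⟩ := h.exists_boundary_limit t
  have heZ : bivEval e (Z, t) = 0 := by
    have h1 := ((continuous_bivEval e).tendsto (Z, t)).comp
      (hZ.prodMk_nhds (tendsto_id'.mpr nhdsWithin_le_nhds))
    refine tendsto_nhds_unique h1 (tendsto_const_nhds.congr' ?_)
    filter_upwards [self_mem_nhdsWithin] with x hx using (he x hx).symm
  have hne := hsep Z t heZ ht
  have hd := tendsto_deriv_of_relation isOpen_upperHalf hζd he hZ hne
  set d := -bivDeriv e (Z, t) / bivEval (derivative e) (Z, t) with hddef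
  refine ⟨Z, d, ⟨hZ, hd⟩, hZmin.ne_zero, ?_, fun hΓ => ?_⟩
  -- The continuation ψ equals ζ at t+iy. At t-iy it is some root, no smaller than the smallest root
  -- there, which is the conjugate of ζ(t+iy).
  · obtain ⟨ψ, hψt, hψd, hψe, hψu⟩ := exists_implicit heZ hne
    rw [← hψt]
    refine im_div_nonneg_of_norm_le hψd ?_
    have hup : Tendsto (fun y : ℝ => (t : ℂ) + y * Complex.I) (𝓝[>] 0) (𝓝[upperHalf] (t : ℂ)) := by
      refine tendsto_nhdsWithin_iff.mpr ⟨?_, ?_⟩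
      · have : Continuous fun y : ℝ => (t : ℂ) + y * Complex.I := by fun_prop
        have h1 := this.tendsto 0
        simp only [Complex.ofReal_zero, zero_mul, add_zero] at h1
        exact h1.mono_left nhdsWithin_le_nhds
      · filter_upwards [self_mem_nhdsWithin] with y hy
        simpa [upperHalf] using hy
    have hlow : Tendsto (fun y : ℝ => (t : ℂ) - y * Complex.I) (𝓝[>] 0) (𝓝 (t : ℂ)) := by
      have : Continuous fun y : ℝ => (t : ℂ) - y * Complex.I := by fun_prop
      have h1 := this.tendsto 0
      simp only [Complex.ofReal_zero, zero_mul, sub_zero] at h1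
      exact h1.mono_left nhdsWithin_le_nhds
    have hpair : Tendsto (fun x => (x, ζ x)) (𝓝[upperHalf] (t : ℂ)) (𝓝 ((t : ℂ), Z)) :=
      Tendsto.prodMk_nhds (tendsto_id'.mpr nhdsWithin_le_nhds) hZ
    have hψ0 : ∀ᶠ x in 𝓝 (t : ℂ), ψ x ≠ 0 := by
      refine hψd.continuousAt.eventually_ne ?_
      rw [hψt]; exact hZmin.ne_zero
    filter_upwards [hup (hpair.eventually hψu), hlow.eventually hψe, hlow.eventually hψ0,
      self_mem_nhdsWithin] with y h1 h2 h3 hy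
    have hy0 : (0 : ℝ) < y := hy
    have him : 0 < ((t : ℂ) + y * Complex.I).im := by simpa using hy0
    have h4 : ψ ((t : ℂ) + y * Complex.I) = ζ ((t : ℂ) + y * Complex.I) := h1 (he _ him)
    rw [h4]
    have h5 := (h.isMinRoot_periodProd him).conj h.conj_eq
    have h6 : (starRingEnd ℂ) ((t : ℂ) + y * Complex.I) = (t : ℂ) - y * Complex.I := by
      simp [sub_eq_add_neg]
    rw [h6] at h5
    obtain ⟨q, hq⟩ := heF
    have h7 := h5.le _ h3 ((bivEval_bivPoly_eq_zero_iff β A h3 _).mp (by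
      rw [hq, bivEval_mul, h2, zero_mul]))
    simpa using h7
  -- Off Γ₁ the smallest root at t is unique, hence real, and simple. Implicit differentiation then
  -- gives the same derivative from both half planes, so d is real as well.
  · have hconj : (starRingEnd ℂ) Z = Z := by
      have h1 := hZmin.conj h.conj_eq
      rw [Complex.conj_ofReal] at h1
      exact h1.eq_of_notMem_Gamma1 h.hessenberg hΓ hZmin
    have hne' := hZmin.derivative_ne_zero h.hessenberg hΓ
    have hd1 := tendsto_deriv_of_relation isOpen_upperHalf hζd hFζ hZ hne'
    have e1 := tendsto_nhds_unique hd hd1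
    have := neBot_nhdsWithin_lowerHalf t
    set g : ℂ → ℂ := (starRingEnd ℂ) ∘ ζ ∘ (starRingEnd ℂ) with hg
    have hgd : DifferentiableOn ℂ g lowerHalf := by
      intro x hx
      have hx' : 0 < ((starRingEnd ℂ) x).im := by
        have : x.im < 0 := hx
        simpa using this
      have h2 := (hζd.differentiableAt (isOpen_upperHalf.mem_nhds hx')).conj_conj
      rw [Complex.conj_conj] at h2
      exact h2.differentiableWithinAt
    have hgF : ∀ x ∈ lowerHalf, bivEval (bivPoly β A) (g x, x) = 0 := by
      intro x hx
      have hx' : 0 < ((starRingEnd ℂ) x).im := by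
        have : x.im < 0 := hx
        simpa using this
      have h2 := (h.isMinRoot_periodProd hx').conj h.conj_eq
      rw [Complex.conj_conj] at h2
      exact (bivEval_bivPoly_eq_zero_iff β A h2.ne_zero x).mpr h2.root
    have hgZ : Tendsto g (𝓝[lowerHalf] (t : ℂ)) (𝓝 Z) := by
      have h2 := (Complex.continuous_conj.tendsto Z).comp (hZ.comp (tendsto_conj_lowerHalf t))
      rwa [hconj] at h2
    have hd2 := tendsto_deriv_of_relation isOpen_lowerHalf hgd hgF hgZ hne'
    have hd3 : Tendsto (deriv g) (𝓝[lowerHalf] (t : ℂ)) (𝓝 ((starRingEnd ℂ) d)) := by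
      refine ((Complex.continuous_conj.tendsto d).comp
        (hd.comp (tendsto_conj_lowerHalf t))).congr fun x => ?_
      rw [hg, deriv_conj_conj]
    have e2 : (starRingEnd ℂ) d = d := (tendsto_nhds_unique hd3 hd2).trans e1.symm
    rw [← Complex.conj_eq_iff_im, map_div₀, hconj, e2]

end IsRegularSymbol

/-! ### A logarithm of z₁ and its boundary phase. -/

theorem finite_setOf_exp_eq (w : ℂ) (B : ℝ) : {l : ℂ | Complex.exp l = w ∧ |l.im| ≤ B}.Finite := by
  rcases Set.eq_empty_or_nonempty {l : ℂ | Complex.exp l = w ∧ |l.im| ≤ B} with h | ⟨l₀, h₀, hB₀⟩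
  · rw [h]; exact Set.finite_empty
  refine ((Set.finite_Icc (-⌈B⌉) ⌈B⌉).image
    fun n : ℤ => l₀ + n * (2 * Real.pi * Complex.I)).subset fun l hl => ?_
  obtain ⟨n, hn⟩ := Complex.exp_eq_exp_iff_exists_int.mp (hl.1.trans h₀.symm)
  refine ⟨n, ?_, hn.symm⟩
  have h1 : l.im = l₀.im + n * (2 * Real.pi) := by rw [hn]; simp
  have h2 := abs_le.mp hl.2
  have h3 := abs_le.mp hB₀
  have h4 := Real.pi_gt_three
  have h5 := Int.le_ceil B
  have hB : 0 ≤ B := (abs_nonneg _).trans hB₀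
  have h6 : |(n : ℝ)| ≤ B := by
    by_contra hcon
    rw [not_le] at hcon
    have h7 : |(n : ℝ) * (2 * Real.pi)| ≤ 2 * B := abs_le.mpr ⟨by linarith, by linarith⟩
    rw [abs_mul, abs_of_pos (a := 2 * Real.pi) (by positivity)] at h7
    nlinarith
  have h8 := abs_le.mp h6
  rw [Set.mem_Icc]
  constructor
  · have : ((-⌈B⌉ : ℤ) : ℝ) ≤ n := by push_cast; linarith
    exact_mod_cast this
  · have : (n : ℝ) ≤ ((⌈B⌉ : ℤ) : ℝ) := by linarith
    exact_mod_cast this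

/-- A branch of `-log` of the product of the ratios over a period. -/
def logSum (r : ℕ) (U : ℤ → ℂ → ℂ) (x : ℂ) : ℂ := -∑ p ∈ Finset.range r, Complex.log (U p x)

/-- Keeps U_i off the cut of the principal logarithm, with -arg in (0, π). Summing r such logarithms
instead of taking one of the product yields a global branch with imaginary part in [0, πr]. -/
theorem IsLimitRatio.im_neg {m : ℕ} {a : ℤ → ℤ → ℂ} {U : ℤ → ℂ → ℂ} (h : IsLimitRatio m a U)
    (i : ℤ) {z : ℂ} (hz : 0 < z.im) : (U i z).im < 0 := by
  have h1 := (h.stieltjes i).norm_sq_le z hz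
  have h2 : 0 < ‖U i z‖ := norm_pos_iff.mpr (h.ne_zero i hz)
  have : 0 < z.im * ‖U i z‖ ^ 2 := by positivity
  linarith

theorem im_logSum_le (r : ℕ) (U : ℤ → ℂ → ℂ) (x : ℂ) :
    (logSum r U x).im ≤ Real.pi * r := by
  rw [logSum, Complex.neg_im, Complex.im_sum, ← Finset.sum_neg_distrib]
  refine (Finset.sum_le_card_nsmul _ _ Real.pi fun p _ => ?_).trans (by simp [mul_comm])
  rw [Complex.log_im]
  linarith [Complex.neg_pi_lt_arg (U p x)]

/-- The boundary values of the normalised argument of the product of the ratios. -/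
def phase (r : ℕ) (U : ℤ → ℂ → ℂ) (t : ℝ) : ℝ :=
  (extendFrom upperHalf (logSum r U) t).im / (Real.pi * r)

namespace IsRegularSymbol

variable {r : ℕ} [NeZero r] {β : ℕ} {A : ℤ → Matrix (Fin r) (Fin r) ℂ} {U : ℤ → ℂ → ℂ}

theorem im_logSum_nonneg (h : IsRegularSymbol β A U) {x : ℂ} (hx : 0 < x.im) :
    0 ≤ (logSum r U x).im := by
  rw [logSum, Complex.neg_im, Complex.im_sum, neg_nonneg]
  refine Finset.sum_nonpos fun p _ => ?_
  rw [Complex.log_im]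
  exact (Complex.arg_neg_iff.mpr (h.limitRatio.im_neg p hx)).le

theorem exp_logSum (h : IsRegularSymbol β A U) {x : ℂ} (hx : 0 < x.im) :
    Complex.exp (logSum r U x) = (periodProd r U x)⁻¹ := by
  rw [logSum, Complex.exp_neg, Complex.exp_sum, periodProd]
  congr 1
  exact Finset.prod_congr rfl fun p _ => Complex.exp_log (h.limitRatio.ne_zero p hx)

theorem hasDerivAt_logSum (h : IsRegularSymbol β A U) {x : ℂ} (hx : 0 < x.im) :
    HasDerivAt (logSum r U) (-∑ p ∈ Finset.range r, deriv (U p) x / U p x) x := by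
  refine HasDerivAt.fun_neg (HasDerivAt.fun_sum fun p _ => ?_)
  refine HasDerivAt.clog ?_ (Or.inr (h.limitRatio.im_neg p hx).ne)
  exact ((h.limitRatio.stieltjes p).differentiableOn.differentiableAt
    (isOpen_upperHalf.mem_nhds hx)).hasDerivAt

theorem differentiableOn_logSum (h : IsRegularSymbol β A U) :
    DifferentiableOn ℂ (logSum r U) upperHalf :=
  fun _ hx => (h.hasDerivAt_logSum hx).differentiableAt.differentiableWithinAt

theorem deriv_logSum (h : IsRegularSymbol β A U) {x : ℂ} (hx : 0 < x.im) :
    deriv (logSum r U) x = -(deriv (periodProd r U) x / periodProd r U x) := by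
  have h1 : Set.EqOn (fun y => Complex.exp (logSum r U y)) (fun y => (periodProd r U y)⁻¹) upperHalf :=
    fun y hy => h.exp_logSum hy
  have hn := isOpen_upperHalf.mem_nhds hx
  have h2 := (h1.eventuallyEq_of_mem hn).deriv_eq
  have hL := (h.hasDerivAt_logSum hx).differentiableAt
  have hζ := h.differentiableOn_periodProd.differentiableAt hn
  have hζ0 := h.periodProd_ne_zero hx
  rw [(hL.hasDerivAt.cexp).deriv, (hζ.hasDerivAt.fun_inv hζ0).deriv, h.exp_logSum hx] at h2
  field_simp at h2 ⊢
  linear_combination h2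

/-- Limit points l satisfy exp l = Z⁻¹ and |Im l| ≤ πr, which leaves finitely many; the real part is
controlled by |ζ| → |Z| ≠ 0. -/
theorem exists_tendsto_logSum (h : IsRegularSymbol β A U) (t : ℝ) :
    ∃ l, Tendsto (logSum r U) (𝓝[upperHalf] (t : ℂ)) (𝓝 l) := by
  obtain ⟨Z, hZmin, hZ⟩ := h.exists_boundary_limit t
  have hZ0 := hZmin.ne_zero
  have hre : ∀ x : ℂ, 0 < x.im → (logSum r U x).re = -Real.log ‖periodProd r U x‖ := by
    intro x hx
    have h1 := congrArg norm (h.exp_logSum hx)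
    rw [Complex.norm_exp, norm_inv] at h1
    rw [← Real.log_inv, ← h1, Real.log_exp]
  have hlog : Tendsto (fun x => |Real.log ‖periodProd r U x‖|) (𝓝[upperHalf] (t : ℂ))
      (𝓝 |Real.log ‖Z‖|) := (hZ.norm.log (norm_ne_zero_iff.mpr hZ0)).abs
  obtain ⟨l, -, hl⟩ := exists_tendsto_of_finite (t := t)
    (S := {l : ℂ | Complex.exp l = Z⁻¹ ∧ |l.im| ≤ Real.pi * r})
    h.differentiableOn_logSum.continuousOn (finite_setOf_exp_eq _ _)
    (B := |Real.log ‖Z‖| + 1 + Real.pi * r) (by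
      filter_upwards [self_mem_nhdsWithin, hlog.eventually (gt_mem_nhds (lt_add_one _))]
        with x hx h1
      refine (Complex.norm_le_abs_re_add_abs_im _).trans ?_
      rw [hre x hx, abs_neg, abs_of_nonneg (h.im_logSum_nonneg hx)]
      linarith [im_logSum_le r U x])
    (fun 𝒰 w h𝒰 hw => by
      constructor
      · refine tendsto_nhds_unique ((Complex.continuous_exp.tendsto w).comp hw)
          (((hZ.mono_left h𝒰).inv₀ hZ0).congr' ?_)
        filter_upwards [h𝒰 self_mem_nhdsWithin] with x hx using (h.exp_logSum hx).symm
      · refine le_of_tendsto ((Complex.continuous_im.tendsto w).comp hw).abs ?_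
        filter_upwards [h𝒰 self_mem_nhdsWithin] with x hx
        rw [Function.comp, abs_of_nonneg (h.im_logSum_nonneg hx)]
        exact im_logSum_le r U x)
  exact ⟨l, hl⟩

theorem tendsto_logSum (h : IsRegularSymbol β A U) (t : ℝ) :
    Tendsto (logSum r U) (𝓝[upperHalf] (t : ℂ)) (𝓝 (extendFrom upperHalf (logSum r U) t)) :=
  tendsto_extendFrom (h.exists_tendsto_logSum t)

theorem tendsto_im_logSum (h : IsRegularSymbol β A U) (t : ℝ) :
    Tendsto (fun x => (logSum r U x).im / (Real.pi * r)) (𝓝[upperHalf] (t : ℂ))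
      (𝓝 (phase r U t)) :=
  ((Complex.continuous_im.tendsto _).comp (h.tendsto_logSum t)).div_const _

theorem phase_nonneg (h : IsRegularSymbol β A U) (t : ℝ) : 0 ≤ phase r U t := by
  refine ge_of_tendsto (h.tendsto_im_logSum t) ?_
  filter_upwards [self_mem_nhdsWithin] with x hx
  have := h.im_logSum_nonneg hx
  positivity

theorem phase_le_one (h : IsRegularSymbol β A U) (t : ℝ) : phase r U t ≤ 1 := by
  refine le_of_tendsto (h.tendsto_im_logSum t) ?_
  filter_upwards [self_mem_nhdsWithin] with x hx
  have : (0 : ℝ) < r := by exact_mod_cast NeZero.pos r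
  exact div_le_one_of_le₀ (im_logSum_le r U x) (by positivity)

theorem extendFrom_eq (h : IsRegularSymbol β A U) {x : ℂ} (hx : x ∈ upperHalf) :
    extendFrom upperHalf (logSum r U) x = logSum r U x := by
  refine _root_.extendFrom_eq (subset_closure hx) ?_
  exact (h.differentiableOn_logSum.continuousOn x hx)

theorem continuousOn_extendFrom (h : IsRegularSymbol β A U) :
    ContinuousOn (extendFrom upperHalf (logSum r U)) (closure upperHalf) := by
  refine _root_.continuousOn_extendFrom subset_rfl fun x hx => ?_
  have hcl : closure upperHalf = {z : ℂ | 0 ≤ z.im} := Complex.closure_setOfPred_lt_im 0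
  rw [hcl] at hx
  rcases (show (0 : ℝ) ≤ x.im from hx).eq_or_lt with h0 | h0
  · have : x = (x.re : ℂ) := Complex.ext (by simp) (by simp [← h0])
    rw [this]
    exact h.exists_tendsto_logSum _
  · exact ⟨_, h.differentiableOn_logSum.continuousOn x h0⟩

theorem continuous_phase (h : IsRegularSymbol β A U) : Continuous (phase r U) := by
  have h1 : Continuous fun t : ℝ => extendFrom upperHalf (logSum r U) (t : ℂ) :=
    h.continuousOn_extendFrom.comp_continuous Complex.continuous_ofReal mem_closure_upperHalf
  exact (Complex.continuous_im.comp h1).div_const _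

/-- The derivative of the logarithm converges at t from the convex half plane, so its continuous
extension is differentiable at t relative to the closure, and one may restrict to the real line. -/
theorem hasDerivAt_phase (h : IsRegularSymbol β A U) {t : ℝ} {Z d : ℂ}
    (hb : HasBoundaryValues (periodProd r U) t Z d) (hZ : Z ≠ 0) :
    HasDerivAt (phase r U) (-(1 / (Real.pi * r) * (d / Z).im)) t := by
  set E := extendFrom upperHalf (logSum r U)
  have hEq : Set.EqOn E (logSum r U) upperHalf := fun x hx => h.extendFrom_eq hx
  have hdiff : DifferentiableOn ℂ E upperHalf := h.differentiableOn_logSum.congr hEq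
  have hder : ∀ x ∈ upperHalf, deriv E x = -(deriv (periodProd r U) x / periodProd r U x) :=
    fun x hx => by
      rw [(hEq.eventuallyEq_of_mem (isOpen_upperHalf.mem_nhds hx)).deriv_eq, h.deriv_logSum hx]
  have hlim : Tendsto (fun x => fderiv ℝ E x) (𝓝[upperHalf] (t : ℂ))
      (𝓝 ((ContinuousLinearMap.toSpanSingleton ℂ (-(d / Z))).restrictScalars ℝ)) := by
    have h1 : Tendsto (fun x => deriv E x) (𝓝[upperHalf] (t : ℂ)) (𝓝 (-(d / Z))) := by
      refine ((hb.tendsto_deriv.div hb.tendsto hZ).neg).congr' ?_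
      filter_upwards [self_mem_nhdsWithin] with x hx using (hder x hx).symm
    have hc : Continuous fun w : ℂ =>
        (ContinuousLinearMap.toSpanSingleton ℂ w).restrictScalars ℝ := by
      refine (ContinuousLinearMap.restrictScalarsL ℂ ℂ ℂ ℝ ℝ).continuous.comp ?_
      exact (ContinuousLinearMap.toSpanSingletonCLE (𝕜 := ℂ) (E := ℂ)).continuous
    refine ((hc.tendsto _).comp h1).congr' ?_
    filter_upwards [self_mem_nhdsWithin] with x hx
    have h2 := (hdiff.differentiableAt (isOpen_upperHalf.mem_nhds hx)).hasDerivAt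
    exact (h2.hasFDerivAt.restrictScalars ℝ).fderiv.symm
  have hF := hasFDerivWithinAt_closure_of_tendsto_fderiv (hdiff.restrictScalars ℝ)
    convex_upperHalf isOpen_upperHalf
    (fun y hy => (h.continuousOn_extendFrom y hy).mono subset_closure) hlim
  have hG : HasDerivAt (fun s : ℝ => E (s : ℂ)) (-(d / Z)) t := by
    have h3 : HasDerivWithinAt (fun s : ℝ => (s : ℂ)) 1 Set.univ t :=
      (Complex.ofRealCLM.hasDerivAt (x := t)).hasDerivWithinAt
    have h4 := hF.comp_hasDerivWithinAt t h3 (fun s _ => mem_closure_upperHalf s)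
    rw [hasDerivWithinAt_univ] at h4
    rw [ContinuousLinearMap.coe_restrictScalars', ContinuousLinearMap.toSpanSingleton_apply,
      one_smul] at h4
    exact h4
  have h5 := (Complex.imCLM.hasFDerivAt.comp_hasDerivAt t hG).div_const (Real.pi * r)
  refine h5.congr_deriv ?_
  simp only [Complex.imCLM_apply, Complex.neg_im]
  ring

end IsRegularSymbol

/-! ### The distribution function of μ₁. -/

/-- Induction on the number of exceptional points in the interval, splitting at one of them.
Continuity of g rules out jumps there, and integrability is automatic for a nonnegative derivative.
-/
theorem lintegral_Ioc_of_hasDerivAt_nonneg {g g' : ℝ → ℝ} (hg : Continuous g) {S : Finset ℝ}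
    (hd : ∀ t ∉ S, HasDerivAt g (g' t) t) (h0 : ∀ t ∉ S, 0 ≤ g' t) :
    ∀ {a b : ℝ}, a ≤ b → g a ≤ g b ∧
      ∫⁻ t in Set.Ioc a b, ENNReal.ofReal (g' t) = ENNReal.ofReal (g b - g a) := by
  suffices H : ∀ (n : ℕ) (a b : ℝ), a ≤ b → (S.filter (· ∈ Set.Ioo a b)).card ≤ n →
      g a ≤ g b ∧ ∫⁻ t in Set.Ioc a b, ENNReal.ofReal (g' t) = ENNReal.ofReal (g b - g a) from
    fun {a b} hab => H _ a b hab le_rfl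
  intro n
  induction n with
  | zero =>
    intro a b hab hcard
    have hS : ∀ t ∈ Set.Ioo a b, t ∉ S := by
      intro t ht htS
      have : t ∈ S.filter (· ∈ Set.Ioo a b) := Finset.mem_filter.mpr ⟨htS, ht⟩
      rw [Finset.card_eq_zero.mp (Nat.le_zero.mp hcard)] at this
      simp at this
    have hd' : ∀ t ∈ Set.Ioo a b, HasDerivAt g (g' t) t := fun t ht => hd t (hS t ht)
    have h0' : ∀ t ∈ Set.Ioo a b, 0 ≤ g' t := fun t ht => h0 t (hS t ht)
    have hi := intervalIntegral.integrableOn_deriv_of_nonneg hg.continuousOn hd' h0'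
    have he := intervalIntegral.integral_eq_sub_of_hasDerivAt_of_le hab hg.continuousOn hd'
      ((intervalIntegrable_iff_integrableOn_Ioc_of_le hab).mpr hi)
    rw [intervalIntegral.integral_of_le hab] at he
    have hae : 0 ≤ᵐ[volume.restrict (Set.Ioc a b)] g' := by
      rw [← restrict_Ioo_eq_restrict_Ioc]
      exact (ae_restrict_mem measurableSet_Ioo).mono h0'
    refine ⟨?_, ?_⟩
    · have := integral_nonneg_of_ae hae
      linarith
    · rw [← ofReal_integral_eq_lintegral_ofReal hi hae, he]
  | succ n ih =>
    intro a b hab hcard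
    by_cases hne : (S.filter (· ∈ Set.Ioo a b)).Nonempty
    · obtain ⟨c, hc⟩ := hne
      have hc' := Finset.mem_filter.mp hc
      have hlt : ∀ a' b', Set.Ioo a' b' ⊆ Set.Ioo a b → c ∉ Set.Ioo a' b' →
          (S.filter (· ∈ Set.Ioo a' b')).card ≤ n := by
        intro a' b' hsub hcn
        refine Nat.lt_succ_iff.mp ((Finset.card_lt_card ?_).trans_le hcard)
        refine Finset.ssubset_iff_subset_ne.mpr ⟨fun t ht => ?_, fun heq => ?_⟩
        · rw [Finset.mem_filter] at ht ⊢
          exact ⟨ht.1, hsub ht.2⟩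
        · rw [← heq] at hc
          exact hcn (Finset.mem_filter.mp hc).2
      obtain ⟨h1, h2⟩ := ih a c hc'.2.1.le
        (hlt a c (Set.Ioo_subset_Ioo_right hc'.2.2.le) (by simp))
      obtain ⟨h3, h4⟩ := ih c b hc'.2.2.le
        (hlt c b (Set.Ioo_subset_Ioo_left hc'.2.1.le) (by simp))
      refine ⟨h1.trans h3, ?_⟩
      rw [← Set.Ioc_union_Ioc_eq_Ioc hc'.2.1.le hc'.2.2.le,
        lintegral_union measurableSet_Ioc (Set.Ioc_disjoint_Ioc_of_le le_rfl), h2, h4,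
        ← ENNReal.ofReal_add (by linarith) (by linarith)]
      congr 1; ring
    · refine ih a b hab ?_
      rw [Finset.not_nonempty_iff_eq_empty.mp hne]
      simp

theorem isFiniteMeasure_of_Ioc_le {μ : Measure ℝ} {c : ENNReal} (hc : c ≠ ⊤)
    (h : ∀ a b, a ≤ b → μ (Set.Ioc a b) ≤ c) : IsFiniteMeasure μ := by
  have hU : (⋃ n : ℕ, Set.Ioc (-(n : ℝ)) n) = Set.univ := by
    refine Set.eq_univ_of_forall fun t => Set.mem_iUnion.mpr ?_
    obtain ⟨n, hn⟩ := exists_nat_gt |t|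
    exact ⟨n, (abs_lt.mp hn).1, (abs_lt.mp hn).2.le⟩
  have hm : Monotone fun n : ℕ => Set.Ioc (-(n : ℝ)) n := by
    intro m n hmn
    have : (m : ℝ) ≤ n := by exact_mod_cast hmn
    exact Set.Ioc_subset_Ioc (by linarith) this
  have ht := tendsto_measure_iUnion_atTop (μ := μ) hm
  rw [hU] at ht
  exact ⟨(le_of_tendsto' ht fun n => h _ _ (by linarith [n.cast_nonneg (α := ℝ)])).trans_lt
    hc.lt_top⟩

namespace IsRegularSymbol

variable {r : ℕ} [NeZero r] {β : ℕ} {A : ℤ → Matrix (Fin r) (Fin r) ℂ} {U : ℤ → ℂ → ℂ}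

/-- `μ₁` has distribution function `-phase`. -/
theorem mu1_Ioc (h : IsRegularSymbol β A U) {a b : ℝ} (hab : a ≤ b) :
    phase r U b ≤ phase r U a ∧
      mu1 β A (Set.Ioc a b) = ENNReal.ofReal (phase r U a - phase r U b) := by
  obtain ⟨S, hS, hb⟩ := h.exists_finite_boundary
  have hkey : ∀ t ∉ S, HasDerivAt (fun t => -phase r U t) (density β A t).re t ∧
      0 ≤ (density β A t).re ∧ ((t : ℂ) ∉ Gamma1 β A → (density β A t).re = 0) := by
    intro t ht
    obtain ⟨Z, d, hZd, hZ, h0, h1⟩ := hb t ht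
    have hr : (0 : ℝ) < r := by exact_mod_cast NeZero.pos r
    rw [h.density_eq hZd, Complex.ofReal_re]
    refine ⟨?_, by have := Real.pi_pos; positivity, fun hΓ => by rw [h1 hΓ, mul_zero]⟩
    have := (h.hasDerivAt_phase hZd hZ).fun_neg
    rwa [neg_neg] at this
  obtain ⟨h1, h2⟩ := lintegral_Ioc_of_hasDerivAt_nonneg (g := fun t => -phase r U t)
    (g' := fun t => (density β A t).re) h.continuous_phase.neg (S := hS.toFinset)
    (fun t ht => (hkey t (by simpa using ht)).1) (fun t ht => (hkey t (by simpa using ht)).2.1) hab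
  refine ⟨by linarith, ?_⟩
  rw [mu1, withDensity_apply _ measurableSet_Ioc, Measure.restrict_comm measurableSet_Ioc]
  rw [show phase r U a - phase r U b = -phase r U b - -phase r U a by ring, ← h2]
  -- S is null and outside S the density vanishes off Γ₁, so the restriction to Γ₁ does not affect
  -- the integral.
  have hae : (fun t => ENNReal.ofReal (density β A t).re) =ᵐ[volume.restrict (Set.Ioc a b)]
      Set.indicator Sᶜ fun t => ENNReal.ofReal (density β A t).re := by
    refine ae_restrict_of_ae ?_
    filter_upwards [hS.countable.ae_notMem volume] with t ht
    rw [Set.indicator_of_mem (by exact ht)]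
  rw [lintegral_congr_ae hae, lintegral_congr_ae (ae_restrict_of_ae hae)]
  refine setLIntegral_eq_of_support_subset fun t ht => ?_
  have htS : t ∉ S := (Set.support_indicator_subset ht : t ∈ Sᶜ)
  by_contra hΓ
  refine ht ?_
  rw [Set.indicator_of_mem (by exact htS), (hkey t htS).2.2 hΓ, ENNReal.ofReal_zero]

theorem isFiniteMeasure_mu1 (h : IsRegularSymbol β A U) : IsFiniteMeasure (mu1 β A) :=
  isFiniteMeasure_of_Ioc_le ENNReal.one_ne_top fun a b hab => by
    rw [(h.mu1_Ioc hab).2, ← ENNReal.ofReal_one]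
    exact ENNReal.ofReal_le_ofReal (by linarith [h.phase_le_one a, h.phase_nonneg b])

end IsRegularSymbol

/-! ### Recovering the Stieltjes transform from the distribution function. -/

/-- A maximum principle for bounded analytic functions on the upper half plane; nothing is assumed
at infinity. -/
theorem norm_le_of_tendsto_norm {E : ℂ → ℂ} (hE : DifferentiableOn ℂ E upperHalf) {B κ : ℝ}
    (hB : ∀ x, 0 < x.im → ‖E x‖ ≤ B)
    (hκ : ∀ t : ℝ, Tendsto (fun x => ‖E x‖) (𝓝[upperHalf] (t : ℂ)) (𝓝 κ)) {x₀ : ℂ}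
    (hx₀ : 0 < x₀.im) : ‖E x₀‖ ≤ κ := by
  by_contra! hcon
  have hκ0 : 0 ≤ κ := ge_of_tendsto (hκ 0) (Eventually.of_forall fun _ => norm_nonneg _)
  have hB0 : 0 ≤ B := (norm_nonneg _).trans (hB x₀ hx₀)
  -- The damping factor 1/(1 - iεx) has modulus at most 1 on the half plane and decays at infinity;
  -- for small ε it preserves the strict inequality at x₀.
  obtain ⟨ε, hε, hεx⟩ : ∃ ε : ℝ, 0 < ε ∧ κ < ‖E x₀ * (1 - Complex.I * (ε * x₀))⁻¹‖ := by
    have hc : ContinuousAt (fun ε : ℝ => ‖E x₀ * (1 - Complex.I * (ε * x₀))⁻¹‖) 0 := by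
      refine (ContinuousAt.mul continuousAt_const (ContinuousAt.inv₀ ?_ (by simp))).norm
      fun_prop
    have h1 := hc.eventually (lt_mem_nhds (a := κ) (by simpa using hcon))
    obtain ⟨ε, h2, h3⟩ := ((h1.filter_mono nhdsWithin_le_nhds).and
      (self_mem_nhdsWithin (s := Set.Ioi (0 : ℝ)))).exists
    exact ⟨ε, h3, h2⟩
  have hmul : ∀ x : ℂ, 0 < x.im → 1 ≤ ‖1 - Complex.I * (ε * x)‖ := by
    intro x hx
    refine le_trans ?_ (Complex.re_le_norm _)
    have : (1 - Complex.I * (ε * x)).re = 1 + ε * x.im := by simp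
    rw [this]
    have := mul_pos hε hx
    linarith
  set G : ℂ → ℂ := fun x => E x * (1 - Complex.I * (ε * x))⁻¹ with hG
  have hGE : ∀ x : ℂ, 0 < x.im → ‖G x‖ ≤ ‖E x‖ := by
    intro x hx
    rw [hG, norm_mul, norm_inv]
    exact mul_le_of_le_one_right (norm_nonneg _) (inv_le_one_of_one_le₀ (hmul x hx))
  have hGd : DifferentiableOn ℂ G upperHalf := by
    refine hE.mul (DifferentiableOn.inv (by fun_prop) fun x hx h0 => ?_)
    have := hmul x hx
    rw [h0, norm_zero] at this
    linarith
  set K := ‖G x₀‖ with hK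
  have hKκ : κ < K := hεx
  have hK0 : 0 < K := hκ0.trans_lt hKκ
  have hfar : ∀ x : ℂ, 0 < x.im → (B / K + 2) / ε ≤ ‖x‖ → ‖G x‖ < K := by
    intro x hx hxn
    have h1 : B / K + 1 ≤ ‖1 - Complex.I * (ε * x)‖ := by
      have h2 := norm_sub_norm_le (Complex.I * (ε * x)) 1
      rw [norm_sub_rev, norm_mul, norm_mul, Complex.norm_I, one_mul, norm_one,
        Complex.norm_real, Real.norm_of_nonneg hε.le] at h2
      rw [div_le_iff₀ hε] at hxn
      linarith
    rw [hG, norm_mul, norm_inv, ← div_eq_mul_inv]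
    have h3 : 0 < B / K + 1 := by positivity
    rw [div_lt_iff₀ (h3.trans_le h1)]
    calc ‖E x‖ ≤ B := hB x hx
      _ < K * (B / K + 1) := by rw [mul_add, mul_div_cancel₀ _ hK0.ne']; linarith
      _ ≤ _ := by gcongr
  -- T is bounded by the decay of G and closed because near the real line |G| ≤ |E| → κ < K. A
  -- maximum over T would make G constant, contradicting the decay.
  set T : Set ℂ := {x | 0 < x.im ∧ K ≤ ‖G x‖} with hT
  have hTbdd : Bornology.IsBounded T := by
    refine (Metric.isBounded_closedBall (x := (0 : ℂ)) (r := (B / K + 2) / ε)).subset fun x hx => ?_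
    rw [mem_closedBall_zero_iff]
    by_contra! h
    exact absurd (hfar x hx.1 h.le) (not_lt.mpr hx.2)
  have hTcl : IsClosed T := by
    refine isClosed_of_closure_subset fun x hx => ?_
    have hcl : closure upperHalf = {z : ℂ | 0 ≤ z.im} := Complex.closure_setOfPred_lt_im 0
    have hx' : x ∈ closure upperHalf := closure_mono (fun y hy => hy.1) hx
    rw [hcl] at hx'
    have := mem_closure_iff_nhdsWithin_neBot.mp hx
    have hle : 𝓝[T] x ≤ 𝓝[upperHalf] x := nhdsWithin_mono _ fun y hy => hy.1
    rcases (show (0 : ℝ) ≤ x.im from hx').eq_or_lt with h0 | h0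
    · have hxr : x = (x.re : ℂ) := Complex.ext (by simp) (by simp [← h0])
      rw [hxr] at hle
      have h1 := hle ((hκ x.re).eventually (gt_mem_nhds hKκ))
      rw [← hxr] at h1
      obtain ⟨y, hy, hyT⟩ := (Filter.Eventually.and h1 self_mem_nhdsWithin).exists
      exact absurd (hyT.2.trans (hGE y hyT.1)) (not_le.mpr hy)
    · refine ⟨h0, ge_of_tendsto ((hGd.continuousOn x h0).mono_left hle).norm ?_⟩
      filter_upwards [self_mem_nhdsWithin] with y hy using hy.2
  obtain ⟨c, hc, hmax⟩ := (Metric.isCompact_of_isClosed_isBounded hTcl hTbdd).exists_isMaxOn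
    ⟨x₀, hx₀, le_rfl⟩ ((hGd.continuousOn.mono fun y hy => hy.1).norm)
  have hmax' : IsMaxOn (norm ∘ G) upperHalf c := by
    intro y hy
    by_cases hyK : K ≤ ‖G y‖
    · exact hmax ⟨hy, hyK⟩
    · exact (not_le.mp hyK).le.trans hc.2
  have hconst := Complex.eqOn_of_isPreconnected_of_isMaxOn_norm isPreconnected_upperHalf
    isOpen_upperHalf hGd hc.1 hmax'
  set R := (B / K + 2) / ε
  have hR : 0 < R := by positivity
  have hw : 0 < ((R : ℂ) * Complex.I).im := by simpa using hR
  have h1 := hfar _ hw (by simp [abs_of_pos hR])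
  rw [hconst hw] at h1
  exact absurd hc.2 (not_le.mpr h1)

/-- An analytic function on the upper half plane with bounded imaginary part having constant
boundary values is constant. -/
theorem deriv_eq_zero_of_tendsto_im {N : ℂ → ℂ} (hN : DifferentiableOn ℂ N upperHalf) {B κ : ℝ}
    (hB : ∀ x, 0 < x.im → |(N x).im| ≤ B)
    (hκ : ∀ t : ℝ, Tendsto (fun x => (N x).im) (𝓝[upperHalf] (t : ℂ)) (𝓝 κ)) {x : ℂ}
    (hx : 0 < x.im) : deriv N x = 0 := by
  have h1 : ∀ y, 0 < y.im → (N y).im ≤ κ := by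
    intro y hy
    -- The modulus of exp(-iN) is exp(Im N); the opposite sign gives the lower bound.
    have := norm_le_of_tendsto_norm (E := fun y => Complex.exp (-Complex.I * N y)) (B := Real.exp B)
      (κ := Real.exp κ) (hN.const_mul _).cexp (fun z hz => ?_) (fun t => ?_) hy
    · simpa [Complex.norm_exp] using this
    · simpa [Complex.norm_exp] using (le_abs_self _).trans (hB z hz)
    · simpa [Complex.norm_exp] using (hκ t).rexp
  have h2 : ∀ y, 0 < y.im → κ ≤ (N y).im := by
    intro y hy
    have := norm_le_of_tendsto_norm (E := fun y => Complex.exp (Complex.I * N y)) (B := Real.exp B)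
      (κ := Real.exp (-κ)) (hN.const_mul _).cexp (fun z hz => ?_) (fun t => ?_) hy
    · simpa [Complex.norm_exp] using this
    · simpa [Complex.norm_exp] using (neg_le_abs _).trans (hB z hz)
    · simpa [Complex.norm_exp] using (hκ t).neg.rexp
  -- Im N is now constant, so exp(-iN) has constant modulus and is itself constant.
  have hd := (hN.const_mul (-Complex.I)).cexp
  have hconst := Complex.eqOn_of_isPreconnected_of_isMaxOn_norm isPreconnected_upperHalf
    isOpen_upperHalf hd (c := x) hx fun y hy => by
      simpa [Complex.norm_exp] using (h1 y hy).trans (h2 x hx)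
  have hn := isOpen_upperHalf.mem_nhds hx
  have h3 := (hconst.eventuallyEq_of_mem hn).deriv_eq
  have h4 := ((hN.differentiableAt hn).hasDerivAt.const_mul (-Complex.I)).cexp.deriv
  rw [h4, show deriv (Function.const ℂ (Complex.exp (-Complex.I * N x))) x = 0 from
    deriv_const x _] at h3
  simpa [Complex.exp_ne_zero] using h3

section LogPotential

variable {μ : Measure ℝ} [IsFiniteMeasure μ]

theorem sub_ofReal_mem_slitPlane {x : ℂ} (hx : 0 < x.im) (t : ℝ) : x - t ∈ Complex.slitPlane :=
  Or.inr (by simpa using hx.ne')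

theorem norm_inv_sub_ofReal_le {x : ℂ} (hx : 0 < x.im) (t : ℝ) : ‖(x - t)⁻¹‖ ≤ x.im⁻¹ := by
  rw [norm_inv]
  refine inv_anti₀ hx ?_
  have := im_le_norm_sub_ofReal x t
  rwa [abs_of_pos hx] at this

theorem continuous_log_sub_ofReal {x : ℂ} (hx : 0 < x.im) :
    Continuous fun t : ℝ => Complex.log (x - t) :=
  Continuous.clog (by fun_prop) fun t => sub_ofReal_mem_slitPlane hx t

theorem continuous_arg_sub_ofReal {x : ℂ} (hx : 0 < x.im) :
    Continuous fun t : ℝ => Complex.arg (x - t) := by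
  have := Complex.continuous_im.comp (continuous_log_sub_ofReal hx)
  exact this.congr fun t => Complex.log_im _

theorem continuous_inv_sub_ofReal {x : ℂ} (hx : 0 < x.im) : Continuous fun t : ℝ => (x - t)⁻¹ :=
  Continuous.inv₀ (by fun_prop) fun t => sub_ofReal_ne_zero hx t

/-- Uniform in t, so subtracting log(i - t) makes the potential of any finite measure converge
without moment assumptions. -/
theorem norm_log_sub_log_le {x y : ℂ} {c : ℝ} (hc : 0 < c) (hx : c ≤ x.im) (hy : c ≤ y.im) (t : ℝ) :
    ‖Complex.log (x - t) - Complex.log (y - t)‖ ≤ c⁻¹ * ‖x - y‖ := by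
  refine Convex.norm_image_sub_le_of_norm_hasDerivWithin_le (f := fun w : ℂ => Complex.log (w - t))
    (f' := fun w => 1 / (w - t)) (s := {w : ℂ | c ≤ w.im}) (fun w hw => ?_) (fun w hw => ?_)
    (convex_halfSpace_im_ge c) hy hx
  · exact (((hasDerivAt_id w).sub_const _).clog
      (sub_ofReal_mem_slitPlane (hc.trans_le hw) t)).hasDerivWithinAt
  · rw [one_div]
    exact (norm_inv_sub_ofReal_le (hc.trans_le hw) t).trans (inv_anti₀ hc hw)

/-- The logarithmic potential of `μ`, normalised to vanish at `i`. -/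
def logPotential (μ : Measure ℝ) (x : ℂ) : ℂ :=
  ∫ t : ℝ, (Complex.log (x - t) - Complex.log (Complex.I - t)) ∂μ

theorem I_im_pos : 0 < Complex.I.im := by simp

theorem integrable_log_sub_log {x : ℂ} (hx : 0 < x.im) :
    Integrable (fun t : ℝ => Complex.log (x - t) - Complex.log (Complex.I - t)) μ := by
  refine Integrable.of_bound (C := (min x.im 1)⁻¹ * ‖x - Complex.I‖)
    ((continuous_log_sub_ofReal hx).sub
      (continuous_log_sub_ofReal I_im_pos)).aestronglyMeasurable
    (Eventually.of_forall fun t => ?_)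
  exact norm_log_sub_log_le (lt_min hx one_pos) (min_le_left _ _) (by simp) t

theorem hasDerivAt_logPotential {x : ℂ} (hx : 0 < x.im) :
    HasDerivAt (logPotential μ) (∫ t : ℝ, (x - t)⁻¹ ∂μ) x := by
  have hs : {w : ℂ | x.im / 2 < w.im} ∈ 𝓝 x :=
    (isOpen_lt continuous_const Complex.continuous_im).mem_nhds (half_lt_self hx)
  refine (hasDerivAt_integral_of_dominated_loc_of_deriv_le (μ := μ)
    (F := fun (x : ℂ) (t : ℝ) => Complex.log (x - t) - Complex.log (Complex.I - t))
    (F' := fun x t => (x - t)⁻¹)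
    (bound := fun _ => (x.im / 2)⁻¹) hs ?_ (integrable_log_sub_log hx) ?_ ?_ ?_ ?_).2
  · filter_upwards [isOpen_upperHalf.mem_nhds hx] with y hy
    exact (integrable_log_sub_log hy).aestronglyMeasurable
  · exact (continuous_inv_sub_ofReal hx).aestronglyMeasurable
  · refine Eventually.of_forall fun t y hy => ?_
    have hy' : x.im / 2 < y.im := hy
    exact (norm_inv_sub_ofReal_le (by linarith) t).trans (inv_anti₀ (by linarith) hy'.le)
  · exact integrable_const _
  · refine Eventually.of_forall fun t y hy => ?_
    have hy' : x.im / 2 < y.im := hy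
    have := (((hasDerivAt_id y).sub_const (t : ℂ)).clog
      (sub_ofReal_mem_slitPlane (by simp only [id]; linarith) t)).sub_const
        (Complex.log (Complex.I - t))
    rwa [one_div] at this

theorem integrable_arg_sub {x : ℂ} (hx : 0 < x.im) :
    Integrable (fun t : ℝ => Complex.arg (x - t)) μ :=
  Integrable.of_bound (continuous_arg_sub_ofReal hx).aestronglyMeasurable Real.pi
    (Eventually.of_forall fun _ => Complex.abs_arg_le_pi _)

theorem im_logPotential {x : ℂ} (hx : 0 < x.im) :
    (logPotential μ x).im
      = ∫ t : ℝ, Complex.arg (x - t) ∂μ - ∫ t : ℝ, Complex.arg (Complex.I - t) ∂μ := by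
  rw [logPotential, ← integral_sub (integrable_arg_sub hx) (integrable_arg_sub I_im_pos)]
  have := Complex.imCLM.integral_comp_comm (integrable_log_sub_log (μ := μ) hx)
  rw [Complex.imCLM_apply] at this
  rw [← this]
  simp [Complex.log_im]

theorem norm_integral_arg_le (x : ℂ) :
    |∫ t : ℝ, Complex.arg (x - t) ∂μ| ≤ Real.pi * μ.real Set.univ :=
  norm_integral_le_of_norm_le_const (f := fun t : ℝ => Complex.arg (x - t))
    (Eventually.of_forall fun _ => Complex.abs_arg_le_pi _)

/-- As x → s, arg(x - t) tends to π for t > s and to 0 for t < s; the absence of atoms disposes of t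
= s. -/
theorem tendsto_integral_arg [NullSingletonClass μ] (s : ℝ) :
    Tendsto (fun x : ℂ => ∫ t : ℝ, Complex.arg (x - t) ∂μ) (𝓝[upperHalf] (s : ℂ))
      (𝓝 (Real.pi * μ.real (Set.Ioi s))) := by
  have h1 : Real.pi * μ.real (Set.Ioi s)
      = ∫ t, (Set.Ioi s).indicator (fun _ => Real.pi) t ∂μ := by
    rw [integral_indicator_const _ measurableSet_Ioi, smul_eq_mul, mul_comm]
  rw [h1]
  refine tendsto_integral_filter_of_dominated_convergence (fun _ => Real.pi) ?_ ?_
    (integrable_const _) ?_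
  · filter_upwards [self_mem_nhdsWithin] with x hx
    exact (continuous_arg_sub_ofReal hx).aestronglyMeasurable
  · exact Eventually.of_forall fun x => Eventually.of_forall fun t => Complex.abs_arg_le_pi _
  · have hne : ∀ᵐ t ∂μ, t ≠ s := by
      rw [ae_iff]; simp
    filter_upwards [hne] with t ht
    have hsub : Tendsto (fun x : ℂ => x - t) (𝓝[upperHalf] (s : ℂ))
        (𝓝[{z : ℂ | 0 ≤ z.im}] ((s - t : ℝ) : ℂ)) := by
      refine tendsto_nhdsWithin_iff.mpr ⟨?_, ?_⟩
      · have : Continuous fun x : ℂ => x - t := by fun_prop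
        have h2 := this.tendsto (s : ℂ)
        rw [← Complex.ofReal_sub] at h2
        exact h2.mono_left nhdsWithin_le_nhds
      · filter_upwards [self_mem_nhdsWithin] with x hx
        have : 0 < x.im := hx
        simpa using this.le
    rcases lt_or_gt_of_ne ht with h | h
    · rw [Set.indicator_of_notMem (by simpa using h.le)]
      have h3 := Complex.continuousAt_arg (x := ((s - t : ℝ) : ℂ))
        (Or.inl (by simpa using h))
      have h4 := h3.tendsto.comp (hsub.mono_right nhdsWithin_le_nhds)
      rwa [Complex.arg_ofReal_of_nonneg (sub_nonneg.mpr h.le)] at h4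
    · rw [Set.indicator_of_mem (by exact h)]
      have h3 := Complex.continuousWithinAt_arg_of_re_neg_of_im_zero (z := ((s - t : ℝ) : ℂ))
        (by simpa using h) (Complex.ofReal_im _)
      have h4 := h3.tendsto.comp hsub
      rwa [Complex.arg_ofReal_of_neg (sub_neg.mpr h)] at h4

/-- A finite measure is determined by the analytic function on the upper half plane whose imaginary
part has, up to sign, the distribution function of the measure as boundary values. -/
theorem integral_inv_sub_eq_deriv [NullSingletonClass μ] {L : ℂ → ℂ} {θ : ℝ → ℝ}
    (hL : DifferentiableOn ℂ L upperHalf) {B : ℝ} (hB : ∀ x, 0 < x.im → |(L x).im| ≤ B)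
    (hθ : ∀ t : ℝ, Tendsto (fun x => (L x).im) (𝓝[upperHalf] (t : ℂ)) (𝓝 (Real.pi * θ t)))
    (hμ : ∀ a b, a ≤ b → θ b ≤ θ a ∧ μ (Set.Ioc a b) = ENNReal.ofReal (θ a - θ b)) {x : ℂ}
    (hx : 0 < x.im) : ∫ t : ℝ, (x - t)⁻¹ ∂μ = deriv L x := by
  -- The tail of μ and θ have equal increments, so they differ by a constant; limits of θ at ±∞ are
  -- not needed.
  have hconst : ∀ a b, a ≤ b → μ.real (Set.Ioi a) - θ a = μ.real (Set.Ioi b) - θ b := by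
    intro a b hab
    obtain ⟨h1, h2⟩ := hμ a b hab
    have h3 : μ.real (Set.Ioi a) = μ.real (Set.Ioc a b) + μ.real (Set.Ioi b) := by
      rw [← Set.Ioc_union_Ioi_eq_Ioi hab]
      exact measureReal_union (Set.disjoint_left.mpr fun t ht ht' => not_lt.mpr ht.2 ht')
        measurableSet_Ioi
    rw [h3, Measure.real, h2, ENNReal.toReal_ofReal (by linarith)]
    ring
  have hconst' : ∀ a, μ.real (Set.Ioi a) - θ a = μ.real (Set.Ioi 0) - θ 0 := fun a =>
    (le_total a 0).elim (hconst a 0) fun h => (hconst 0 a h).symm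
  set c := ∫ t : ℝ, Complex.arg (Complex.I - t) ∂μ with hc
  have hMd : DifferentiableOn ℂ (logPotential μ) upperHalf := fun y hy =>
    (hasDerivAt_logPotential hy).differentiableAt.differentiableWithinAt
  have hzero := deriv_eq_zero_of_tendsto_im (N := fun y => logPotential μ y - L y)
    (hMd.sub hL) (B := 2 * (Real.pi * μ.real Set.univ) + B)
    (κ := Real.pi * (μ.real (Set.Ioi 0) - θ 0) - c) (fun y hy => ?_) (fun t => ?_) hx
  · have hn := isOpen_upperHalf.mem_nhds hx
    have h1 := ((hasDerivAt_logPotential (μ := μ) hx).sub (hL.differentiableAt hn).hasDerivAt).deriv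
    exact sub_eq_zero.mp (h1.symm.trans hzero)
  · rw [Complex.sub_im, im_logPotential hy]
    have h1 := abs_le.mp (norm_integral_arg_le (μ := μ) y)
    have h2 := abs_le.mp (norm_integral_arg_le (μ := μ) Complex.I)
    have h3 := abs_le.mp (hB y hy)
    exact abs_le.mpr ⟨by linarith, by linarith⟩
  · have h1 := ((tendsto_integral_arg (μ := μ) t).sub_const c).sub (hθ t)
    have h2 : Real.pi * (μ.real (Set.Ioi 0) - θ 0) - c
        = Real.pi * μ.real (Set.Ioi t) - c - Real.pi * θ t := by
      rw [← hconst' t]; ring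
    rw [h2]
    refine h1.congr' ?_
    filter_upwards [self_mem_nhdsWithin] with y hy
    rw [Complex.sub_im, im_logPotential hy]

end LogPotential

/-! ### Total mass of μ₁ from the behaviour at i∞. -/

theorem tendsto_mul_integral_inv_sub (μ : Measure ℝ) [IsFiniteMeasure μ] :
    Tendsto (fun y : ℝ => (y * Complex.I : ℂ) * ∫ t : ℝ, (y * Complex.I - t : ℂ)⁻¹ ∂μ) atTop
      (𝓝 (μ.real Set.univ : ℂ)) := by
  have h1 : (μ.real Set.univ : ℂ) = ∫ _ : ℝ, (1 : ℂ) ∂μ := by simp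
  rw [h1]
  simp_rw [← integral_const_mul]
  refine tendsto_integral_filter_of_dominated_convergence (fun _ => 1) ?_ ?_
    (integrable_const _) ?_
  · filter_upwards [eventually_gt_atTop 0] with y hy
    exact (continuous_const.mul
      (continuous_inv_sub_ofReal (x := y * Complex.I) (by simpa using hy))).aestronglyMeasurable
  · filter_upwards [eventually_gt_atTop 0] with y hy
    refine Eventually.of_forall fun t => ?_
    have h2 := norm_inv_sub_ofReal_le (x := y * Complex.I) (by simpa using hy) t
    rw [norm_mul]
    calc _ ≤ ‖(y * Complex.I : ℂ)‖ * ((y * Complex.I : ℂ).im)⁻¹ := by gcongr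
      _ = 1 := by simp [abs_of_pos hy, hy.ne']
  · refine Eventually.of_forall fun t => ?_
    have h3 : Tendsto (fun y : ℝ => ((1 : ℂ) - t * ((y⁻¹ : ℝ) : ℂ) * (-Complex.I))⁻¹) atTop (𝓝 1) := by
      have h4 := (Complex.continuous_ofReal.tendsto 0).comp tendsto_inv_atTop_zero
      have h5 := ((tendsto_const_nhds (x := (1 : ℂ))).sub
        ((h4.const_mul (t : ℂ)).mul_const (-Complex.I))).inv₀ (by simp)
      simpa [Function.comp_def] using h5
    refine h3.congr' ?_
    filter_upwards [eventually_gt_atTop 0] with y hy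
    have hy0 : (y : ℂ) ≠ 0 := by exact_mod_cast hy.ne'
    rw [← div_eq_mul_inv, inv_eq_one_div, ← mul_div_mul_left _ _
      (mul_ne_zero hy0 Complex.I_ne_zero), mul_one]
    congr 1
    push_cast
    field_simp
    linear_combination (t : ℂ) * Complex.I_sq

/-- The ratio equation reads U_i = 1/(x - W) with W bounded for Im x ≥ 1 and W' = O(1/y) by Cauchy's
estimate, so xU_i'/U_i = -x(1 - W')/(x - W). -/
theorem IsLimitRatio.tendsto_mul_logDeriv {m : ℕ} {a : ℤ → ℤ → ℂ} {U : ℤ → ℂ → ℂ}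
    (h : IsLimitRatio m a U) (hC : ∃ C : ℝ, ∀ i j, ‖a i j‖ ≤ C) (i : ℤ) :
    Tendsto (fun y : ℝ => (y * Complex.I : ℂ) *
      (deriv (U i) (y * Complex.I) / U i (y * Complex.I))) atTop (𝓝 (-1)) := by
  obtain ⟨C, hC⟩ := hC
  have hC0 : 0 ≤ C := (norm_nonneg _).trans (hC 0 0)
  set W : ℂ → ℂ := fun x => ∑ l ∈ Finset.range m, a i (i - l) *
    ∏ p ∈ Finset.range l, U (i - 1 - p) x with hW
  have hWd : DifferentiableOn ℂ W upperHalf := by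
    refine DifferentiableOn.fun_sum fun l _ => DifferentiableOn.const_mul ?_ _
    exact DifferentiableOn.fun_finsetProd fun p _ => (h.stieltjes _).differentiableOn
  have hUW : ∀ x : ℂ, 0 < x.im → U i x * (x - W x) = 1 := by
    intro x hx
    have := h.solution x hx i
    simp only at this
    linear_combination this
  have hWb : ∀ x : ℂ, 1 ≤ x.im → ‖W x‖ ≤ m * C := by
    intro x hx
    have hx0 : 0 < x.im := by linarith
    have hl : ∀ l : ℕ, ‖a i (i - l) * ∏ p ∈ Finset.range l, U (i - 1 - p) x‖ ≤ C := by
      intro l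
      rw [norm_mul, norm_prod]
      exact (mul_le_of_le_one_right (norm_nonneg _)
        (Finset.prod_le_one (fun _ _ => norm_nonneg _) fun p _ =>
          ((h.stieltjes _).norm_le hx0).trans (inv_le_one_of_one_le₀ hx))).trans (hC _ _)
    exact (norm_sum_le _ _).trans
      ((Finset.sum_le_sum fun l _ => hl l).trans (le_of_eq (by simp)))
  have hWd' : ∀ y : ℝ, 2 ≤ y → ‖deriv W (y * Complex.I)‖ ≤ m * C * 2 * y⁻¹ := by
    intro y hy
    have hball : ∀ z ∈ Metric.closedBall (y * Complex.I : ℂ) (y / 2), 1 ≤ z.im := by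
      intro z hz
      rw [mem_closedBall_iff_norm] at hz
      have h1 := (abs_le.mp ((Complex.abs_im_le_norm _).trans hz)).1
      simp at h1
      linarith
    -- The disk of radius y/2 stays in Im ≥ 1 because y ≥ 2.
    have h2 := Complex.norm_deriv_le_of_forall_mem_sphere_norm_le (f := W) (c := y * Complex.I)
      (R := y / 2) (C := m * C) (by linarith) ?_ fun z hz =>
        hWb z (hball z (Metric.sphere_subset_closedBall hz))
    · refine h2.trans (le_of_eq ?_)
      field_simp
    · refine DifferentiableOn.diffContOnCl_ball (U := upperHalf) hWd fun z hz => ?_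
      exact lt_of_lt_of_le one_pos (hball z hz)
  have hinv : Tendsto (fun y : ℝ => ((y : ℂ) * Complex.I)⁻¹) atTop (𝓝 0) := by
    rw [tendsto_zero_iff_norm_tendsto_zero]
    have : Tendsto (fun y : ℝ => |y|⁻¹) atTop (𝓝 0) := tendsto_inv_atTop_zero.comp tendsto_abs_atTop_atTop
    simpa using this
  have hW0 : Tendsto (fun y : ℝ => W (y * Complex.I) * ((y : ℂ) * Complex.I)⁻¹) atTop (𝓝 0) := by
    rw [tendsto_zero_iff_norm_tendsto_zero] at hinv ⊢
    refine squeeze_zero' (g := fun y : ℝ => (m * C) * ‖((y : ℂ) * Complex.I)⁻¹‖)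
      (Eventually.of_forall fun _ => norm_nonneg _) ?_ (by simpa using hinv.const_mul ((m : ℝ) * C))
    filter_upwards [eventually_ge_atTop 1] with y hy
    rw [norm_mul]
    gcongr
    exact hWb _ (by simpa using hy)
  have hW1 : Tendsto (fun y : ℝ => deriv W (y * Complex.I)) atTop (𝓝 0) := by
    rw [tendsto_zero_iff_norm_tendsto_zero]
    refine squeeze_zero' (Eventually.of_forall fun _ => norm_nonneg _)
      ((eventually_ge_atTop 2).mono hWd') ?_
    simpa using tendsto_inv_atTop_zero.const_mul ((m : ℝ) * C * 2)
  have hfin := ((tendsto_const_nhds (x := (1 : ℂ))).sub hW1).div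
    ((tendsto_const_nhds (x := (1 : ℂ))).sub hW0) (by simp)
  have hfin' := hfin.neg
  simp only [sub_zero, div_one] at hfin'
  refine hfin'.congr' ?_
  filter_upwards [eventually_gt_atTop 0] with y hy
  set x : ℂ := y * Complex.I with hxdef
  have hx : 0 < x.im := by simpa [hxdef] using hy
  have hx0 : x ≠ 0 := fun h0 => by simp [h0] at hx
  have hn := isOpen_upperHalf.mem_nhds hx
  have hd := (((h.stieltjes i).differentiableOn.differentiableAt hn).hasDerivAt.mul
    ((hasDerivAt_id x).sub (hWd.differentiableAt hn).hasDerivAt)).deriv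
  have he : (U i * (id - W)) =ᶠ[𝓝 x] fun _ => 1 := by
    filter_upwards [hn] with z hz using hUW z hz
  rw [he.deriv_eq, deriv_const] at hd
  have h1 := hUW x hx
  have hU0 := h.ne_zero i hx
  have hxW : x - W x ≠ 0 := fun h0 => by simp [h0] at h1
  have h2 : 1 - W x * x⁻¹ = (x - W x) / x := by field_simp
  simp only [Pi.sub_apply, id] at hd
  change -((1 - deriv W x) / (1 - W x * x⁻¹)) = _
  rw [h2]
  field_simp
  linear_combination hd

namespace IsRegularSymbol

variable {r : ℕ} [NeZero r] {β : ℕ} {A : ℤ → Matrix (Fin r) (Fin r) ℂ} {U : ℤ → ℂ → ℂ}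

/-- The Stieltjes transform of `μ₁`. -/
theorem integral_inv_sub_mu1 (h : IsRegularSymbol β A U) {x : ℂ} (hx : 0 < x.im) :
    ∫ t : ℝ, (x - t)⁻¹ ∂(mu1 β A)
      = -((r : ℂ)⁻¹ * ∑ p ∈ Finset.range r, deriv (U p) x / U p x) := by
  have := h.isFiniteMeasure_mu1
  have : NullSingletonClass (mu1 β A) := by unfold mu1; infer_instance
  have hr : (0 : ℝ) < r := by exact_mod_cast NeZero.pos r
  have hdiv : ∀ z : ℂ, ((r : ℂ)⁻¹ * z).im = z.im / r := by
    intro z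
    rw [← Complex.ofReal_natCast, ← Complex.ofReal_inv, Complex.im_ofReal_mul, inv_mul_eq_div]
  rw [integral_inv_sub_eq_deriv (L := fun y => (r : ℂ)⁻¹ * logSum r U y) (θ := phase r U)
    (h.differentiableOn_logSum.const_mul _) (B := Real.pi) (fun y hy => ?_) (fun t => ?_)
    (fun a b hab => h.mu1_Ioc hab) hx, ((h.hasDerivAt_logSum hx).const_mul _).deriv, mul_neg]
  · rw [hdiv, abs_of_nonneg (div_nonneg (h.im_logSum_nonneg hy) hr.le), div_le_iff₀ hr]
    exact im_logSum_le r U y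
  · refine ((h.tendsto_im_logSum t).const_mul Real.pi).congr fun y => ?_
    rw [hdiv]
    have := Real.pi_ne_zero
    field_simp

theorem isProbabilityMeasure_mu1 (h : IsRegularSymbol β A U) :
    IsProbabilityMeasure (mu1 β A) := by
  have := h.isFiniteMeasure_mu1
  have hr : (r : ℂ) ≠ 0 := by exact_mod_cast NeZero.ne r
  have h1 := tendsto_mul_integral_inv_sub (mu1 β A)
  have h2 : Tendsto (fun y : ℝ => -((r : ℂ)⁻¹ * ∑ p ∈ Finset.range r,
      (y * Complex.I : ℂ) * (deriv (U p) (y * Complex.I) / U p (y * Complex.I)))) atTop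
      (𝓝 (-((r : ℂ)⁻¹ * ∑ _p ∈ Finset.range r, (-1 : ℂ)))) := by
    refine Tendsto.neg (Tendsto.const_mul _ (tendsto_finsetSum _ fun p _ => ?_))
    exact h.limitRatio.tendsto_mul_logDeriv (exists_norm_toeplitz_le β A) p
  have h3 : -((r : ℂ)⁻¹ * ∑ _p ∈ Finset.range r, (-1 : ℂ)) = 1 := by
    rw [Finset.sum_const, Finset.card_range, nsmul_eq_mul, mul_neg_one, mul_neg, neg_neg,
      inv_mul_cancel₀ hr]
  rw [h3] at h2
  have h4 : ((mu1 β A).real Set.univ : ℂ) = 1 := by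
    refine tendsto_nhds_unique h1 (h2.congr' ?_)
    filter_upwards [eventually_gt_atTop 0] with y hy
    rw [h.integral_inv_sub_mu1 (by simpa using hy), ← Finset.mul_sum]
    ring
  have h5 : (mu1 β A).real Set.univ = 1 := by exact_mod_cast h4
  refine ⟨?_⟩
  rw [Measure.real, ENNReal.toReal_eq_one_iff] at h5
  exact h5

end IsRegularSymbol

/-! ### Poisson smoothing and weak convergence. -/

/-- The Poisson kernel of the upper half plane. -/
def poissonKernel (ε u : ℝ) : ℝ := Real.pi⁻¹ * (ε / (u ^ 2 + ε ^ 2))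

section Poisson

variable {ε : ℝ}

theorem poissonKernel_nonneg (hε : 0 < ε) (u : ℝ) : 0 ≤ poissonKernel ε u := by
  have := Real.pi_pos
  rw [poissonKernel]; positivity

theorem continuous_poissonKernel (hε : 0 < ε) : Continuous (poissonKernel ε) := by
  refine continuous_const.mul (Continuous.div continuous_const (by fun_prop) fun u => ?_)
  positivity

theorem poissonKernel_mul (hε : 0 < ε) (u : ℝ) :
    poissonKernel ε (ε * u) = ε⁻¹ * poissonKernel 1 u := by
  have := Real.pi_pos
  simp only [poissonKernel]
  field_simp

theorem integrable_poissonKernel_one : Integrable (poissonKernel 1) := by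
  refine (integrable_inv_one_add_sq.const_mul Real.pi⁻¹).congr (Eventually.of_forall fun u => ?_)
  simp [poissonKernel, add_comm]

theorem integral_poissonKernel_one : ∫ u, poissonKernel 1 u = 1 := by
  have : poissonKernel 1 = fun u => Real.pi⁻¹ * (1 + u ^ 2)⁻¹ := by
    ext u; simp [poissonKernel, add_comm]
  rw [this, integral_const_mul, integral_univ_inv_one_add_sq, inv_mul_cancel₀ Real.pi_ne_zero]

theorem integral_mul_poissonKernel (hε : 0 < ε) (g : ℝ → ℝ) (t : ℝ) :
    ∫ s, g s * poissonKernel ε (s - t) = ∫ u, g (t + ε * u) * poissonKernel 1 u := by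
  rw [← integral_add_right_eq_self (fun s => g s * poissonKernel ε (s - t)) t]
  have h := Measure.integral_comp_mul_left (fun s => g (s + t) * poissonKernel ε (s + t - t)) ε
  rw [abs_of_pos (inv_pos.mpr hε), smul_eq_mul, eq_inv_mul_iff_mul_eq₀ hε.ne'] at h
  rw [← h, ← integral_const_mul]
  congr 1
  ext u
  rw [add_sub_cancel_right, poissonKernel_mul hε, add_comm]
  field_simp

theorem integrable_poissonKernel (hε : 0 < ε) (t : ℝ) :
    Integrable fun s => poissonKernel ε (s - t) := by
  suffices h : Integrable (poissonKernel ε) from h.comp_sub_right t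
  have h1 := (integrable_poissonKernel_one.comp_mul_left' (inv_ne_zero hε.ne')).const_mul ε⁻¹
  refine h1.congr (Eventually.of_forall fun u => ?_)
  simp only
  rw [← poissonKernel_mul hε, mul_inv_cancel_left₀ hε.ne']

theorem integral_poissonKernel (hε : 0 < ε) (t : ℝ) : ∫ s, poissonKernel ε (s - t) = 1 := by
  have := integral_mul_poissonKernel hε (fun _ => 1) t
  simpa [integral_poissonKernel_one] using this

theorem poissonKernel_eq_im (ε s t : ℝ) :
    poissonKernel ε (s - t) = -Real.pi⁻¹ * (((s + ε * Complex.I : ℂ) - t)⁻¹).im := by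
  rw [Complex.inv_im, poissonKernel, Complex.normSq_apply]
  simp
  ring

variable (μ : Measure ℝ)

/-- The Poisson integral of a measure on the real line. -/
def poissonIntegral (ε s : ℝ) : ℝ := ∫ t, poissonKernel ε (s - t) ∂μ

theorem poissonIntegral_eq_im [IsProbabilityMeasure μ] (hε : 0 < ε) (s : ℝ) :
    poissonIntegral μ ε s = -Real.pi⁻¹ * (∫ t : ℝ, ((s + ε * Complex.I : ℂ) - t)⁻¹ ∂μ).im := by
  have hx : 0 < (s + ε * Complex.I : ℂ).im := by simpa using hε
  have hi : Integrable (fun t : ℝ => ((s + ε * Complex.I : ℂ) - t)⁻¹) μ :=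
    Integrable.of_bound (continuous_inv_sub_ofReal hx).aestronglyMeasurable _
      (Eventually.of_forall fun t => norm_inv_sub_ofReal_le hx t)
  have h := Complex.imCLM.integral_comp_comm hi
  rw [Complex.imCLM_apply] at h
  rw [poissonIntegral, ← h, ← integral_const_mul]
  exact integral_congr_ae (Eventually.of_forall fun t => poissonKernel_eq_im ε s t)

theorem poissonIntegral_nonneg (hε : 0 < ε) (s : ℝ) : 0 ≤ poissonIntegral μ ε s :=
  integral_nonneg fun _ => poissonKernel_nonneg hε _

theorem integrable_prod_poissonKernel [IsProbabilityMeasure μ] (hε : 0 < ε) {φ : ℝ → ℝ} (hφ : Continuous φ) {B : ℝ}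
    (hB : ∀ t, |φ t| ≤ B) :
    Integrable (Function.uncurry fun s t => φ s * poissonKernel ε (s - t))
      ((volume : Measure ℝ).prod μ) := by
  have hP := continuous_poissonKernel hε
  have hK : Integrable (Function.uncurry fun s t => poissonKernel ε (s - t))
      ((volume : Measure ℝ).prod μ) := by
    rw [integrable_prod_iff' (Continuous.aestronglyMeasurable (by
      simp only [Function.uncurry_def]; fun_prop))]
    refine ⟨Eventually.of_forall fun t => integrable_poissonKernel hε t, ?_⟩
    have : (fun t => ∫ s, ‖Function.uncurry (fun s t => poissonKernel ε (s - t)) (s, t)‖)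
        = fun _ => (1 : ℝ) := by
      ext t
      rw [← integral_poissonKernel hε t]
      exact integral_congr_ae (Eventually.of_forall fun s =>
        Real.norm_of_nonneg (poissonKernel_nonneg hε _))
    rw [this]
    exact integrable_const _
  refine (hK.bdd_mul (f := fun p => φ p.1) (c := B)
    (Continuous.aestronglyMeasurable (by fun_prop)) (Eventually.of_forall fun p => hB _))

variable [IsProbabilityMeasure μ]

/-- Fubini moves the smoothing from the measure to the test function, where the Lipschitz bound
controls it uniformly in μ. -/
theorem integral_mul_poissonIntegral (hε : 0 < ε) {φ : ℝ → ℝ} (hφ : Continuous φ) {B : ℝ}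
    (hB : ∀ t, |φ t| ≤ B) :
    ∫ s, φ s * poissonIntegral μ ε s
      = ∫ t, (∫ u, φ (t + ε * u) * poissonKernel 1 u) ∂μ := by
  have h := integral_integral_swap (integrable_prod_poissonKernel μ hε hφ hB)
  simp_rw [integral_mul_poissonKernel hε, integral_const_mul] at h
  exact h

theorem integrable_poissonIntegral (hε : 0 < ε) : Integrable (poissonIntegral μ ε) := by
  have h := (integrable_prod_poissonKernel μ hε (φ := fun _ => 1) continuous_const (B := 1)
    (fun _ => by simp)).integral_prod_left
  simp only [Function.uncurry, one_mul] at h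
  exact h

theorem integral_poissonIntegral (hε : 0 < ε) : ∫ s, poissonIntegral μ ε s = 1 := by
  have h := integral_mul_poissonIntegral μ hε (φ := fun _ => 1) continuous_const (B := 1)
    (fun _ => by simp)
  simpa [integral_poissonKernel_one] using h

/-- The error in approximating the integral of a bounded Lipschitz function by that of its Poisson
integral. -/
def smoothingError (L B ε : ℝ) : ℝ := ∫ u, min (L * (ε * |u|)) (2 * B) * poissonKernel 1 u

theorem integrable_smoothingError {L B : ℝ} (hL : 0 ≤ L) (hB : 0 ≤ B) (hε : 0 < ε) :
    Integrable fun u => min (L * (ε * |u|)) (2 * B) * poissonKernel 1 u := by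
  refine integrable_poissonKernel_one.bdd_mul (c := 2 * B)
    (Continuous.aestronglyMeasurable (by fun_prop)) (Eventually.of_forall fun u => ?_)
  rw [Real.norm_of_nonneg (le_min (by positivity) (by positivity))]
  exact min_le_right _ _

theorem tendsto_smoothingError {L B : ℝ} (hL : 0 ≤ L) (hB : 0 ≤ B) :
    Tendsto (smoothingError L B) (𝓝[>] 0) (𝓝 0) := by
  suffices h : Tendsto (smoothingError L B) (𝓝[>] 0) (𝓝 (∫ _u : ℝ, (0 : ℝ))) by simpa using h
  refine tendsto_integral_filter_of_dominated_convergence (fun u => 2 * B * poissonKernel 1 u)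
    ?_ ?_ (integrable_poissonKernel_one.const_mul _) ?_
  · filter_upwards [self_mem_nhdsWithin] with ε hε
    exact (integrable_smoothingError hL hB hε).aestronglyMeasurable
  · filter_upwards [self_mem_nhdsWithin] with ε hε
    have hε' : 0 < ε := hε
    refine Eventually.of_forall fun u => ?_
    rw [norm_mul, Real.norm_of_nonneg (poissonKernel_nonneg one_pos u),
      Real.norm_of_nonneg (le_min (by positivity) (by positivity))]
    exact mul_le_mul_of_nonneg_right (min_le_right _ _) (poissonKernel_nonneg one_pos u)
  · refine Eventually.of_forall fun u => ?_
    have hc : Continuous fun ε : ℝ => min (L * (ε * |u|)) (2 * B) * poissonKernel 1 u := by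
      fun_prop
    have := hc.tendsto 0
    rw [zero_mul, mul_zero, min_eq_left (by positivity), zero_mul] at this
    exact this.mono_left nhdsWithin_le_nhds

theorem abs_integral_sub_integral_poissonIntegral_le {φ : ℝ → ℝ} {L B : ℝ} (hL : 0 ≤ L)
    (hφ : Continuous φ) (hB : ∀ t, |φ t| ≤ B) (hlip : ∀ s t, |φ s - φ t| ≤ L * |s - t|)
    (hε : 0 < ε) :
    |∫ t, φ t ∂μ - ∫ s, φ s * poissonIntegral μ ε s| ≤ smoothingError L B ε := by
  have hB0 : 0 ≤ B := (abs_nonneg _).trans (hB 0)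
  have hint : ∀ t, Integrable fun u => φ (t + ε * u) * poissonKernel 1 u := fun t =>
    integrable_poissonKernel_one.bdd_mul (c := B)
      (Continuous.aestronglyMeasurable (by fun_prop)) (Eventually.of_forall fun u => hB _)
  have hinner : Integrable (fun t => ∫ u, φ (t + ε * u) * poissonKernel 1 u) μ := by
    have h := (integrable_prod_poissonKernel μ hε hφ hB).integral_prod_right
    simpa only [Function.uncurry, integral_mul_poissonKernel hε] using h
  have hφi : Integrable φ μ :=
    Integrable.of_bound hφ.aestronglyMeasurable B (Eventually.of_forall hB)
  rw [integral_mul_poissonIntegral μ hε hφ hB, ← integral_sub hφi hinner]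
  suffices hpt : ∀ t, ‖φ t - ∫ u, φ (t + ε * u) * poissonKernel 1 u‖ ≤ smoothingError L B ε by
    have := norm_integral_le_of_norm_le_const (μ := μ) (Eventually.of_forall hpt)
    rwa [probReal_univ, mul_one] at this
  intro t
  have h1 : φ t - ∫ u, φ (t + ε * u) * poissonKernel 1 u
      = ∫ u, (φ t - φ (t + ε * u)) * poissonKernel 1 u := by
    simp_rw [sub_mul]
    rw [integral_sub (integrable_poissonKernel_one.const_mul _) (hint t), integral_const_mul,
      integral_poissonKernel_one, mul_one]
  rw [h1]
  refine norm_integral_le_of_norm_le (integrable_smoothingError hL hB0 hε)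
    (Eventually.of_forall fun u => ?_)
  rw [norm_mul, Real.norm_of_nonneg (poissonKernel_nonneg one_pos u)]
  refine mul_le_mul_of_nonneg_right (le_min ?_ ?_) (poissonKernel_nonneg one_pos u)
  · refine (hlip _ _).trans (le_of_eq ?_)
    rw [sub_add_cancel_left, abs_neg, abs_mul, abs_of_pos hε]
  · have h2 := abs_le.mp (hB t)
    have h3 := abs_le.mp (hB (t + ε * u))
    exact abs_le.mpr ⟨by linarith, by linarith⟩

end Poisson

/-- Scheffé's lemma. -/
theorem tendsto_integral_mul_of_tendsto {p : ℕ → ℝ → ℝ} {q : ℝ → ℝ} (hp0 : ∀ n s, 0 ≤ p n s)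
    (hq0 : ∀ s, 0 ≤ q s) (hp : ∀ n, Integrable (p n)) (hq : Integrable q)
    (hp1 : ∀ n, ∫ s, p n s = ∫ s, q s) (hlim : ∀ s, Tendsto (fun n => p n s) atTop (𝓝 (q s)))
    {φ : ℝ → ℝ} (hφ : Continuous φ) {B : ℝ} (hB : ∀ t, |φ t| ≤ B) :
    Tendsto (fun n => ∫ s, φ s * p n s) atTop (𝓝 (∫ s, φ s * q s)) := by
  have hB0 : 0 ≤ B := (abs_nonneg _).trans (hB 0)
  have hpos : Tendsto (fun n => ∫ s, max (q s - p n s) 0) atTop (𝓝 0) := by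
    suffices h : Tendsto (fun n => ∫ s, max (q s - p n s) 0) atTop (𝓝 (∫ _s : ℝ, (0 : ℝ))) by
      simpa using h
    refine tendsto_integral_of_dominated_convergence q
      (fun n => ((hq.sub (hp n)).pos_part).aestronglyMeasurable) hq
      (fun n => Eventually.of_forall fun s => ?_) (Eventually.of_forall fun s => ?_)
    · rw [Real.norm_of_nonneg (le_max_right _ _)]
      exact max_le (by linarith [hp0 n s]) (hq0 s)
    · have := ((tendsto_const_nhds (x := q s)).sub (hlim s)).max
        (tendsto_const_nhds (x := (0 : ℝ)))
      simpa using this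
  -- Equal total integrals reduce the L¹ distance to twice the positive part of q - p_n, which is
  -- dominated by q.
  have habs : ∀ n, ∫ s, |q s - p n s| = 2 * ∫ s, max (q s - p n s) 0 := by
    intro n
    have h1 : ∀ s, |q s - p n s| = 2 * max (q s - p n s) 0 - (q s - p n s) := by
      intro s
      rcases le_total 0 (q s - p n s) with h | h
      · rw [abs_of_nonneg h, max_eq_left h]; ring
      · rw [abs_of_nonpos h, max_eq_right h]; ring
    have h2 := integral_sub ((hq.sub (hp n)).pos_part.const_mul 2) (hq.sub (hp n))
    have h3 := integral_sub hq (hp n)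
    simp only [Pi.sub_apply] at h2
    simp_rw [h1]
    rw [h2, integral_const_mul, h3, hp1 n, sub_self, sub_zero]
  have hbd : ∀ g : ℝ → ℝ, Integrable g → Integrable fun s => φ s * g s := fun g hg =>
    hg.bdd_mul (c := B) hφ.aestronglyMeasurable (Eventually.of_forall hB)
  rw [tendsto_iff_norm_sub_tendsto_zero]
  refine squeeze_zero (g := fun n => B * (2 * ∫ s, max (q s - p n s) 0))
    (fun _ => norm_nonneg _) (fun n => ?_) (by simpa using (hpos.const_mul 2).const_mul B)
  rw [← integral_sub (hbd _ (hp n)) (hbd _ hq), ← habs, ← integral_const_mul]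
  refine norm_integral_le_of_norm_le ((hq.sub (hp n)).abs.const_mul B)
    (Eventually.of_forall fun s => ?_)
  rw [← mul_sub, norm_mul, norm_sub_rev]
  exact mul_le_mul_of_nonneg_right (hB s) (norm_nonneg _)

/-- Convergence of the Stieltjes transforms of probability measures on the upper half plane implies
weak convergence. -/
theorem tendsto_integral_of_tendsto_stieltjes {ρ : ℕ → Measure ℝ} {ν : Measure ℝ}
    [∀ n, IsProbabilityMeasure (ρ n)] [IsProbabilityMeasure ν]
    (h : ∀ x : ℂ, 0 < x.im →
      Tendsto (fun n => ∫ t : ℝ, (x - t)⁻¹ ∂(ρ n)) atTop (𝓝 (∫ t : ℝ, (x - t)⁻¹ ∂ν)))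
    (φ : ℝ →ᵇ ℝ) : Tendsto (fun n => ∫ t, φ t ∂(ρ n)) atTop (𝓝 (∫ t, φ t ∂ν)) := by
  let ρ' : ℕ → ProbabilityMeasure ℝ := fun n => ⟨ρ n, inferInstance⟩
  let ν' : ProbabilityMeasure ℝ := ⟨ν, inferInstance⟩
  suffices hw : Tendsto ρ' atTop (𝓝 ν') from
    ProbabilityMeasure.tendsto_iff_forall_integral_tendsto.mp hw φ
  rw [tendsto_iff_forall_lipschitz_integral_tendsto]
  rintro ψ ⟨C, hC⟩ ⟨K, hK⟩
  change Tendsto (fun n => ∫ t, ψ t ∂(ρ n)) atTop (𝓝 (∫ t, ψ t ∂ν))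
  set B := |ψ 0| + C
  have hB : ∀ t, |ψ t| ≤ B := by
    intro t
    have h1 := hC t 0
    rw [Real.dist_eq] at h1
    have h2 := abs_sub_abs_le_abs_sub (ψ t) (ψ 0)
    simp only [B]; linarith
  have hB0 : 0 ≤ B := (abs_nonneg _).trans (hB 0)
  have hlip : ∀ s t, |ψ s - ψ t| ≤ K * |s - t| := fun s t => by
    simpa [Real.dist_eq] using hK.dist_le_mul s t
  rw [Metric.tendsto_atTop]
  intro δ hδ
  obtain ⟨ε, hε1, hε⟩ := (((tendsto_smoothingError K.coe_nonneg hB0).eventually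
    (gt_mem_nhds (show (0 : ℝ) < δ / 3 by positivity))).and
      (self_mem_nhdsWithin (s := Set.Ioi (0 : ℝ)))).exists
  have hε0 : 0 < ε := hε
  -- At fixed height ε the Poisson integrals are probability densities, converging pointwise because
  -- they are imaginary parts of Stieltjes transforms.
  have hlim := tendsto_integral_mul_of_tendsto (p := fun n => poissonIntegral (ρ n) ε)
    (q := poissonIntegral ν ε) (fun n => poissonIntegral_nonneg _ hε0)
    (poissonIntegral_nonneg _ hε0) (fun n => integrable_poissonIntegral _ hε0)
    (integrable_poissonIntegral _ hε0)
    (fun n => by rw [integral_poissonIntegral _ hε0, integral_poissonIntegral _ hε0])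
    (fun s => by
      simp only [poissonIntegral_eq_im _ hε0]
      exact ((Complex.continuous_im.tendsto _).comp
        (h (s + ε * Complex.I) (by simpa using hε0))).const_mul _) hK.continuous hB
  obtain ⟨N, hN⟩ := Metric.tendsto_atTop.mp hlim (δ / 3) (by positivity)
  refine ⟨N, fun n hn => ?_⟩
  have h1 := abs_integral_sub_integral_poissonIntegral_le (ρ n) K.coe_nonneg hK.continuous hB hlip
    hε0
  have h2 := abs_integral_sub_integral_poissonIntegral_le ν K.coe_nonneg hK.continuous hB hlip hε0
  have h3 := hN n hn
  rw [Real.dist_eq] at h3 ⊢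
  rw [abs_le] at h1 h2
  rw [abs_lt] at h3 ⊢
  constructor <;> linarith

/-! ### Averages as integrals of step functions. -/

theorem stronglyMeasurable_comp_floor {E : Type*} [TopologicalSpace E]
    [TopologicalSpace.PseudoMetrizableSpace E] (g : ℕ → E) (n : ℕ) :
    StronglyMeasurable fun s : ℝ => g ⌊(n : ℝ) * s⌋₊ :=
  (StronglyMeasurable.of_discrete (f := g)).comp_measurable
    (Nat.measurable_floor.comp (measurable_const_mul (n : ℝ)))

/-- The integral of a step function. -/
theorem setIntegral_comp_floor (g : ℕ → ℂ) {n : ℕ} (hn : 0 < n) :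
    ∫ s in Set.Ioo (0 : ℝ) 1, g ⌊(n : ℝ) * s⌋₊ = (n : ℂ)⁻¹ * ∑ i ∈ Finset.range n, g i := by
  have hn0 : (0 : ℝ) < n := by exact_mod_cast hn
  set a : ℕ → ℝ := fun k => k / n with ha
  have hle : ∀ k, a k ≤ a (k + 1) := fun k => by simp only [ha]; gcongr; simp
  have hae : ∀ k, ∀ᵐ s ∂volume.restrict (Set.Ioc (a k) (a (k + 1))), g k = g ⌊(n : ℝ) * s⌋₊ := by
    intro k
    rw [← restrict_Ioo_eq_restrict_Ioc]
    filter_upwards [ae_restrict_mem measurableSet_Ioo] with s hs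
    have h1 := (div_lt_iff₀ hn0).mp hs.1
    have h2 := (lt_div_iff₀ hn0).mp hs.2
    push_cast at h2
    congr 1
    refine ((Nat.floor_eq_iff (by linarith [k.cast_nonneg (α := ℝ)])).mpr ⟨?_, ?_⟩).symm <;> linarith
  have hpiece : ∀ k, IntervalIntegrable (fun s => g ⌊(n : ℝ) * s⌋₊) volume (a k) (a (k + 1)) ∧
      ∫ s in (a k)..(a (k + 1)), g ⌊(n : ℝ) * s⌋₊ = (n : ℂ)⁻¹ * g k := by
    intro k
    rw [intervalIntegrable_iff_integrableOn_Ioc_of_le (hle k), intervalIntegral.integral_of_le (hle k)]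
    refine ⟨(integrableOn_const (by simp)).congr (hae k), ?_⟩
    rw [← integral_congr_ae (hae k), setIntegral_const, Real.volume_real_Ioc_of_le (hle k)]
    have : a (k + 1) - a k = (n : ℝ)⁻¹ := by simp only [ha]; push_cast; field_simp; ring
    rw [this, Complex.real_smul]
    push_cast; rfl
  have hsum := intervalIntegral.sum_integral_adjacent_intervals (n := n) fun k _ => (hpiece k).1
  rw [Finset.sum_congr rfl fun k _ => (hpiece k).2, ← Finset.mul_sum] at hsum
  rw [hsum]
  have h0 : a 0 = 0 := by simp [ha]
  have h1 : a n = 1 := by simp [ha, hn0.ne']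
  rw [h0, h1, intervalIntegral.integral_of_le zero_le_one, integral_Ioc_eq_integral_Ioo]

/-- The average of `g` over the block of length `r` containing `i`. -/
def blockAverage (r : ℕ) (g : ℕ → ℂ) (i : ℕ) : ℂ :=
  (r : ℂ)⁻¹ * ∑ a ∈ Finset.range r, g (r * (i / r) + a)

theorem norm_blockAverage_le {r : ℕ} (hr : 1 ≤ r) {g : ℕ → ℂ} {K : ℝ} (hg : ∀ i, ‖g i‖ ≤ K) (i : ℕ) :
    ‖blockAverage r g i‖ ≤ K := by
  have hr0 : (0 : ℝ) < r := by exact_mod_cast hr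
  rw [blockAverage, norm_mul, norm_inv, Complex.norm_natCast, inv_mul_le_iff₀ hr0]
  exact (norm_sum_le _ _).trans ((Finset.sum_le_sum fun a _ => hg _).trans (by simp))

theorem sum_blockAverage {r : ℕ} (hr : 1 ≤ r) (g : ℕ → ℂ) (q : ℕ) :
    ∑ i ∈ Finset.range (r * q), blockAverage r g i = ∑ i ∈ Finset.range (r * q), g i := by
  have hr0 : (r : ℂ) ≠ 0 := by exact_mod_cast (by omega : r ≠ 0)
  induction q with
  | zero => simp
  | succ q ih =>
    rw [mul_add, mul_one, Finset.sum_range_add, Finset.sum_range_add, ih]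
    congr 1
    have : ∀ a ∈ Finset.range r, blockAverage r g (r * q + a) = blockAverage r g (r * q) := by
      intro a ha
      rw [blockAverage, blockAverage, Nat.mul_add_div hr,
        Nat.div_eq_of_lt (Finset.mem_range.mp ha), Nat.mul_div_cancel_left _ hr, add_zero]
    rw [Finset.sum_congr rfl this, Finset.sum_const, Finset.card_range, nsmul_eq_mul, blockAverage,
      mul_inv_cancel_left₀ hr0, Nat.mul_div_cancel_left _ hr]

/-- Complete blocks contribute equally to both sums; only the last, incomplete one, with fewer than
r terms, differs. -/
theorem norm_sum_blockAverage_sub_sum_le {r : ℕ} (hr : 1 ≤ r) {g : ℕ → ℂ} {K : ℝ}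
    (hg : ∀ i, ‖g i‖ ≤ K) (n : ℕ) :
    ‖∑ i ∈ Finset.range n, blockAverage r g i - ∑ i ∈ Finset.range n, g i‖ ≤ 2 * r * K := by
  have hK : 0 ≤ K := (norm_nonneg _).trans (hg 0)
  have hmod : n % r < r := Nat.mod_lt _ hr
  have hb : ∀ h : ℕ → ℂ, (∀ i, ‖h i‖ ≤ K) →
      ‖∑ a ∈ Finset.range (n % r), h (r * (n / r) + a)‖ ≤ r * K := by
    intro h hh
    refine (norm_sum_le _ _).trans ((Finset.sum_le_sum fun a _ => hh _).trans ?_)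
    rw [Finset.sum_const, Finset.card_range, nsmul_eq_mul]
    gcongr
  rw [← Nat.div_add_mod n r, Finset.sum_range_add, Finset.sum_range_add, sum_blockAverage hr,
    add_sub_add_left_eq_sub]
  refine (norm_sub_le _ _).trans ?_
  linarith [hb g hg, hb _ (norm_blockAverage_le hr hg)]

/-- Averages of uniformly bounded sequences, in terms of the limits of their block averages. -/
theorem tendsto_average {r : ℕ} (hr : 1 ≤ r) {g : ℕ → ℕ → ℂ} {K : ℝ} (hg : ∀ n i, ‖g n i‖ ≤ K)
    {G : ℝ → ℂ} (hlim : ∀ s ∈ Set.Ioo (0 : ℝ) 1,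
      Tendsto (fun n => blockAverage r (g n) ⌊(n : ℝ) * s⌋₊) atTop (𝓝 (G s))) :
    Tendsto (fun n : ℕ => (n : ℂ)⁻¹ * ∑ i ∈ Finset.range n, g n i) atTop
      (𝓝 (∫ s in Set.Ioo (0 : ℝ) 1, G s)) := by
  have h1 : Tendsto (fun n : ℕ => ∫ s in Set.Ioo (0 : ℝ) 1, blockAverage r (g n) ⌊(n : ℝ) * s⌋₊)
      atTop (𝓝 (∫ s in Set.Ioo (0 : ℝ) 1, G s)) := by
    refine tendsto_integral_of_dominated_convergence (fun _ => K)
      (fun n => (stronglyMeasurable_comp_floor _ n).aestronglyMeasurable)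
      (integrable_const _)
      (fun n => Eventually.of_forall fun s => norm_blockAverage_le hr (hg n) _) ?_
    exact (ae_restrict_mem measurableSet_Ioo).mono hlim
  refine tendsto_of_tendsto_of_dist h1 (squeeze_zero' (g := fun n : ℕ => (n : ℝ)⁻¹ * (2 * r * K))
    (Eventually.of_forall fun _ => dist_nonneg) ?_ ?_)
  · filter_upwards [eventually_gt_atTop 0] with n hn
    rw [setIntegral_comp_floor _ hn, dist_eq_norm, ← mul_sub, norm_mul, norm_inv,
      Complex.norm_natCast]
    gcongr
    exact norm_sum_blockAverage_sub_sum_le hr (hg n) n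
  · simpa using tendsto_inv_atTop_nhds_zero_nat.mul_const (2 * r * K)

theorem isProbabilityMeasure_countingMeasure {n : ℕ} (hn : 0 < n) (x : Fin n → ℝ) :
    IsProbabilityMeasure (countingMeasure x) := by
  refine ⟨?_⟩
  have h0 : (n : ENNReal) ≠ 0 := by exact_mod_cast hn.ne'
  rw [countingMeasure, Measure.smul_apply, Measure.finsetSum_apply]
  simp [ENNReal.inv_mul_cancel h0 (ENNReal.natCast_ne_top n)]

/-- The logarithmic derivative of Q_n telescopes over the ratios, starting from Q_0 = 1. -/
theorem HasInterlacingZeros.integral_inv_sub_countingMeasure {Q : ℕ → ℂ[X]}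
    {x : (k : ℕ) → Fin k → ℝ} (hx : HasInterlacingZeros Q x) (hm : ∀ k, (Q k).Monic)
    (hd : ∀ k, (Q k).natDegree = k) (n : ℕ) {z : ℂ} (hz : 0 < z.im) :
    ∫ t : ℝ, (z - t)⁻¹ ∂(countingMeasure (x n))
      = (n : ℂ)⁻¹ * ∑ i ∈ Finset.range n, -(deriv (ratio Q i) z / ratio Q i z) := by
  have h1 : ∫ t : ℝ, (z - t)⁻¹ ∂(countingMeasure (x n)) = (n : ℂ)⁻¹ * ∑ j, (z - x n j)⁻¹ := by
    rw [countingMeasure, integral_smul_measure, integral_finsetSum_measure fun j _ => by simp [integrable_dirac]]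
    simp [integral_dirac]
  have hQ0 : ∀ k, (Q k).eval z ≠ 0 := fun k => hx.eval_ne_zero hm hd k hz
  have h2 : ∀ k, logDeriv (fun w => (Q k).eval w) z = ∑ j, (z - x k j)⁻¹ := by
    intro k
    rw [hx.eq_prod hm hd k]
    simp only [eval_prod, eval_sub, eval_X, eval_C]
    rw [logDeriv_prod (f := fun j w => w - (x k j : ℂ)) (fun j _ => sub_ofReal_ne_zero hz _) (fun j _ => by fun_prop)]
    refine Finset.sum_congr rfl fun j _ => ?_
    simp [logDeriv_apply]
  have h3 : ∀ k, logDeriv (ratio Q k) z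
      = logDeriv (fun w => (Q k).eval w) z - logDeriv (fun w => (Q (k + 1)).eval w) z := by
    intro k
    exact logDeriv_div z (hQ0 k) (hQ0 (k + 1)) (Q k).differentiableAt (Q (k + 1)).differentiableAt
  have h4 : ∑ i ∈ Finset.range n, -(deriv (ratio Q i) z / ratio Q i z)
      = logDeriv (fun w => (Q n).eval w) z := by
    have h5 : ∀ i, -(deriv (ratio Q i) z / ratio Q i z)
        = logDeriv (fun w => (Q (i + 1)).eval w) z - logDeriv (fun w => (Q i).eval w) z := by
      intro i
      rw [← logDeriv_apply, h3, neg_sub]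
    rw [Finset.sum_congr rfl fun i _ => h5 i, Finset.sum_range_sub
      fun i => logDeriv (fun w => (Q i).eval w) z, h2 0]
    simp
  rw [h1, h4, h2]

/-! ### Integration over s. -/

section Assembly

variable {r : ℕ} [NeZero r] {β : ℕ} {J : ℕ → ℕ → ℕ → ℂ} {Q : ℕ → ℕ → ℂ[X]}
  {A : ℝ → ℤ → Matrix (Fin r) (Fin r) ℂ} {x : ℕ → (k : ℕ) → Fin k → ℝ}

/-- The limits of the ratios of consecutive polynomials, for `0 < s < 1`. -/
structure IsRatioLimitFamily (β : ℕ) (Q : ℕ → ℕ → ℂ[X]) (A : ℝ → ℤ → Matrix (Fin r) (Fin r) ℂ)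
    (U : ℝ → ℤ → ℂ → ℂ) : Prop where
  isRegularSymbol : ∀ s ∈ Set.Ioo (0 : ℝ) 1, IsRegularSymbol β (A s) (U s)
  tendsto : ∀ s ∈ Set.Ioo (0 : ℝ) 1, ∀ (p : ℕ) (z : ℂ), 0 < z.im →
    Tendsto (fun n : ℕ => ratio (Q n) (r * (⌊(n : ℝ) * s⌋₊ / r) + p) z) atTop (𝓝 (U s p z))

theorem exists_isRatioLimitFamily (hA : IsLocallyBlockToeplitz r β J A)
    (hQ : ∀ n, IsGeneratedBy r β (J n) (Q n)) (hx : ∀ n, HasInterlacingZeros (Q n) (x n))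
    (hroot : ∀ s : ℝ, 0 < s → s < 1 → ∀ y : ℂ, ∃ z : ℂ, z ≠ 0 ∧ f β (A s) z y = 0)
    (hΓ : ∀ s : ℝ, 0 ≤ s → Gamma1 β (A s) ⊆ Set.range ((↑) : ℝ → ℂ)) :
    ∃ U, IsRatioLimitFamily β Q A U := by
  have h : ∀ s : ℝ, ∃ U : ℤ → ℂ → ℂ, 0 < s → IsLimitRatio (r * (β + 1)) (toeplitz β (A s)) U ∧
      ∀ i z, 0 < z.im → Tendsto (fun p : ℕ × ℕ =>
        ratio (Q p.2) ((r : ℤ) * (p.1 : ℕ) + i).toNat z) (ratioFilter r s) (𝓝 (U i z)) := by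
    intro s
    by_cases hs : 0 < s
    · obtain ⟨U, hU⟩ := exists_isLimitRatio hA hQ hx hs
      exact ⟨U, fun _ => hU⟩
    · exact ⟨fun _ _ => 0, fun h => absurd h hs⟩
  choose U hU using h
  refine ⟨U, fun s hs => ⟨hA.isPeriodicHessenberg hQ hs.1, (hU s hs.1).1,
    fun j hj a b => hA.conj_eq hQ hx hs.1 hj a b, hroot s hs.1 hs.2, hΓ s hs.1.le⟩,
    fun s hs p z hz => ?_⟩
  refine (((hU s hs.1).2 p z hz).comp
    (tendsto_floor_ratioFilter (one_le_of_neZero r) hs.1)).congr fun n => ?_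
  simp only [Function.comp]
  congr 1

namespace IsRatioLimitFamily

variable {U : ℝ → ℤ → ℂ → ℂ}

/-- U is chosen separately for each s; measurability in s comes from the step functions converging
to it. -/
theorem measurable_indicator_ratio (h : IsRatioLimitFamily β Q A U) (p : ℕ) {z : ℂ} (hz : 0 < z.im) :
    Measurable (Set.indicator (Set.Ioo (0 : ℝ) 1) fun s => U s p z) := by
  refine measurable_of_tendsto_metrizable (f := fun (n : ℕ) => Set.indicator (Set.Ioo (0 : ℝ) 1)
    fun s => ratio (Q n) (r * (⌊(n : ℝ) * s⌋₊ / r) + p) z) (fun n => ?_) ?_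
  · exact ((stronglyMeasurable_comp_floor (fun i => ratio (Q n) (r * (i / r) + p) z)
      n).measurable).indicator measurableSet_Ioo
  · rw [tendsto_pi_nhds]
    intro s
    by_cases hs : s ∈ Set.Ioo (0 : ℝ) 1
    · simp only [Set.indicator_of_mem hs]
      exact h.tendsto s hs p z hz
    · simp only [Set.indicator_of_notMem hs]
      exact tendsto_const_nhds

theorem measurable_indicator_phase (h : IsRatioLimitFamily β Q A U) (t : ℝ) :
    Measurable (Set.indicator (Set.Ioo (0 : ℝ) 1) fun s => phase r (U s) t) := by
  have hup : Tendsto (fun n : ℕ => (t : ℂ) + (((n : ℝ) + 1)⁻¹ : ℝ) * Complex.I) atTop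
      (𝓝[upperHalf] (t : ℂ)) := by
    refine tendsto_nhdsWithin_iff.mpr ⟨?_, Eventually.of_forall fun n => ?_⟩
    · have h1 : Tendsto (fun n : ℕ => ((n : ℝ) + 1)⁻¹) atTop (𝓝 0) := by
        simpa using tendsto_one_div_add_atTop_nhds_zero_nat (𝕜 := ℝ)
      have hc : Continuous fun y : ℝ => (t : ℂ) + y * Complex.I := by fun_prop
      have h2 := (hc.tendsto 0).comp h1
      simpa [Function.comp_def] using h2
    · have : (0 : ℝ) < ((n : ℝ) + 1)⁻¹ := by positivity
      rw [mem_upperHalf, Complex.add_im, Complex.ofReal_im, Complex.im_ofReal_mul, Complex.I_im,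
        mul_one, zero_add]
      exact this
  refine measurable_of_tendsto_metrizable (f := fun n : ℕ => Set.indicator (Set.Ioo (0 : ℝ) 1)
    fun s => (logSum r (U s) ((t : ℂ) + (((n : ℝ) + 1)⁻¹ : ℝ) * Complex.I)).im / (Real.pi * r))
    (fun n => ?_) ?_
  · set z : ℂ := (t : ℂ) + (((n : ℝ) + 1)⁻¹ : ℝ) * Complex.I with hzdef
    have hz : 0 < z.im := by
      have : (0 : ℝ) < ((n : ℝ) + 1)⁻¹ := by positivity
      rw [hzdef, Complex.add_im, Complex.ofReal_im, Complex.im_ofReal_mul, Complex.I_im,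
        mul_one, zero_add]
      exact this
    have heq : (Set.indicator (Set.Ioo (0 : ℝ) 1)
        fun s => (logSum r (U s) z).im / (Real.pi * r)) = fun s =>
          (-∑ p ∈ Finset.range r, Complex.log
            (Set.indicator (Set.Ioo (0 : ℝ) 1) (fun s => U s p z) s)).im / (Real.pi * r) := by
      ext s
      by_cases hs : s ∈ Set.Ioo (0 : ℝ) 1
      · simp only [Set.indicator_of_mem hs, logSum]
      · simp [Set.indicator_of_notMem hs]
    rw [heq]
    refine Measurable.div_const (Complex.measurable_im.comp (Measurable.neg
      (Finset.measurable_fun_sum _ fun p _ => ?_))) _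
    exact Complex.measurable_log.comp (h.measurable_indicator_ratio p hz)
  · rw [tendsto_pi_nhds]
    intro s
    by_cases hs : s ∈ Set.Ioo (0 : ℝ) 1
    · simp only [Set.indicator_of_mem hs]
      exact ((h.isRegularSymbol s hs).tendsto_im_logSum t).comp hup
    · simp only [Set.indicator_of_notMem hs]
      exact tendsto_const_nhds

open Classical in
/-- The measures `μ₁`, modified to be a point mass for `s` not in `(0, 1)`. -/
def measureFamily (β : ℕ) (A : ℝ → ℤ → Matrix (Fin r) (Fin r) ℂ) (s : ℝ) : Measure ℝ :=
  if s ∈ Set.Ioo (0 : ℝ) 1 then mu1 β (A s) else Measure.dirac 0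

theorem isProbabilityMeasure_measureFamily (h : IsRatioLimitFamily β Q A U) (s : ℝ) :
    IsProbabilityMeasure (measureFamily β A s) := by
  unfold measureFamily
  split_ifs with hs
  · exact (h.isRegularSymbol s hs).isProbabilityMeasure_mu1
  · infer_instance

/-- Half-open intervals form a generating π-system, and their masses are differences of phases,
which are measurable in s. -/
theorem measurable_measureFamily (h : IsRatioLimitFamily β Q A U) :
    Measurable (measureFamily β A) := by
  have := h.isProbabilityMeasure_measureFamily
  refine Measurable.measure_of_isPiSystem_of_isProbabilityMeasure
    (S := {S : Set ℝ | ∃ l u, l < u ∧ Set.Ioc l u = S})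
    ((BorelSpace.measurable_eq (α := ℝ)).trans (borel_eq_generateFrom_Ioc ℝ))
    (by simpa using isPiSystem_Ioc (id : ℝ → ℝ) id) ?_
  rintro - ⟨a, b, hab, rfl⟩
  classical
  have heq : (fun s => measureFamily β A s (Set.Ioc a b)) = fun s =>
      if s ∈ Set.Ioo (0 : ℝ) 1 then ENNReal.ofReal
        (Set.indicator (Set.Ioo (0 : ℝ) 1) (fun s => phase r (U s) a) s
          - Set.indicator (Set.Ioo (0 : ℝ) 1) (fun s => phase r (U s) b) s)
      else Measure.dirac 0 (Set.Ioc a b) := by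
    ext s
    by_cases hs : s ∈ Set.Ioo (0 : ℝ) 1
    · rw [measureFamily, if_pos hs, if_pos hs, ((h.isRegularSymbol s hs).mu1_Ioc hab.le).2,
        Set.indicator_of_mem hs, Set.indicator_of_mem hs]
    · rw [measureFamily, if_neg hs, if_neg hs]
  rw [heq]
  exact Measurable.ite measurableSet_Ioo (((h.measurable_indicator_phase a).sub
    (h.measurable_indicator_phase b)).ennreal_ofReal) measurable_const

theorem nu1_eq {r : ℕ} (β : ℕ) (A : ℝ → ℤ → Matrix (Fin r) (Fin r) ℂ) :
    nu1 β A = Measure.bind (volume.restrict (Set.Ioo (0 : ℝ) 1)) (measureFamily β A) := by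
  -- The endpoints s = 0 and s = 1, where the symbol need not be regular, form a null set.
  rw [nu1, ← Measure.restrict_congr_set Ioo_ae_eq_Icc]
  refine Measure.bind_congr_right ?_
  filter_upwards [ae_restrict_mem measurableSet_Ioo] with s hs
  rw [measureFamily, if_pos hs]

theorem isProbabilityMeasure_nu1 (h : IsRatioLimitFamily β Q A U) :
    IsProbabilityMeasure (nu1 β A) := by
  have := h.isProbabilityMeasure_measureFamily
  refine ⟨?_⟩
  rw [nu1_eq, Measure.bind_apply MeasurableSet.univ h.measurable_measureFamily.aemeasurable]
  simp

/-- Viewing ν₁ as the second marginal of a kernel product makes Fubini for vector-valued integrands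
available. -/
theorem integral_nu1 (h : IsRatioLimitFamily β Q A U) {φ : ℝ → ℂ} (hφ : Continuous φ) {B : ℝ}
    (hB : ∀ t, ‖φ t‖ ≤ B) :
    ∫ t, φ t ∂(nu1 β A) = ∫ s in Set.Ioo (0 : ℝ) 1, ∫ t, φ t ∂(mu1 β (A s)) := by
  have := h.isProbabilityMeasure_measureFamily
  let κ : ProbabilityTheory.Kernel ℝ ℝ := ⟨measureFamily β A, h.measurable_measureFamily⟩
  have hκ : ProbabilityTheory.IsMarkovKernel κ := ⟨this⟩
  set m : Measure ℝ := volume.restrict (Set.Ioo (0 : ℝ) 1)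
  have h1 : nu1 β A = (m.compProd κ).snd := by
    rw [Measure.snd_compProd, nu1_eq]
    rfl
  have hi : Integrable (fun p : ℝ × ℝ => φ p.2) (m.compProd κ) :=
    Integrable.of_bound (Continuous.aestronglyMeasurable (by fun_prop)) B
      (Eventually.of_forall fun p => hB _)
  rw [h1, Measure.snd, integral_map measurable_snd.aemeasurable hφ.aestronglyMeasurable,
    Measure.integral_compProd hi]
  refine integral_congr_ae ?_
  filter_upwards [ae_restrict_mem measurableSet_Ioo] with s hs
  change ∫ t, φ t ∂(measureFamily β A s) = _
  rw [measureFamily, if_pos hs]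

/-- A block average covers exactly one period of ratios, which is the form of the Stieltjes
transform of μ₁^s; derivatives converge along with the ratios. -/
theorem tendsto_blockAverage (h : IsRatioLimitFamily β Q A U)
    (hst : ∀ n i, IsStieltjesLike (ratio (Q n) i)) {z : ℂ} (hz : 0 < z.im) {s : ℝ}
    (hs : s ∈ Set.Ioo (0 : ℝ) 1) :
    Tendsto (fun n : ℕ => blockAverage r
      (fun i => -(deriv (ratio (Q n) i) z / ratio (Q n) i z)) ⌊(n : ℝ) * s⌋₊) atTop
      (𝓝 (∫ t : ℝ, (z - t)⁻¹ ∂(mu1 β (A s)))) := by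
  have hR := h.isRegularSymbol s hs
  rw [hR.integral_inv_sub_mu1 hz, ← mul_neg, ← Finset.sum_neg_distrib]
  refine Tendsto.const_mul _ (tendsto_finsetSum _ fun p _ => Tendsto.neg (Tendsto.div ?_
    (h.tendsto s hs p z hz) (hR.limitRatio.ne_zero p hz)))
  exact IsStieltjesLike.tendsto_deriv (fun n => hst _ _) (fun w hw => h.tendsto s hs p w hw) hz

end IsRatioLimitFamily

end Assembly

end BlockToeplitz

end

/-! ### The main theorem. -/

open BlockToeplitz in
theorem theorem2p3 (r β : ℕ) (hr : 1 ≤ r)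
    (J : ℕ → ℕ → ℕ → ℂ) (Q : ℕ → ℕ → ℂ[X])
    (hQ : ∀ n, BlockToeplitz.IsGeneratedBy r β (J n) (Q n))
    (A : ℝ → ℤ → Matrix (Fin r) (Fin r) ℂ)
    (hA : BlockToeplitz.IsLocallyBlockToeplitz r β J A)
    (x : ℕ → (k : ℕ) → Fin k → ℝ)
    (hx : ∀ n, BlockToeplitz.HasInterlacingZeros (Q n) (x n))
    (hroot : ∀ s : ℝ, 0 < s → s < 1 → ∀ y : ℂ, ∃ z : ℂ, z ≠ 0 ∧ BlockToeplitz.f β (A s) z y = 0)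
    (hΓ : ∀ s : ℝ, 0 ≤ s → BlockToeplitz.Gamma1 β (A s) ⊆ Set.range ((↑) : ℝ → ℂ)) :
    IsProbabilityMeasure (BlockToeplitz.nu1 β A) ∧
    ∀ φ : ℝ →ᵇ ℝ,
      Tendsto (fun n : ℕ => ∫ t, φ t ∂(BlockToeplitz.countingMeasure (x n n))) atTop
        (𝓝 (∫ t, φ t ∂(BlockToeplitz.nu1 β A))) := by
  have : NeZero r := ⟨by omega⟩
  obtain ⟨U, hU⟩ := exists_isRatioLimitFamily hA hQ hx hroot hΓ
  have hν := hU.isProbabilityMeasure_nu1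
  refine ⟨hν, fun φ => ?_⟩
  have hst : ∀ n i, IsStieltjesLike (ratio (Q n) i) := fun n i =>
    (hx n).isStieltjesLike_ratio (hQ n).monic (hQ n).natDegree_eq i
  have hprob : ∀ n : ℕ, IsProbabilityMeasure (countingMeasure (x (n + 1) (n + 1))) :=
    fun n => isProbabilityMeasure_countingMeasure n.succ_pos _
  -- The index is shifted because the counting measure for n = 0 is zero, not a probability measure.
  refine (tendsto_add_atTop_iff_nat 1).mp (tendsto_integral_of_tendsto_stieltjes
    (ρ := fun n => countingMeasure (x (n + 1) (n + 1))) (fun z hz => ?_) φ)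
  refine (tendsto_add_atTop_iff_nat (f := fun n => ∫ t : ℝ, (z - t)⁻¹
    ∂(countingMeasure (x n n))) 1).mpr ?_
  rw [hU.integral_nu1 (continuous_inv_sub_ofReal hz) (norm_inv_sub_ofReal_le hz)]
  refine (tendsto_average hr (g := fun n i => -(deriv (ratio (Q n) i) z / ratio (Q n) i z))
    (K := z.im⁻¹) (fun n i => ?_) fun s hs => hU.tendsto_blockAverage hst hz hs).congr fun n => ?_
  · rw [norm_neg]
    exact (hst n i).norm_logDeriv_le hz
  · exact ((hx n).integral_inv_sub_countingMeasure (hQ n).monic (hQ n).natDegree_eq n hz).symm
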